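/- Let $\mathrm{M}$ be a loopless matroid of rank $d$ on a finite set $E$. The augmented Chow ring of $\mathrm{M}$ is the graded $\mathbb{Q}$-algebra $$\mathrm{CH}(\mathrm{M})=\mathbb{Q}\big[y_e\ (e\in E),\ x_F\ (F \text{ a proper flat of } \mathrm{M})\big]/(I_{\mathrm{M}}+J_{\mathrm{M}}),$$ where all variables have degree $1$, $I_{\mathrm{M}}$ is generated by the linear forms $y_e-\sum_{F\not\ni e}x_F$ for $e\in E$, and $J_{\mathrm{M}}$ is generated by the monomials $x_{F_1}x_{F_2}$ for incomparable proper flats $F_1,F_2$ and $y_e x_F$ for $e\notin F$. There is a unique linear map $\deg_{\mathrm{M}}:\mathrm{CH}^d(\mathrm{M})\to\mathbb{Q}$ (the degree map) with $\deg_{\mathrm{M}}\big(\prod_{e\in I}y_e\prod_{F\in\mathscr{F}}x_F\big)=1$ whenever $I$ is an independent set, $\mathscr{F}$ is a flag of proper flats each containing $I$, and $|I|+|\mathscr{F}|=d$. The Poincaré pairing is $\mathrm{CH}^k(\mathrm{M})\times\mathrm{CH}^{d-k}(\mathrm{M})\to\mathbb{Q}$, $(\eta_1,\eta_2)\mapsto\deg_{\mathrm{M}}(\eta_1\eta_2)$.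 Let $i\in E$, let $\mathrm{M}\setminus i$ be the deletion, and let $\theta_i:\mathrm{CH}(\mathrm{M}\setminus i)\to\mathrm{CH}(\mathrm{M})$ be the graded algebra homomorphism with $x_F\mapsto x_F+x_{F\cup i}$ and $y_e\mapsto y_e$, where a variable in the target is set to zero if its label is not a flat of $\mathrm{M}$. Regard $\mathrm{CH}(\mathrm{M})$ as a $\mathrm{CH}(\mathrm{M}\setminus i)$-module through $\theta_i$, let $\mathrm{CH}_{(i)}$ be the image of $\theta_i$, and let $\mathscr{S}_i$ be the collection of proper subsets $F$ of $E\setminus i$ such that $F$ and $F\cup i$ are both flats of $\mathrm{M}$. 1. If $i$ is not a coloop of $\mathrm{M}$, there is a direct sum decomposition of $\mathrm{CH}(\mathrm{M})$ into indecomposable (in particular nonzero) cyclic graded $\mathrm{CH}(\mathrm{M}\setminus i)$-modules $$\mathrm{CH}(\mathrm{M})=\mathrm{CH}_{(i)}\oplus\bigoplus_{F\in\mathscr{S}_i}x_{F\cup i}\,\mathrm{CH}_{(i)},$$ and all pairs of distinct summands are orthogonal for the Poincaré pairing of $\mathrm{CH}(\mathrm{M})$. 2. If $i$ is a coloop of $\mathrm{M}$,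 there is a direct sum decomposition of $\mathrm{CH}(\mathrm{M})$ into indecomposable (in particular nonzero) cyclic graded $\mathrm{CH}(\mathrm{M}\setminus i)$-modules $$\mathrm{CH}(\mathrm{M})=\mathrm{CH}_{(i)}\oplus x_{E\setminus i}\,\mathrm{CH}_{(i)}\oplus\bigoplus_{F\in\mathscr{S}_i}x_{F\cup i}\,\mathrm{CH}_{(i)},$$ and all pairs of distinct summands except for the first two are orthogonal for the Poincaré pairing of $\mathrm{CH}(\mathrm{M})$; the first two are not orthogonal. Here indecomposability holds already in the category of ungraded modules. -/

import Mathlib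

noncomputable section

namespace Matroid

open Set MvPolynomial

universe u

variable {α : Type u}

/-- The proper flats of `M`: the flats different from the ground set. -/
def ProperFlat (M : Matroid α) : Type u := {F : Set α // M.IsFlat F ∧ F ≠ M.E}

instance ProperFlat.finite (M : Matroid α) [M.Finite] : Finite M.ProperFlat :=
  haveI : Finite {S : Set α // S ∈ 𝒫 M.E} := M.ground_finite.finite_subsets.to_subtype
  Finite.of_injective
    (fun F : M.ProperFlat ↦ (⟨F.1, F.2.1.subset_ground⟩ : {S : Set α // S ∈ 𝒫 M.E}))
    (fun _ _ h ↦ Subtype.ext (congrArg (fun S : {S : Set α // S ∈ 𝒫 M.E} ↦ S.1) h))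

instance ProperFlat.fintype (M : Matroid α) [M.Finite] : Fintype M.ProperFlat :=
  Fintype.ofFinite _

/-- The polynomial ring over `ℚ` in the variables `y_e` (for `e` in the ground set) and `x_F`
(for `F` a proper flat). -/
abbrev ChowPoly (M : Matroid α) : Type u := MvPolynomial (↥M.E ⊕ M.ProperFlat) ℚ

/-- The ideal generated by the linear forms `y_e - ∑_{e ∉ F} x_F`. -/
def linearIdeal (M : Matroid α) [M.Finite] : Ideal M.ChowPoly :=
  open scoped Classical in
  Ideal.span {p | ∃ e : ↥M.E,
    p = X (Sum.inl e) - ∑ F : M.ProperFlat with e.1 ∉ F.1, X (Sum.inr F)}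

/-- The ideal generated by the monomials `x_{F₁} x_{F₂}` for incomparable proper flats, and
`y_e x_F` for `e ∉ F`. -/
def quadraticIdeal (M : Matroid α) : Ideal M.ChowPoly :=
  Ideal.span
    ({p | ∃ F₁ F₂ : M.ProperFlat, ¬ F₁.1 ⊆ F₂.1 ∧ ¬ F₂.1 ⊆ F₁.1 ∧
        p = X (Sum.inr F₁) * X (Sum.inr F₂)} ∪
     {p | ∃ (e : ↥M.E) (F : M.ProperFlat), e.1 ∉ F.1 ∧ p = X (Sum.inl e) * X (Sum.inr F)})

/-- The augmented Chow ring `CH(M)`. -/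
def AugChow (M : Matroid α) [M.Finite] : Type u :=
  M.ChowPoly ⧸ (M.linearIdeal + M.quadraticIdeal)

instance (M : Matroid α) [M.Finite] : CommRing M.AugChow :=
  inferInstanceAs (CommRing (M.ChowPoly ⧸ (M.linearIdeal + M.quadraticIdeal)))

instance (M : Matroid α) [M.Finite] : Algebra ℚ M.AugChow :=
  inferInstanceAs (Algebra ℚ (M.ChowPoly ⧸ (M.linearIdeal + M.quadraticIdeal)))

/-- The quotient map onto `CH(M)`. -/
def chowMk (M : Matroid α) [M.Finite] : M.ChowPoly →ₐ[ℚ] M.AugChow :=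
  Ideal.Quotient.mkₐ ℚ (M.linearIdeal + M.quadraticIdeal)

/-- The class of the variable `y_e`. -/
def chowY (M : Matroid α) [M.Finite] (e : ↥M.E) : M.AugChow := M.chowMk (X (Sum.inl e))

open scoped Classical in
/-- The class of the variable `x_S`, set to zero if `S` is not a proper flat. -/
def chowX (M : Matroid α) [M.Finite] (S : Set α) : M.AugChow :=
  if h : M.IsFlat S ∧ S ≠ M.E then M.chowMk (X (Sum.inr ⟨S, h⟩)) else 0

/-- The graded piece `CH^k(M)`. -/
def chowGr (M : Matroid α) [M.Finite] (k : ℕ) : Submodule ℚ M.AugChow :=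
  (homogeneousSubmodule (↥M.E ⊕ M.ProperFlat) ℚ k).map M.chowMk.toLinearMap

theorem chowGr_mul_mem (M : Matroid α) [M.Finite] {k l n : ℕ} (h : k + l = n) {a b : M.AugChow}
    (ha : a ∈ M.chowGr k) (hb : b ∈ M.chowGr l) : a * b ∈ M.chowGr n := by
  obtain ⟨p, hp, rfl⟩ := ha
  obtain ⟨q, hq, rfl⟩ := hb
  subst h
  exact ⟨p * q, IsHomogeneous.mul hp hq, map_mul M.chowMk p q⟩

theorem chowMonomial_mem (M : Matroid α) [M.Finite] {n : ℕ} (I : Finset ↥M.E)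
    (𝓕 : Finset M.ProperFlat) (h : I.card + 𝓕.card = n) :
    (∏ e ∈ I, M.chowY e) * ∏ F ∈ 𝓕, M.chowX F.1 ∈ M.chowGr n := by
  refine M.chowGr_mul_mem h ?_ ?_
  · refine ⟨∏ e ∈ I, X (Sum.inl e), ?_, map_prod M.chowMk _ _⟩
    simpa using IsHomogeneous.prod I (fun e ↦ (X (Sum.inl e) : M.ChowPoly)) (fun _ ↦ 1)
      (fun e _ ↦ isHomogeneous_X ℚ _)
  · refine ⟨∏ F ∈ 𝓕, X (Sum.inr F), ?_, ?_⟩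
    · simpa using IsHomogeneous.prod 𝓕 (fun e ↦ (X (Sum.inr e) : M.ChowPoly)) (fun _ ↦ 1)
        (fun e _ ↦ isHomogeneous_X ℚ _)
    · refine (map_prod M.chowMk _ _).trans (Finset.prod_congr rfl fun F _ ↦ ?_)
      rw [chowX, dif_pos F.2]
      rfl

/-- The rank of a finite matroid as a natural number. -/
def natRank (M : Matroid α) : ℕ := M.eRank.toNat

/-- `I ≤ 𝓕` is a compatible pair: `I` is an independent set, `𝓕` is a flag of proper flats, and
`I` is contained in every member of `𝓕`. -/
structure CompatiblePair (M : Matroid α) (I : Finset ↥M.E) (𝓕 : Finset M.ProperFlat) :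
    Prop where
  indep : M.Indep (Subtype.val '' (I : Set ↥M.E))
  flag : ∀ F ∈ 𝓕, ∀ G ∈ 𝓕, F.1 ⊆ G.1 ∨ G.1 ⊆ F.1
  compatible : ∀ e ∈ I, ∀ F ∈ 𝓕, e.1 ∈ F.1

/-- `deg : CH^d(M) → ℚ`, where `d` is the rank of `M`, is the degree map: it takes the value `1` on
the monomial `y_I x_𝓕` of every maximal compatible pair `I ≤ 𝓕`, that is, one
with `|I| + |𝓕| = d`. -/
def IsDegreeMap (M : Matroid α) [M.Finite] (deg : M.chowGr M.natRank →ₗ[ℚ] ℚ) : Prop :=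
  ∀ (I : Finset ↥M.E) (𝓕 : Finset M.ProperFlat) (h : I.card + 𝓕.card = M.natRank),
    M.CompatiblePair I 𝓕 →
      deg ⟨(∏ e ∈ I, M.chowY e) * ∏ F ∈ 𝓕, M.chowX F.1, M.chowMonomial_mem I 𝓕 h⟩ = 1

/-- The pairing `CH^k(M) × CH^l(M) → ℚ`, `(a, b) ↦ deg (a b)`, for `k + l = d`. -/
def poincarePairing (M : Matroid α) [M.Finite] (deg : M.chowGr M.natRank →ₗ[ℚ] ℚ) {k l : ℕ}
    (h : k + l = M.natRank) (a : M.chowGr k) (b : M.chowGr l) : ℚ :=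
  deg ⟨a.1 * b.1, M.chowGr_mul_mem h a.2 b.2⟩

/-! ### The deletion homomorphism -/

theorem IsFlat.delete {M : Matroid α} (i : α) {G : Set α} (hG : M.IsFlat G) : (M ＼ {i}).IsFlat (G \ {i}) := by
  rw [isFlat_iff_closure_eq, delete_closure_eq, sdiff_idem]
  refine subset_antisymm (sdiff_subset_sdiff_left ?_) fun x hx ↦ ⟨?_, hx.2⟩
  · exact (M.closure_subset_closure sdiff_subset).trans hG.closure.subset
  · exact M.subset_closure _ (sdiff_subset.trans hG.subset_ground) hx

theorem ProperFlat.notMem {M : Matroid α} {i : α} (F : (M ＼ {i}).ProperFlat) : i ∉ F.1 := fun h ↦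
  (F.2.1.subset_ground h).2 rfl

section Theta

variable (M : Matroid α) [M.Finite] (i : α)

theorem chowX_eq (F : M.ProperFlat) : M.chowX F.1 = M.chowMk (X (Sum.inr F)) := by
  rw [chowX, dif_pos F.2]
  rfl

theorem chowX_of_not {S : Set α} (h : ¬ (M.IsFlat S ∧ S ≠ M.E)) : M.chowX S = 0 := by
  rw [chowX, dif_neg h]

theorem chowMk_eq_zero {p : M.ChowPoly} (h : p ∈ M.linearIdeal ⊔ M.quadraticIdeal) :
    M.chowMk p = 0 :=
  Ideal.Quotient.eq_zero_iff_mem.mpr h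

theorem chowX_mul_chowX {S T : Set α} (h₁ : ¬ S ⊆ T) (h₂ : ¬ T ⊆ S) :
    M.chowX S * M.chowX T = 0 := by
  by_cases hS : M.IsFlat S ∧ S ≠ M.E
  · by_cases hT : M.IsFlat T ∧ T ≠ M.E
    · rw [M.chowX_eq ⟨S, hS⟩, M.chowX_eq ⟨T, hT⟩, ← map_mul]
      exact M.chowMk_eq_zero (Ideal.mem_sup_right (Ideal.subset_span
        (Or.inl ⟨⟨S, hS⟩, ⟨T, hT⟩, h₁, h₂, rfl⟩)))
    · rw [M.chowX_of_not hT, mul_zero]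
  · rw [M.chowX_of_not hS, zero_mul]

theorem chowY_mul_chowX (e : ↥M.E) {S : Set α} (h : e.1 ∉ S) : M.chowY e * M.chowX S = 0 := by
  by_cases hS : M.IsFlat S ∧ S ≠ M.E
  · rw [M.chowX_eq ⟨S, hS⟩, chowY, ← map_mul]
    exact M.chowMk_eq_zero (Ideal.mem_sup_right (Ideal.subset_span
      (Or.inr ⟨e, ⟨S, hS⟩, h, rfl⟩)))
  · rw [M.chowX_of_not hS, mul_zero]

open scoped Classical in
theorem chowY_eq_sum (e : ↥M.E) :
    M.chowY e = ∑ F : M.ProperFlat with e.1 ∉ F.1, M.chowX F.1 := by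
  have h := M.chowMk_eq_zero (Ideal.mem_sup_left (Ideal.subset_span ⟨e, rfl⟩))
  rw [map_sub, sub_eq_zero, map_sum] at h
  simpa only [chowX_eq, chowY] using h

/-- The images of the variables under the deletion homomorphism:
`y_e ↦ y_e` and `x_F ↦ x_F + x_{F ∪ i}`. -/
def thetaVar : ↥(M ＼ {i}).E ⊕ (M ＼ {i}).ProperFlat → M.AugChow :=
  Sum.elim (fun e ↦ M.chowY ⟨e.1, e.2.1⟩) (fun F ↦ M.chowX F.1 + M.chowX (insert i F.1))

open scoped Classical in
theorem thetaVar_linear (e : ↥(M ＼ {i}).E) :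
    M.chowY ⟨e.1, e.2.1⟩ =
      ∑ F : (M ＼ {i}).ProperFlat with e.1 ∉ F.1, (M.chowX F.1 + M.chowX (insert i F.1)) := by
  have hei : e.1 ≠ i := e.2.2
  rw [chowY_eq_sum]
  have hf (G : M.ProperFlat) (hG : e.1 ∉ G.1) :
      (M ＼ {i}).IsFlat (G.1 \ {i}) ∧ G.1 \ {i} ≠ (M ＼ {i}).E :=
    ⟨IsFlat.delete i G.2.1, fun h ↦ hG (h.symm.subset e.2).1⟩
  have hx (S : Set α) (h : M.chowX S ≠ 0) : M.IsFlat S ∧ S ≠ M.E := by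
    by_contra h'
    exact h (M.chowX_of_not h')
  rw [Finset.sum_add_distrib,
    ← Finset.sum_filter_add_sum_filter_not _ (fun G : M.ProperFlat ↦ i ∉ G.1)]
  congr 1
  · refine Finset.sum_bij_ne_zero (fun G hG _ ↦ ⟨G.1 \ {i}, hf G (Finset.mem_filter.1 (Finset.mem_filter.1 hG).1).2⟩) ?_ ?_ ?_ ?_
    · intro G hG _
      have hG' := (Finset.mem_filter.1 (Finset.mem_filter.1 hG).1).2
      exact Finset.mem_filter.2 ⟨Finset.mem_univ _, fun h ↦ hG' h.1⟩
    · intro G hG _ G' hG' _ h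
      have h' := congrArg Subtype.val h
      simp only [Finset.mem_filter, Finset.mem_univ, true_and] at hG hG'
      simp only [sdiff_singleton_eq_self hG.2, sdiff_singleton_eq_self hG'.2] at h'
      exact Subtype.ext h'
    · intro F hF hne
      simp only [Finset.mem_filter, Finset.mem_univ, true_and] at hF
      refine ⟨⟨F.1, hx _ hne⟩, ?_, hne, Subtype.ext (sdiff_singleton_eq_self F.notMem)⟩
      exact Finset.mem_filter.2 ⟨Finset.mem_filter.2 ⟨Finset.mem_univ _, hF⟩, F.notMem⟩
    · intro G hG _
      simp only [Finset.mem_filter, Finset.mem_univ, true_and] at hG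
      simp only [sdiff_singleton_eq_self hG.2]
  · refine Finset.sum_bij_ne_zero (fun G hG _ ↦ ⟨G.1 \ {i}, hf G (Finset.mem_filter.1 (Finset.mem_filter.1 hG).1).2⟩) ?_ ?_ ?_ ?_
    · intro G hG _
      have hG' := (Finset.mem_filter.1 (Finset.mem_filter.1 hG).1).2
      exact Finset.mem_filter.2 ⟨Finset.mem_univ _, fun h ↦ hG' h.1⟩
    · intro G hG _ G' hG' _ h
      have h' := congrArg Subtype.val h
      simp only [Finset.mem_filter, Finset.mem_univ, true_and, not_not] at hG hG'
      refine Subtype.ext ?_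
      rw [← insert_sdiff_self_of_mem hG.2, ← insert_sdiff_self_of_mem hG'.2]
      exact congrArg (insert i) h'
    · intro F hF hne
      simp only [Finset.mem_filter, Finset.mem_univ, true_and] at hF
      refine ⟨⟨insert i F.1, hx _ hne⟩, ?_, hne, Subtype.ext (insert_sdiff_self_of_notMem F.notMem)⟩
      exact Finset.mem_filter.2 ⟨Finset.mem_filter.2 ⟨Finset.mem_univ _, fun h ↦
        h.elim hei hF⟩, not_not.2 (mem_insert i _)⟩
    · intro G hG _
      simp only [Finset.mem_filter, Finset.mem_univ, true_and, not_not] at hG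
      simp only [insert_sdiff_self_of_mem hG.2]

theorem thetaVar_relations (p : (M ＼ {i}).ChowPoly)
    (hp : p ∈ (M ＼ {i}).linearIdeal + (M ＼ {i}).quadraticIdeal) :
    aeval (M.thetaVar i) p = 0 := by
  suffices h : (M ＼ {i}).linearIdeal + (M ＼ {i}).quadraticIdeal ≤
      RingHom.ker (aeval (R := ℚ) (M.thetaVar i)) from h hp
  refine sup_le (Ideal.span_le.2 ?_) (Ideal.span_le.2 ?_)
  · rintro _ ⟨e, rfl⟩
    simp only [SetLike.mem_coe, RingHom.mem_ker, map_sub, map_sum, aeval_X, thetaVar, Sum.elim_inl,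
      Sum.elim_inr]
    rw [sub_eq_zero]
    exact M.thetaVar_linear i e
  · rintro _ (⟨F₁, F₂, h₁, h₂, rfl⟩ | ⟨e, F, h, rfl⟩)
    · have h1 := F₁.notMem
      have h2 := F₂.notMem
      have key {S T : Set α} (hS : i ∉ S) (hST : ¬ S ⊆ T) : ¬ S ⊆ insert i T := fun h ↦
        hST ((subset_insert_iff_of_notMem hS).1 h)
      simp only [SetLike.mem_coe, RingHom.mem_ker, map_mul, aeval_X, thetaVar, Sum.elim_inr]
      rw [add_mul, mul_add, mul_add, M.chowX_mul_chowX h₁ h₂,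
        M.chowX_mul_chowX (key h1 h₁) fun h ↦ h1 (h (mem_insert i _)),
        M.chowX_mul_chowX (fun h ↦ h2 (h (mem_insert i _))) (key h2 h₂),
        M.chowX_mul_chowX (fun h ↦ key h1 h₁ ((subset_insert i _).trans h))
          (fun h ↦ key h2 h₂ ((subset_insert i _).trans h))]
      simp
    · have hei : e.1 ≠ i := e.2.2
      simp only [SetLike.mem_coe, RingHom.mem_ker, map_mul, aeval_X, thetaVar, Sum.elim_inl,
        Sum.elim_inr]
      rw [mul_add, M.chowY_mul_chowX _ h, M.chowY_mul_chowX _ (by simp [hei, h]), add_zero]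

/-- The homomorphism `θ_i : CH(M ＼ i) → CH(M)`, `x_F ↦ x_F + x_{F ∪ i}`. -/
def theta : (M ＼ {i}).AugChow →ₐ[ℚ] M.AugChow :=
  Ideal.Quotient.liftₐ _ (aeval (M.thetaVar i)) (M.thetaVar_relations i)

/-- `CH(M)` is an algebra, hence a module, over `CH(M ＼ i)` through `θ_i`. -/
instance : Algebra (M ＼ {i}).AugChow M.AugChow := (M.theta i).toRingHom.toAlgebra

/-- `CH_(i)`, the image of `θ_i`, as a `CH(M ＼ i)`-submodule of `CH(M)`. -/
def chowImage : Submodule (M ＼ {i}).AugChow M.AugChow :=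
  LinearMap.range (Algebra.linearMap (M ＼ {i}).AugChow M.AugChow)

/-- The submodule `a · CH_(i)` of `CH(M)`. -/
def mulChowImage (a : M.AugChow) : Submodule (M ＼ {i}).AugChow M.AugChow :=
  (M.chowImage i).map (LinearMap.mulLeft (M ＼ {i}).AugChow a)

/-- The collection `𝒮_i` of proper subsets `F` of `E ∖ i` such that `F` and `F ∪ i` are flats. -/
def deletionFlats (M : Matroid α) (i : α) : Set (Set α) :=
  {F | F ⊂ M.E \ {i} ∧ M.IsFlat F ∧ M.IsFlat (insert i F)}

/-- The summands in the non-coloop case: `CH_(i)`, then `x_{F ∪ i} CH_(i)` for `F ∈ 𝒮_i`. -/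
def summand : Unit ⊕ ↥(M.deletionFlats i) → Submodule (M ＼ {i}).AugChow M.AugChow :=
  Sum.elim (fun _ ↦ M.chowImage i) (fun F ↦ M.mulChowImage i (M.chowX (insert i F.1)))

/-- The summands in the coloop case: `CH_(i)` and `x_{E ∖ i} CH_(i)`, then `x_{F ∪ i} CH_(i)`
for `F ∈ 𝒮_i`. -/
def summandColoop : Fin 2 ⊕ ↥(M.deletionFlats i) → Submodule (M ＼ {i}).AugChow M.AugChow :=
  Sum.elim ![M.chowImage i, M.mulChowImage i (M.chowX (M.E \ {i}))]
    (fun F ↦ M.mulChowImage i (M.chowX (insert i F.1)))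

variable {M} {i}

/-- `N` is a graded submodule: it contains the homogeneous components of its elements. -/
def IsGradedSubmodule (N : Submodule (M ＼ {i}).AugChow M.AugChow) : Prop :=
  ∀ z ∈ N, ∃ c : ℕ →₀ M.AugChow, (∀ k, c k ∈ M.chowGr k ∧ c k ∈ N) ∧ c.sum (fun _ a ↦ a) = z

/-- `N` and `N'` are orthogonal for the Poincaré pairing defined by `deg`. -/
def PoincareOrthogonal (deg : M.chowGr M.natRank →ₗ[ℚ] ℚ)
    (N N' : Submodule (M ＼ {i}).AugChow M.AugChow) : Prop :=
  ∀ (k l : ℕ) (h : k + l = M.natRank) (a : M.chowGr k) (b : M.chowGr l),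
    a.1 ∈ N → b.1 ∈ N' → M.poincarePairing deg h a b = 0

end Theta

/-- A submodule `N` is indecomposable: it is nonzero, and it is not the direct sum of two nonzero
submodules. (The submodules need not be graded, so for a graded `N` this includes
indecomposability as a graded module.) -/
def IsIndecomposableSubmodule {R A : Type*} [CommRing R] [AddCommGroup A] [Module R A]
    (N : Submodule R A) : Prop :=
  N ≠ ⊥ ∧ ∀ N₁ N₂ : Submodule R A, Disjoint N₁ N₂ → N₁ ⊔ N₂ = N → N₁ = ⊥ ∨ N₂ = ⊥

end Matroid

end

/-! For a set S let h_S be the sum of x_F over the proper flats F not containing S, so that h_{e} =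
y_e. The classes h_F of flats generate CH(M), and the degree of a product of d of them is 1 or 0 by
a Hall–Rado rule: it is 1 exactly when no flat G contains more than rk G of the factors. This rule
serves as the definition. It gives a functional on a polynomial ring in symbols h_S, with x_F
recovered by Möbius inversion; the relations of CH(M) hold modulo the largest ideal in its kernel
(`sub_mul_sub_mem_hallRadoIdeal`, `closure_singleton_mul_mem_hallRadoIdeal`, `toSetPoly_mem`), so
the functional descends to `chowDeg`.

Poincaré duality (`eq_zero_of_forall_chowDeg`) comes from a triangularity argument. Monomials in the
h_F supported on chains with bounded exponents span CH(M), and each has a test class (`exists_test`)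
of degree 1 against it and of degree 0 against every product of h_F's that does not dominate it.
Duality makes CH^d a line, so the degree map is unique.

For the deletion, θ_i fixes h_S for S ⊆ E∖i, so the Hall–Rado rule evaluates degrees on the image of
θ_i. If F ∈ 𝒮_i, a set avoiding i has closure in F ∪ i exactly when its closure is in F; so F ∪ i
cannot be tight and deg(x_{F∪i} θ_i(r)) = 0. Products of distinct generators are again generators
times θ_i(t), or zero, which gives orthogonality. The sum of the summands is closed under
multiplication and contains every x_G, hence is everything (`span_summandGen_eq_top`). An
x_{F∪i}-component of a vanishing sum is orthogonal to all of CH(M), hence zero by duality. In the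
coloop case deg ∘ θ_i = 0 separates the first two summands; in the other case x_{E∖i} = 0, so one
family serves both. Each summand is cyclic over the local ring CH(M∖i), hence indecomposable. -/

noncomputable section

namespace Matroid

open Set MvPolynomial
open scoped Classical

universe u

variable {α : Type u}

/-! ### The rank function with natural number values -/

/-- The rank of a set in a matroid of finite rank, as a natural number. -/
def natRk (M : Matroid α) (S : Set α) : ℕ := (M.eRk S).toNat

section NatRk

variable {M : Matroid α} {F G S T : Set α} {e : α}

theorem Indep.natRk_eq_ncard (h : M.Indep S) : M.natRk S = S.ncard := by
  rw [natRk, h.eRk_eq_encard, ncard]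

theorem IsFlat.subset_iff_closure_subset (hF : M.IsFlat F) (hS : S ⊆ M.E) :
    M.closure S ⊆ F ↔ S ⊆ F := by
  refine ⟨(M.subset_closure S).trans, fun h ↦ ?_⟩
  have := M.closure_subset_closure h
  rwa [hF.closure] at this

variable [M.Finite]

theorem coe_natRk (M : Matroid α) [M.Finite] (S : Set α) : (M.natRk S : ℕ∞) = M.eRk S :=
  ENat.natCast_toNat (eRk_ne_top_iff.2 (M.isRkFinite_set S))

theorem natRk_mono (M : Matroid α) [M.Finite] (h : S ⊆ T) : M.natRk S ≤ M.natRk T := by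
  have := M.eRk_mono h
  rw [← coe_natRk, ← coe_natRk] at this
  exact_mod_cast this

theorem natRk_closure (M : Matroid α) (S : Set α) : M.natRk (M.closure S) = M.natRk S := by
  rw [natRk, eRk_closure_eq, natRk]

theorem natRk_empty (M : Matroid α) : M.natRk ∅ = 0 := by simp [natRk]

theorem natRk_ground (M : Matroid α) : M.natRk M.E = M.natRank := by
  rw [natRk, eRk_ground, natRank]

theorem natRk_le_natRank (M : Matroid α) [M.Finite] (S : Set α) : M.natRk S ≤ M.natRank := by
  have := M.eRk_le_eRank S
  rw [← eRk_ground, ← coe_natRk, ← coe_natRk, natRk_ground] at this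
  exact_mod_cast this

theorem natRk_inter_add_union_le (M : Matroid α) [M.Finite] (S T : Set α) :
    M.natRk (S ∩ T) + M.natRk (S ∪ T) ≤ M.natRk S + M.natRk T := by
  have := M.eRk_inter_add_eRk_union_le S T
  simp only [← coe_natRk] at this
  exact_mod_cast this

theorem natRk_insert_le (M : Matroid α) [M.Finite] (e : α) (S : Set α) :
    M.natRk (insert e S) ≤ M.natRk S + 1 := by
  have := M.eRk_union_le_eRk_add_encard S {e}
  simp only [← coe_natRk, union_singleton, encard_singleton] at this
  exact_mod_cast this

theorem IsFlat.natRk_lt (hF : M.IsFlat F) (h : F ⊂ G) (hG : G ⊆ M.E) :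
    M.natRk F < M.natRk G := by
  refine lt_of_le_of_ne (M.natRk_mono h.subset) fun heq ↦ h.not_subset ?_
  have h2 := (M.isRkFinite_set F).closure_eq_closure_of_subset_of_eRk_ge_eRk h.subset
    (by rw [← coe_natRk M F, heq, coe_natRk])
  rw [hF.closure] at h2
  rw [h2]
  exact M.subset_closure G

theorem IsFlat.eq_of_subset_of_natRk_le (hF : M.IsFlat F) (h : F ⊆ G) (hG : G ⊆ M.E)
    (hr : M.natRk G ≤ M.natRk F) : F = G := by
  by_contra hne
  exact absurd (hF.natRk_lt (h.ssubset_of_ne hne) hG) (not_lt.2 hr)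

theorem isFlat_empty (M : Matroid α) [M.Loopless] : M.IsFlat ∅ := by
  rw [isFlat_iff_closure_eq, closure_empty, loops_eq_empty]

theorem IsFlat.natRk_insert (hF : M.IsFlat F) (he : e ∉ F) (heE : e ∈ M.E) :
    M.natRk (insert e F) = M.natRk F + 1 :=
  le_antisymm (M.natRk_insert_le e F)
    (hF.natRk_lt (ssubset_insert he) (insert_subset heE hF.subset_ground))

/-- The rank of `G` relative to a flat `F` drops when `F` is enlarged by an element of `G`. -/
theorem IsFlat.relRank_lt {H : Set α} (hF : M.IsFlat F) (hFH : F ⊆ H) (heH : e ∈ H)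
    (heG : e ∈ G) (heF : e ∉ F) (hG : G ⊆ M.E) {n : ℕ}
    (h : M.natRk (F ∪ G) ≤ M.natRk F + (n + 1)) : M.natRk (H ∪ G) ≤ M.natRk H + n := by
  have h1 := M.natRk_inter_add_union_le (F ∪ G) H
  have h2 : M.natRk (insert e F) ≤ M.natRk ((F ∪ G) ∩ H) :=
    M.natRk_mono (insert_subset ⟨Or.inr heG, heH⟩ fun x hx ↦ ⟨Or.inl hx, hFH hx⟩)
  rw [hF.natRk_insert heF (hG heG)] at h2
  have h3 : F ∪ G ∪ H = H ∪ G := by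
    ext x; simp only [mem_union]; have := @hFH x; tauto
  rw [h3] at h1
  omega

end NatRk

/-! ### The Hall–Rado functional -/

/-- A multiset `s` of sets satisfies the Hall–Rado condition: it has `d` members, where `d` is the
rank of `M`, and at most `rk G` of them are contained in `G`, for every flat `G`. -/
def HallRado (M : Matroid α) (s : Multiset (Set α)) : Prop :=
  s.card = M.natRank ∧ ∀ G, M.IsFlat G → s.countP (· ⊆ G) ≤ M.natRk G

/-- The polynomial ring over `ℚ` in variables `h_S` for all sets `S`. -/
abbrev SetPoly (α : Type u) : Type u := AddMonoidAlgebra ℚ (Multiset (Set α))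

/-- The variable `h_S`. -/
def setVar (S : Set α) : SetPoly α := AddMonoidAlgebra.single {S} 1

/-- The linear functional whose value on a monomial is `1` or `0`, according to the
Hall–Rado condition. -/
def hallRadoFun (M : Matroid α) : SetPoly α →ₗ[ℚ] ℚ :=
  (Finsupp.linearCombination ℚ fun s ↦ if M.HallRado s then (1 : ℚ) else 0) ∘ₗ
    (AddMonoidAlgebra.coeffLinearEquiv (S := ℚ) ℚ).toLinearMap

theorem hallRadoFun_single (M : Matroid α) (s : Multiset (Set α)) :
    M.hallRadoFun (AddMonoidAlgebra.single s 1) = if M.HallRado s then 1 else 0 := by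
  simp [hallRadoFun]

/-- The largest ideal on which the Hall–Rado functional vanishes. -/
def hallRadoIdeal (M : Matroid α) : Ideal (SetPoly α) where
  carrier := {p | ∀ q, M.hallRadoFun (p * q) = 0}
  add_mem' ha hb q := by rw [add_mul, map_add, ha, hb, add_zero]
  zero_mem' q := by rw [zero_mul, map_zero]
  smul_mem' c x hx q := by
    rw [smul_eq_mul, mul_comm c, mul_assoc]
    exact hx _

theorem mem_hallRadoIdeal_of_single {M : Matroid α} {p : SetPoly α}
    (h : ∀ s, M.hallRadoFun (p * AddMonoidAlgebra.single s 1) = 0) : p ∈ M.hallRadoIdeal := by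
  intro q
  induction q using AddMonoidAlgebra.induction_linear with
  | zero => simp
  | add f g hf hg => rw [mul_add, map_add, hf, hg, add_zero]
  | single s c =>
    have : (AddMonoidAlgebra.single s c : SetPoly α) = c • AddMonoidAlgebra.single s 1 := by simp
    rw [this, mul_smul_comm, map_smul, h, smul_zero]

/-- Counting members below a set is supermodular while rank is submodular; this opposition is what
makes tight flats closed under join. -/
theorem countP_subset_add_le (s : Multiset (Set α)) {K L N : Set α} (hK : K ⊆ N) (hL : L ⊆ N) :
    s.countP (· ⊆ K) + s.countP (· ⊆ L) ≤ s.countP (· ⊆ N) + s.countP (· ⊆ K ∩ L) := by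
  induction s using Multiset.induction with
  | empty => simp
  | cons S s ih =>
    simp only [Multiset.countP_cons]
    have h3 : S ⊆ K ∩ L ↔ S ⊆ K ∧ S ⊆ L := subset_inter_iff
    have h1 : S ⊆ K → S ⊆ N := fun h ↦ h.trans hK
    have h2 : S ⊆ L → S ⊆ N := fun h ↦ h.trans hL
    split_ifs <;> first | omega | tauto

theorem countP_subset_mono (s : Multiset (Set α)) {K N : Set α} (hK : K ⊆ N) :
    s.countP (· ⊆ K) ≤ s.countP (· ⊆ N) := by
  rw [Multiset.countP_eq_card_filter, Multiset.countP_eq_card_filter]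
  exact Multiset.card_le_card (Multiset.monotone_filter_right s fun S h ↦ h.trans hK)

theorem IsFlat.inter {M : Matroid α} {F G : Set α} (hF : M.IsFlat F) (hG : M.IsFlat G) :
    M.IsFlat (F ∩ G) := by
  rw [isFlat_iff_closure_eq]
  refine subset_antisymm (subset_inter ?_ ?_)
    (M.subset_closure _ (inter_subset_left.trans hF.subset_ground))
  · exact (M.closure_subset_closure inter_subset_left).trans hF.closure.subset
  · exact (M.closure_subset_closure inter_subset_right).trans hG.closure.subset

/-- The indicator of `S ⊆ K`. -/
def setInd (S K : Set α) : ℕ := if S ⊆ K then 1 else 0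

theorem setInd_pos {S K : Set α} (h : 0 < setInd S K) : S ⊆ K := by
  by_contra h'
  simp [setInd, h'] at h

section

variable {M : Matroid α} {F G H : Set α} {e : α}

theorem IsFlat.closure_union_subset_iff {K : Set α} (hK : M.IsFlat K) (hF : F ⊆ M.E)
    (hG : G ⊆ M.E) : M.closure (F ∪ G) ⊆ K ↔ F ⊆ K ∧ G ⊆ K := by
  rw [hK.subset_iff_closure_subset (union_subset hF hG), union_subset_iff]

theorem setVar_empty_mem_hallRadoIdeal [M.Loopless] : setVar ∅ ∈ M.hallRadoIdeal := by
  refine mem_hallRadoIdeal_of_single fun s ↦ ?_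
  rw [setVar, AddMonoidAlgebra.single_mul_single, mul_one, hallRadoFun_single, if_neg]
  rintro ⟨-, h⟩
  have := h ∅ M.isFlat_empty
  simp [natRk_empty] at this

theorem hallRado_cons_cons {A B : Set α} {s : Multiset (Set α)} :
    M.HallRado (A ::ₘ B ::ₘ s) ↔ s.card + 2 = M.natRank ∧ ∀ K, M.IsFlat K →
      s.countP (· ⊆ K) + setInd B K + setInd A K ≤ M.natRk K := by
  simp only [HallRado, Multiset.card_cons, Multiset.countP_cons, setInd, add_assoc]

theorem setVar_mul_setVar_mul_single (A B : Set α) (s : Multiset (Set α)) :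
    setVar A * setVar B * AddMonoidAlgebra.single s 1 =
      (AddMonoidAlgebra.single (A ::ₘ B ::ₘ s) 1 : SetPoly α) := by
  simp [setVar, AddMonoidAlgebra.single_mul_single]

variable [M.Finite]

/-- Flats that are tight for a multiset satisfying the rank inequalities are closed under join. -/
theorem countP_closure_union_of_tight {s : Multiset (Set α)} {K L : Set α}
    (hs : ∀ G, M.IsFlat G → s.countP (· ⊆ G) ≤ M.natRk G) (hK : M.IsFlat K) (hL : M.IsFlat L)
    (hK' : M.natRk K ≤ s.countP (· ⊆ K)) (hL' : M.natRk L ≤ s.countP (· ⊆ L)) :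
    M.natRk (M.closure (K ∪ L)) ≤ s.countP (· ⊆ M.closure (K ∪ L)) := by
  have hE := union_subset hK.subset_ground hL.subset_ground
  have h1 := countP_subset_add_le s (subset_union_left.trans (M.subset_closure (K ∪ L)))
    (subset_union_right.trans (M.subset_closure (K ∪ L)))
  have h2 := hs _ (hK.inter hL)
  have h3 := M.natRk_inter_add_union_le K L
  rw [natRk_closure]
  omega

/-- Expanding, the Hall–Rado indicators of s with HH, FH, HG, FG adjoined must satisfy [HH] − [FH] −
[HG] + [FG] = 0. This is inclusion–exclusion: FG holds iff FH and HG both hold, and HH holds iff at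
least one of them does. -/
theorem sub_mul_sub_mem_hallRadoIdeal (hF : M.IsFlat F) (hG : M.IsFlat G) :
    (setVar (M.closure (F ∪ G)) - setVar F) * (setVar (M.closure (F ∪ G)) - setVar G)
      ∈ M.hallRadoIdeal := by
  refine mem_hallRadoIdeal_of_single fun s ↦ ?_
  set H := M.closure (F ∪ G) with hH
  have key {K : Set α} (hK : M.IsFlat K) : H ⊆ K ↔ F ⊆ K ∧ G ⊆ K :=
    hK.closure_union_subset_iff hF.subset_ground hG.subset_ground
  have ind {K : Set α} (hK : M.IsFlat K) : setInd F K ≤ 1 ∧ setInd G K ≤ 1 ∧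
      setInd H K ≤ setInd F K ∧ setInd H K ≤ setInd G K ∧
      setInd F K + setInd G K ≤ 1 + setInd H K := by
    have := key hK
    unfold setInd
    split_ifs <;> first | omega | tauto
  simp only [sub_mul, mul_sub, setVar_mul_setVar_mul_single, map_sub, hallRadoFun_single]
  have h1 : M.HallRado (F ::ₘ G ::ₘ s) → M.HallRado (F ::ₘ H ::ₘ s) := by
    rw [hallRado_cons_cons, hallRado_cons_cons]
    exact fun h ↦ ⟨h.1, fun K hK ↦ by have := h.2 K hK; have := ind hK; omega⟩
  have h2 : M.HallRado (F ::ₘ G ::ₘ s) → M.HallRado (H ::ₘ G ::ₘ s) := by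
    rw [hallRado_cons_cons, hallRado_cons_cons]
    exact fun h ↦ ⟨h.1, fun K hK ↦ by have := h.2 K hK; have := ind hK; omega⟩
  have h3 : M.HallRado (F ::ₘ H ::ₘ s) → M.HallRado (H ::ₘ H ::ₘ s) := by
    rw [hallRado_cons_cons, hallRado_cons_cons]
    exact fun h ↦ ⟨h.1, fun K hK ↦ by have := h.2 K hK; have := ind hK; omega⟩
  have h4 : M.HallRado (H ::ₘ G ::ₘ s) → M.HallRado (H ::ₘ H ::ₘ s) := by
    rw [hallRado_cons_cons, hallRado_cons_cons]
    exact fun h ↦ ⟨h.1, fun K hK ↦ by have := h.2 K hK; have := ind hK; omega⟩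
  have h5 : M.HallRado (F ::ₘ H ::ₘ s) → M.HallRado (H ::ₘ G ::ₘ s) →
      M.HallRado (F ::ₘ G ::ₘ s) := by
    rw [hallRado_cons_cons, hallRado_cons_cons, hallRado_cons_cons]
    exact fun h h' ↦ ⟨h.1, fun K hK ↦ by
      have := h.2 K hK; have := h'.2 K hK; have := ind hK; omega⟩
  -- If FH fails at K and HG fails at L, then K ⊇ F and L ⊇ G are tight for s. So is their join,
  -- which contains H and therefore leaves no room for H.
  have h6 : M.HallRado (H ::ₘ H ::ₘ s) → M.HallRado (F ::ₘ H ::ₘ s) ∨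
      M.HallRado (H ::ₘ G ::ₘ s) := by
    rw [hallRado_cons_cons, hallRado_cons_cons, hallRado_cons_cons]
    rintro ⟨hd, h⟩
    by_contra! hcon
    obtain ⟨K, hK, hK'⟩ := hcon.1 hd
    obtain ⟨L, hL, hL'⟩ := hcon.2 hd
    have hKH := h K hK
    have hLH := h L hL
    have kK := ind hK
    have kL := ind hL
    have hFK : F ⊆ K := setInd_pos (by omega)
    have hGL : G ⊆ L := setInd_pos (by omega)
    have := countP_closure_union_of_tight (s := s) (fun K hK ↦ le_trans (by omega) (h K hK)) hK hL
      (by omega) (by omega)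
    have h7 := h _ (M.isFlat_closure (K ∪ L))
    have h8 : setInd H (M.closure (K ∪ L)) = 1 :=
      if_pos (M.closure_subset_closure (union_subset_union hFK hGL))
    omega
  split_ifs <;> first | norm_num; done | tauto

/-- Next to a factor cl{e}, replacing F by cl(F ∪ e) does not affect the Hall–Rado condition. For K
containing F but not e, the inequality at cl(K ∪ e) counts both factors and has rank at most one
higher, which gives the inequality at K. -/
theorem closure_singleton_mul_mem_hallRadoIdeal (hF : M.IsFlat F) (he : e ∈ M.E) :
    setVar (M.closure {e}) * (setVar (M.closure (insert e F)) - setVar F)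
      ∈ M.hallRadoIdeal := by
  refine mem_hallRadoIdeal_of_single fun s ↦ ?_
  set H := M.closure (insert e F) with hH
  set A := M.closure {e} with hA
  have key {K : Set α} (hK : M.IsFlat K) : H ⊆ K ↔ A ⊆ K ∧ F ⊆ K := by
    rw [hH, hK.subset_iff_closure_subset (insert_subset he hF.subset_ground), insert_subset_iff,
      hA, hK.subset_iff_closure_subset (singleton_subset_iff.2 he), singleton_subset_iff]
  have ind {K : Set α} (hK : M.IsFlat K) : setInd A K ≤ 1 ∧ setInd F K ≤ 1 ∧
      setInd H K ≤ setInd A K ∧ setInd H K ≤ setInd F K ∧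
      setInd A K + setInd F K ≤ 1 + setInd H K := by
    have := key hK
    unfold setInd
    split_ifs <;> first | omega | tauto
  simp only [sub_mul, mul_sub, setVar_mul_setVar_mul_single, map_sub, hallRadoFun_single]
  suffices M.HallRado (A ::ₘ H ::ₘ s) ↔ M.HallRado (A ::ₘ F ::ₘ s) by
    simp only [this, sub_self]
  rw [hallRado_cons_cons, hallRado_cons_cons]
  refine and_congr_right fun _ ↦ ⟨fun h K hK ↦ ?_, fun h K hK ↦ ?_⟩
  · have h1 := h K hK
    have h2 := h _ (M.isFlat_closure (insert e K))
    rw [natRk_closure] at h2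
    have h3 := M.natRk_insert_le e K
    have h4 := M.subset_closure (insert e K) (insert_subset he hK.subset_ground)
    have h5 := countP_subset_mono s ((subset_insert e K).trans h4)
    have h6 : setInd A (M.closure (insert e K)) = 1 :=
      if_pos (M.closure_subset_closure (singleton_subset_iff.2 (mem_insert _ _)))
    have h7 := ind hK
    have h8 := ind (M.isFlat_closure (insert e K))
    by_cases hFK : F ⊆ K
    · have h9 : setInd F (M.closure (insert e K)) = 1 :=
        if_pos (hFK.trans ((subset_insert _ _).trans h4))
      omega
    · have h9 : setInd F K = 0 := if_neg hFK
      omega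
  · have := h K hK
    have := ind hK
    omega

end

/-! ### The degree functional -/

/-- Möbius inversion over reverse inclusion, by well-founded recursion from the largest sets
downwards. -/
theorem exists_sum_superset_eq {ι A : Type*} [Fintype ι] [AddCommGroup A] (c : ι → Set α)
    (hc : Function.Injective c) (f : ι → A) :
    ∃ g : ι → A, ∀ a, ∑ b with c a ⊆ c b, g b = f a := by
  let r : ι → ι → Prop := fun b a ↦ c a ⊂ c b
  have : IsTrans ι r := ⟨fun a b c h1 h2 ↦ h2.trans h1⟩
  have : Std.Irrefl r := ⟨fun a h ↦ (h : c a ⊂ c a).ne rfl⟩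
  have wf : WellFounded r := Finite.wellFounded_of_trans_of_irrefl r
  let F : (a : ι) → ((b : ι) → r b a → A) → A := fun a rec ↦
    f a - ∑ b : {b : ι // c a ⊂ c b}, rec b.1 b.2
  refine ⟨wf.fix F, fun a ↦ ?_⟩
  have h1 : ({b : ι | c a ⊆ c b} : Finset ι) = insert a ({b : ι | c a ⊂ c b} : Finset ι) := by
    ext b
    simp only [Finset.mem_filter, Finset.mem_univ, true_and, Finset.mem_insert]
    refine ⟨fun h ↦ ?_, ?_⟩
    · by_cases hb : b = a
      · exact Or.inl hb
      · exact Or.inr (h.ssubset_of_ne fun h ↦ hb (hc h).symm)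
    · rintro (rfl | h)
      · exact subset_rfl
      · exact h.subset
  rw [h1, Finset.sum_insert (by simp), wf.fix_eq]
  simp only [F]
  rw [Finset.sum_subtype (p := fun b ↦ c a ⊂ c b) _ (by simp)]
  abel

section

variable (M : Matroid α) [M.Finite]

theorem exists_flatVar : ∃ g : M.ProperFlat → SetPoly α, ∀ F : M.ProperFlat,
    ∑ G : M.ProperFlat with F.1 ⊆ G.1, g G = setVar M.E - setVar F.1 :=
  exists_sum_superset_eq (fun F : M.ProperFlat ↦ F.1) Subtype.val_injective _

/-- The images of the variables `x_F` in the polynomial ring in the `h_S`. -/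
def flatVar : M.ProperFlat → SetPoly α := M.exists_flatVar.choose

theorem sum_flatVar {S : Set α} (hS : S ⊆ M.E) :
    ∑ G : M.ProperFlat with S ⊆ G.1, M.flatVar G = setVar M.E - setVar (M.closure S) := by
  by_cases h : M.closure S = M.E
  · rw [h, sub_self]
    refine Finset.sum_eq_zero fun G hG ↦ ?_
    simp only [Finset.mem_filter, Finset.mem_univ, true_and] at hG
    exact absurd (subset_antisymm G.2.1.subset_ground
      (h.symm.subset.trans ((G.2.1.subset_iff_closure_subset hS).2 hG))) G.2.2
  · rw [← M.exists_flatVar.choose_spec ⟨_, M.isFlat_closure S, h⟩]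
    refine Finset.sum_congr ?_ fun _ _ ↦ rfl
    ext G
    simp [G.2.1.subset_iff_closure_subset hS]

theorem sum_flatVar_of_subset {S T : Set α} (hST : S ⊆ T) (hT : T ⊆ M.E) :
    ∑ G : M.ProperFlat with S ⊆ G.1 ∧ ¬ T ⊆ G.1, M.flatVar G =
      setVar (M.closure T) - setVar (M.closure S) := by
  have h := Finset.sum_filter_add_sum_filter_not ({G : M.ProperFlat | S ⊆ G.1} : Finset _)
    (fun G : M.ProperFlat ↦ T ⊆ G.1) M.flatVar
  rw [Finset.filter_filter, Finset.filter_filter,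
    Finset.filter_congr (q := fun G : M.ProperFlat ↦ T ⊆ G.1)
      (fun G _ ↦ ⟨fun h ↦ h.2, fun h ↦ ⟨hST.trans h, h⟩⟩), M.sum_flatVar hT,
    M.sum_flatVar (hST.trans hT)] at h
  rw [eq_sub_of_add_eq' h]
  abel

theorem sum_flatVar_compl [M.Loopless] {S : Set α} (hS : S ⊆ M.E) :
    ∑ G : M.ProperFlat with ¬ S ⊆ G.1, M.flatVar G = setVar (M.closure S) - setVar ∅ := by
  have h := M.sum_flatVar_of_subset (empty_subset S) hS
  rw [M.isFlat_empty.closure] at h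
  rw [← h]
  simp

/-- The product (h_{F∨G} − h_F)(h_{F∨G} − h_G) expands into terms x_{F'} x_{G'} with F' ⊇ F, G' ⊇ G
and neither containing F ∪ G. All these pairs are incomparable, and every pair except (F, G) is
covered by induction on the size of the complements. -/
theorem flatVar_mul_flatVar_mem (n : ℕ) : ∀ F G : M.ProperFlat,
    (M.E \ F.1).ncard + (M.E \ G.1).ncard ≤ n → ¬ F.1 ⊆ G.1 → ¬ G.1 ⊆ F.1 →
    (Ideal.Quotient.mk M.hallRadoIdeal (M.flatVar F) *
      Ideal.Quotient.mk M.hallRadoIdeal (M.flatVar G)) = 0 := by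
  induction n using Nat.strong_induction_on with
  | _ n ih =>
  intro F G hn hFG hGF
  have hFE := F.2.1.subset_ground
  have hGE := G.2.1.subset_ground
  have hE := union_subset hFE hGE
  have h0 := sub_mul_sub_mem_hallRadoIdeal F.2.1 G.2.1
  have h1 := M.sum_flatVar_of_subset (subset_union_left (t := G.1)) hE
  have h2 := M.sum_flatVar_of_subset (subset_union_right (s := F.1)) hE
  rw [F.2.1.closure] at h1
  rw [G.2.1.closure] at h2
  rw [← h1, ← h2, ← Ideal.Quotient.eq_zero_iff_mem, map_mul, map_sum, map_sum,
    Finset.sum_mul_sum, ← Finset.sum_product'] at h0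
  rw [← h0, Finset.sum_eq_single (F, G)]
  · rintro ⟨F', G'⟩ hmem hne
    simp only [Finset.mem_product, Finset.mem_filter, Finset.mem_univ, true_and,
      union_subset_iff, not_and] at hmem
    obtain ⟨⟨hF1, hF2⟩, hG1, hG2⟩ := hmem
    have hle (A B : M.ProperFlat) (h : A.1 ⊆ B.1) : (M.E \ B.1).ncard ≤ (M.E \ A.1).ncard :=
      ncard_le_ncard (sdiff_subset_sdiff_right h) (M.ground_finite.sdiff)
    have hlt (A B : M.ProperFlat) (h : A.1 ⊆ B.1) (hne : B ≠ A) :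
        (M.E \ B.1).ncard < (M.E \ A.1).ncard := by
      refine ncard_lt_ncard ?_ (M.ground_finite.sdiff)
      refine (sdiff_subset_sdiff_right h).ssubset_of_ne fun heq ↦ hne (Subtype.ext ?_)
      rw [← sdiff_sdiff_cancel_left B.2.1.subset_ground, heq,
        sdiff_sdiff_cancel_left A.2.1.subset_ground]
    have h3 := hle F F' hF1
    have h4 := hle G G' hG1
    refine ih ((M.E \ F'.1).ncard + (M.E \ G'.1).ncard) ?_ F' G' le_rfl
      (fun h ↦ hG2 (hF1.trans h) hG1) (fun h ↦ hF2 hF1 (hG1.trans h))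
    by_cases hF' : F' = F
    · have := hlt G G' hG1 (fun h ↦ hne (by rw [hF', h]))
      omega
    · have := hlt F F' hF1 hF'
      omega
  · intro h
    simp [hFG, hGF] at h

/-- The difference h_{cl(F∪e)} − h_F is the sum of x_G over G ⊇ F avoiding e; all terms but x_F are
killed by induction. -/
theorem setVar_mul_flatVar_mem {e : α} (he : e ∈ M.E) (n : ℕ) : ∀ F : M.ProperFlat,
    (M.E \ F.1).ncard ≤ n → e ∉ F.1 →
    (Ideal.Quotient.mk M.hallRadoIdeal (setVar (M.closure {e})) *
      Ideal.Quotient.mk M.hallRadoIdeal (M.flatVar F)) = 0 := by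
  induction n using Nat.strong_induction_on with
  | _ n ih =>
  intro F hn heF
  have hFE := F.2.1.subset_ground
  have h0 := closure_singleton_mul_mem_hallRadoIdeal F.2.1 he
  have h1 := M.sum_flatVar_of_subset (subset_insert e F.1) (insert_subset he hFE)
  rw [F.2.1.closure] at h1
  rw [← h1, ← Ideal.Quotient.eq_zero_iff_mem, map_mul, map_sum, Finset.mul_sum] at h0
  rw [← h0, Finset.sum_eq_single F]
  · intro G hG hne
    simp only [Finset.mem_filter, Finset.mem_univ, true_and, insert_subset_iff, not_and'] at hG
    have hlt : (M.E \ G.1).ncard < (M.E \ F.1).ncard := by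
      refine ncard_lt_ncard ?_ (M.ground_finite.sdiff)
      refine (sdiff_subset_sdiff_right hG.1).ssubset_of_ne fun heq ↦ hne (Subtype.ext ?_)
      rw [← sdiff_sdiff_cancel_left G.2.1.subset_ground, heq,
        sdiff_sdiff_cancel_left F.2.1.subset_ground]
    exact ih _ (hlt.trans_le hn) G le_rfl (hG.2 hG.1)
  · intro h
    simp [heF, insert_subset_iff] at h

variable [M.Loopless]

/-- The homomorphism from the polynomial ring in the `y_e` and `x_F` to the polynomial ring in the
`h_S`. -/
def toSetPoly : M.ChowPoly →ₐ[ℚ] SetPoly α :=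
  aeval (Sum.elim (fun e ↦ setVar (M.closure {e.1}) - setVar ∅) M.flatVar)

/-- Subtracting h_∅ in the image of y_e makes the linear relations hold exactly in the polynomial
ring; the correction is harmless because h_∅ lies in the ideal. Only the quadratic relations need
the quotient. -/
theorem toSetPoly_mem {p : M.ChowPoly} (hp : p ∈ M.linearIdeal + M.quadraticIdeal) :
    M.toSetPoly p ∈ M.hallRadoIdeal := by
  suffices h : M.linearIdeal + M.quadraticIdeal ≤
      M.hallRadoIdeal.comap M.toSetPoly.toRingHom from h hp
  refine sup_le (Ideal.span_le.2 ?_) (Ideal.span_le.2 ?_)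
  · rintro _ ⟨e, rfl⟩
    have h := M.sum_flatVar_compl (singleton_subset_iff.2 e.2)
    simp only [singleton_subset_iff] at h
    have : M.toSetPoly (X (Sum.inl e) - ∑ F : M.ProperFlat with e.1 ∉ F.1, X (Sum.inr F)) = 0 := by
      simp only [toSetPoly, map_sub, map_sum, aeval_X, Sum.elim_inl, Sum.elim_inr]
      rw [h, sub_self]
    change M.toSetPoly _ ∈ M.hallRadoIdeal
    rw [this]
    exact zero_mem _
  · rintro _ (⟨F₁, F₂, h₁, h₂, rfl⟩ | ⟨e, F, h, rfl⟩)
    · change M.toSetPoly _ ∈ M.hallRadoIdeal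
      simp only [toSetPoly, map_mul, aeval_X, Sum.elim_inr]
      rw [← Ideal.Quotient.eq_zero_iff_mem, map_mul]
      exact M.flatVar_mul_flatVar_mem _ F₁ F₂ le_rfl h₁ h₂
    · change M.toSetPoly _ ∈ M.hallRadoIdeal
      simp only [toSetPoly, map_mul, aeval_X, Sum.elim_inr, Sum.elim_inl]
      rw [sub_mul]
      refine sub_mem ?_ (Ideal.mul_mem_right _ _ setVar_empty_mem_hallRadoIdeal)
      rw [← Ideal.Quotient.eq_zero_iff_mem, map_mul]
      exact M.setVar_mul_flatVar_mem e.2 _ F le_rfl h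

theorem chowMk_surjective (M : Matroid α) [M.Finite] : Function.Surjective M.chowMk :=
  Ideal.Quotient.mkₐ_surjective ℚ _

/-- Composing with any linear section of the quotient map works, since the functional vanishes on
the ideal (multiplier 1). -/
theorem exists_chowDeg : ∃ f : M.AugChow →ₗ[ℚ] ℚ,
    ∀ p, f (M.chowMk p) = M.hallRadoFun (M.toSetPoly p) := by
  obtain ⟨g, hg⟩ := M.chowMk.toLinearMap.exists_rightInverse_of_surjective
    (LinearMap.range_eq_top.2 M.chowMk_surjective)
  refine ⟨M.hallRadoFun ∘ₗ M.toSetPoly.toLinearMap ∘ₗ g, fun p ↦ ?_⟩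
  have h1 : M.chowMk (g (M.chowMk p)) = M.chowMk p := LinearMap.congr_fun hg (M.chowMk p)
  have h2 : g (M.chowMk p) - p ∈ M.linearIdeal + M.quadraticIdeal := by
    rw [← Ideal.Quotient.eq_zero_iff_mem]
    change M.chowMk _ = 0
    rw [map_sub, h1, sub_self]
  have h3 := M.toSetPoly_mem h2 1
  rw [mul_one, map_sub, map_sub, sub_eq_zero] at h3
  exact h3

/-- The degree map, extended by zero to a linear functional on the whole of `CH(M)`. -/
def chowDeg : M.AugChow →ₗ[ℚ] ℚ := M.exists_chowDeg.choose

/-- The class `h_S`, the sum of the `x_F` over the proper flats that do not contain `S`. -/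
def chowH (M : Matroid α) [M.Finite] (S : Set α) : M.AugChow :=
  ∑ F : M.ProperFlat with ¬ S ⊆ F.1, M.chowX F.1

/-- The product of the classes `h_S` over a multiset of sets. -/
def chowHProd (M : Matroid α) [M.Finite] (s : Multiset (Set α)) : M.AugChow :=
  (s.map M.chowH).prod

theorem chowDeg_chowHProd {s : Multiset (Set α)} (hs : ∀ S ∈ s, M.IsFlat S) :
    M.chowDeg (M.chowHProd s) = if M.HallRado s then 1 else 0 := by
  let q : Set α → M.ChowPoly := fun S ↦ ∑ F : M.ProperFlat with ¬ S ⊆ F.1, X (Sum.inr F)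
  have h1 : M.chowHProd s = M.chowMk (s.map q).prod := by
    rw [map_multiset_prod, Multiset.map_map, chowHProd]
    congr 1
    refine Multiset.map_congr rfl fun S _ ↦ ?_
    simp [q, chowH, chowX_eq]
  have h2 : Ideal.Quotient.mk M.hallRadoIdeal (M.toSetPoly (s.map q).prod) =
      Ideal.Quotient.mk M.hallRadoIdeal (AddMonoidAlgebra.single s 1) := by
    clear h1
    induction s using Multiset.induction with
    | empty => simp; rfl
    | cons S s ih =>
      have h3 : (AddMonoidAlgebra.single (S ::ₘ s) 1 : SetPoly α) =
          setVar S * AddMonoidAlgebra.single s 1 := by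
        simp [setVar, AddMonoidAlgebra.single_mul_single]
      have hS := hs S (Multiset.mem_cons_self S s)
      rw [Multiset.map_cons, Multiset.prod_cons, map_mul, map_mul,
        ih fun T hT ↦ hs T (Multiset.mem_cons_of_mem hT), h3, map_mul]
      congr 1
      have h4 : M.toSetPoly (q S) = setVar S - setVar ∅ := by
        simp only [q, toSetPoly, map_sum, aeval_X, Sum.elim_inr]
        rw [M.sum_flatVar_compl hS.subset_ground, hS.closure]
      rw [h4, map_sub, Ideal.Quotient.eq_zero_iff_mem.2 setVar_empty_mem_hallRadoIdeal, sub_zero]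
  rw [h1, chowDeg, M.exists_chowDeg.choose_spec, ← hallRadoFun_single]
  have h3 := Ideal.Quotient.eq.1 h2 1
  rwa [mul_one, map_sub, sub_eq_zero] at h3

end

/-! ### Relations between the classes `h_S` -/

section

variable (M : Matroid α) [M.Finite] {F G S T : Set α}

theorem chowH_sub (hST : S ⊆ T) :
    M.chowH T - M.chowH S = ∑ H : M.ProperFlat with S ⊆ H.1 ∧ ¬ T ⊆ H.1, M.chowX H.1 := by
  have h := Finset.sum_filter_add_sum_filter_not ({H : M.ProperFlat | ¬ T ⊆ H.1} : Finset _)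
    (fun H : M.ProperFlat ↦ S ⊆ H.1) (fun H ↦ M.chowX H.1)
  have h1 : ({H : M.ProperFlat | ¬ T ⊆ H.1 ∧ S ⊆ H.1} : Finset _) =
      ({H : M.ProperFlat | S ⊆ H.1 ∧ ¬ T ⊆ H.1} : Finset _) :=
    Finset.filter_congr fun H _ ↦ and_comm
  have h2 : ({H : M.ProperFlat | ¬ T ⊆ H.1 ∧ ¬ S ⊆ H.1} : Finset _) =
      ({H : M.ProperFlat | ¬ S ⊆ H.1} : Finset _) :=
    Finset.filter_congr fun H _ ↦ ⟨fun h ↦ h.2, fun h ↦ ⟨fun h' ↦ h (hST.trans h'), h⟩⟩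
  rw [Finset.filter_filter, Finset.filter_filter, h1, h2] at h
  exact sub_eq_of_eq_add h.symm

theorem chowH_empty : M.chowH ∅ = 0 := by simp [chowH]

theorem chowH_singleton (e : ↥M.E) : M.chowH {e.1} = M.chowY e := by
  simp [chowH, chowY_eq_sum]

theorem chowH_closure (hS : S ⊆ M.E) : M.chowH (M.closure S) = M.chowH S := by
  unfold chowH
  refine Finset.sum_congr (Finset.filter_congr fun F _ ↦ ?_) fun _ _ ↦ rfl
  rw [F.2.1.subset_iff_closure_subset hS]

theorem chowX_eq_chowH_sub (hF : M.IsFlat F) (hFE : F ≠ M.E) :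
    M.chowX F = M.chowH M.E - M.chowH F - ∑ G : M.ProperFlat with F ⊂ G.1, M.chowX G.1 := by
  obtain ⟨P, rfl⟩ : ∃ P : M.ProperFlat, P.1 = F := ⟨⟨F, hF, hFE⟩, rfl⟩
  rw [M.chowH_sub hF.subset_ground, eq_sub_iff_add_eq,
    ← Finset.sum_insert (f := fun G : M.ProperFlat ↦ M.chowX G.1) (a := P) (by simp)]
  refine Finset.sum_congr ?_ fun _ _ ↦ rfl
  ext G
  simp only [Finset.mem_insert, Finset.mem_filter, Finset.mem_univ, true_and]
  have h1 : ¬ M.E ⊆ G.1 := fun h ↦ G.2.2 (subset_antisymm G.2.1.subset_ground h)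
  refine ⟨?_, fun h ↦ ?_⟩
  · rintro (rfl | h)
    · exact ⟨subset_rfl, h1⟩
    · exact ⟨h.subset, h1⟩
  · by_cases hG : G = P
    · exact Or.inl hG
    · exact Or.inr (h.1.ssubset_of_ne fun h ↦ hG (Subtype.ext h.symm))

theorem chowX_mul_chowH_singleton {e : α} (he : e ∈ M.E) (heF : e ∉ F) :
    M.chowX F * M.chowH {e} = 0 := by
  rw [M.chowH_singleton ⟨e, he⟩, mul_comm, M.chowY_mul_chowX ⟨e, he⟩ heF]

/-- For e ∈ G ∖ F one has x_F y_e = 0, so x_F h_G = x_F (h_G − h_{e}) is a sum of x_F x_H with e ∈ H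
and G ⊄ H. Only H ⊇ F survive, and the rank of G over H is smaller than over F, so each factor h_G
consumes one unit. -/
theorem chowX_mul_chowH_pow (hG : G ⊆ M.E) (n : ℕ) : ∀ F, ¬ G ⊆ F →
    M.natRk (F ∪ G) ≤ M.natRk F + n → M.chowX F * M.chowH G ^ n = 0 := by
  induction n with
  | zero =>
    intro F hGF h
    by_cases hF : M.IsFlat F ∧ F ≠ M.E
    · exact absurd (hF.1.natRk_lt (ssubset_of_subset_not_subset subset_union_left
        fun h' ↦ hGF (subset_union_right.trans h')) (union_subset hF.1.subset_ground hG))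
        (not_lt.2 h)
    · rw [M.chowX_of_not hF, zero_mul]
  | succ n ih =>
    intro F hGF h
    by_cases hF : M.IsFlat F ∧ F ≠ M.E
    swap
    · rw [M.chowX_of_not hF, zero_mul]
    obtain ⟨e, heG, heF⟩ := not_subset.1 hGF
    have h1 : M.chowX F * M.chowH G ^ (n + 1) =
        M.chowX F * ((M.chowH G - M.chowH {e}) * M.chowH G ^ n) := by
      linear_combination M.chowH G ^ n * M.chowX_mul_chowH_singleton (hG heG) heF
    rw [h1, M.chowH_sub (singleton_subset_iff.2 heG), Finset.sum_mul, Finset.mul_sum]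
    refine Finset.sum_eq_zero fun H hH ↦ ?_
    simp only [Finset.mem_filter, Finset.mem_univ, true_and, singleton_subset_iff] at hH
    by_cases hFH : F ⊆ H.1
    · rw [ih H.1 hH.2 (hF.1.relRank_lt hFH hH.1 heG heF hG h), mul_zero]
    · rw [← mul_assoc, M.chowX_mul_chowX hFH fun h ↦ heF (h hH.1), zero_mul]

theorem chowH_mul_chowH_eq (hF : F ⊆ M.E) (hG : G ⊆ M.E) : M.chowH F * M.chowH G =
    M.chowH F * M.chowH (M.closure (F ∪ G)) + M.chowH G * M.chowH (M.closure (F ∪ G)) -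
      M.chowH (M.closure (F ∪ G)) * M.chowH (M.closure (F ∪ G)) := by
  rw [M.chowH_closure (union_subset hF hG)]
  have h : (M.chowH (F ∪ G) - M.chowH F) * (M.chowH (F ∪ G) - M.chowH G) = 0 := by
    rw [M.chowH_sub subset_union_left, M.chowH_sub subset_union_right, Finset.sum_mul_sum]
    refine Finset.sum_eq_zero fun H hH ↦ Finset.sum_eq_zero fun K hK ↦ ?_
    simp only [Finset.mem_filter, Finset.mem_univ, true_and] at hH hK
    exact M.chowX_mul_chowX (fun h ↦ hK.2 (union_subset (hH.1.trans h) hK.1))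
      (fun h ↦ hH.2 (union_subset hH.1 (hK.1.trans h)))
  linear_combination h

/-- The difference h_F − h_G is a sum of x_H with H ⊇ G and F ⊄ H; each is killed by h_F ^ n because
F has rank at most n over H. -/
theorem chowH_mul_chowH_pow (hGF : G ⊆ F) (hF : F ⊆ M.E) {n : ℕ}
    (h : M.natRk F ≤ M.natRk G + n) : M.chowH G * M.chowH F ^ n = M.chowH F ^ (n + 1) := by
  have h0 : (M.chowH F - M.chowH G) * M.chowH F ^ n = 0 := by
    rw [M.chowH_sub hGF, Finset.sum_mul]
    refine Finset.sum_eq_zero fun H hH ↦ ?_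
    simp only [Finset.mem_filter, Finset.mem_univ, true_and] at hH
    refine M.chowX_mul_chowH_pow hF n H.1 hH.2 ?_
    have h1 := M.natRk_inter_add_union_le H.1 F
    have h2 := M.natRk_mono (subset_inter hH.1 hGF)
    omega
  linear_combination -h0

theorem chowH_pow_eq_zero (hF : F ⊆ M.E) {n : ℕ} (h : M.natRk F < n) : M.chowH F ^ n = 0 := by
  obtain ⟨n, rfl⟩ := Nat.exists_eq_add_one.2 (Nat.zero_lt_of_lt h)
  rw [← M.chowH_mul_chowH_pow (empty_subset F) hF (by rw [natRk_empty]; omega), chowH_empty,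
    zero_mul]

theorem chowH_pow_mul_chowH_pow (hGF : G ⊆ F) (hF : F ⊆ M.E) {n : ℕ} (m : ℕ)
    (h : M.natRk F ≤ M.natRk G + n) :
    M.chowH G ^ m * M.chowH F ^ n = M.chowH F ^ (n + m) := by
  induction m with
  | zero => simp
  | succ m ih =>
    rw [pow_succ', mul_assoc, ih, M.chowH_mul_chowH_pow hGF hF (by omega), add_assoc]

/-- The class `x_F` for a proper flat `F`, and `1` for the ground set. -/
def chowXTop (F : Set α) : M.AugChow := if F = M.E then 1 else M.chowX F

/-- Against x_G h_G ^ n, the sum h_G − h_F reduces to x_F: larger H inside G have too small a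
corank, and H not inside G is incomparable with G. It then remains to multiply by h_F ^ rk F, using
h_F ^ (rk F + 1) = 0. -/
theorem chowXTop_mul_pow (hF : M.IsFlat F) (hG : M.IsFlat G) (hFG : F ⊂ G) {n : ℕ}
    (hn : n + 1 + M.natRk F = M.natRk G) :
    M.chowXTop G * M.chowH G ^ n * (M.chowX F * M.chowH F ^ M.natRk F) =
      M.chowXTop G * M.chowH G ^ M.natRk G := by
  have h1 := M.chowH_pow_mul_chowH_pow hFG.subset hG.subset_ground (n := n + 1) (M.natRk F)
    (by omega)
  have h2 := M.chowH_pow_eq_zero hF.subset_ground (n := M.natRk F + 1) (by omega)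
  have hFE : F ≠ M.E := fun h ↦ hFG.not_subset (hG.subset_ground.trans h.symm.subset)
  have h3 : M.chowXTop G * M.chowH G ^ n * (M.chowH G - M.chowH F) =
      M.chowXTop G * M.chowH G ^ n * M.chowX F := by
    obtain ⟨P, hP⟩ : ∃ P : M.ProperFlat, P.1 = F := ⟨⟨F, hF, hFE⟩, rfl⟩
    rw [M.chowH_sub hFG.subset, Finset.mul_sum, Finset.sum_eq_single P, hP]
    · intro H hH hne
      simp only [Finset.mem_filter, Finset.mem_univ, true_and] at hH
      by_cases hHG : H.1 ⊆ G
      · have h4 : M.natRk F < M.natRk H.1 := hF.natRk_lt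
          (hH.1.ssubset_of_ne fun h ↦ hne (Subtype.ext (h.symm.trans hP.symm))) H.2.1.subset_ground
        have h5 := M.chowX_mul_chowH_pow hG.subset_ground n H.1 hH.2
          (by rw [union_eq_right.2 hHG]; omega)
        linear_combination M.chowXTop G * h5
      · have h5 : M.chowXTop G * M.chowX H.1 = 0 := by
          rw [chowXTop, if_neg fun h ↦ hHG (H.2.1.subset_ground.trans h.symm.subset)]
          exact M.chowX_mul_chowX hH.2 hHG
        linear_combination M.chowH G ^ n * h5
    · intro h
      simp [hP, hFG.not_subset] at h
  have h6 : n + 1 + M.natRk F = M.natRk G := hn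
  rw [← h6, ← h1]
  linear_combination -M.chowH F ^ M.natRk F * h3 - M.chowXTop G * M.chowH G ^ n * h2

theorem chowH_pow_mul_chowX (hF : M.IsFlat F) (hFE : F ≠ M.E) :
    M.chowH M.E ^ (M.natRank - M.natRk F - 1) * (M.chowX F * M.chowH F ^ M.natRk F) =
      M.chowH M.E ^ M.natRank := by
  have h := hF.natRk_lt (hF.subset_ground.ssubset_of_ne hFE) subset_rfl
  rw [natRk_ground] at h
  have := M.chowXTop_mul_pow hF M.ground_isFlat (hF.subset_ground.ssubset_of_ne hFE)
    (n := M.natRank - M.natRk F - 1) (by rw [natRk_ground]; omega)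
  simpa [chowXTop, natRk_ground] using this

end

/-! ### Spanning sets of monomials in the classes `h_S` -/

section

variable (M : Matroid α) {F G S T : Set α}

/-- The sum of the ranks of the members of a multiset. -/
def rankSum (s : Multiset (Set α)) : ℕ := (s.map M.natRk).sum

@[simp] theorem rankSum_cons (S : Set α) (s : Multiset (Set α)) :
    M.rankSum (S ::ₘ s) = M.natRk S + M.rankSum s := by simp [rankSum]

@[simp] theorem rankSum_add (s t : Multiset (Set α)) :
    M.rankSum (s + t) = M.rankSum s + M.rankSum t := by simp [rankSum]

variable [M.Finite]

@[simp] theorem chowHProd_zero : M.chowHProd 0 = 1 := by simp [chowHProd]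

@[simp] theorem chowHProd_cons (S : Set α) (s : Multiset (Set α)) :
    M.chowHProd (S ::ₘ s) = M.chowH S * M.chowHProd s := by simp [chowHProd]

@[simp] theorem chowHProd_add (s t : Multiset (Set α)) :
    M.chowHProd (s + t) = M.chowHProd s * M.chowHProd t := by simp [chowHProd]

@[simp] theorem chowHProd_replicate (n : ℕ) (S : Set α) :
    M.chowHProd (Multiset.replicate n S) = M.chowH S ^ n := by simp [chowHProd]

theorem chowX_mem_span (n : ℕ) : ∀ F : Set α, (M.E \ F).ncard ≤ n →
    M.chowX F ∈ Submodule.span ℚ (M.chowH '' {S | M.IsFlat S ∧ F ⊆ S}) := by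
  induction n using Nat.strong_induction_on with
  | _ n ih =>
  intro F hn
  by_cases hF : M.IsFlat F ∧ F ≠ M.E
  swap
  · rw [M.chowX_of_not hF]
    exact zero_mem _
  rw [M.chowX_eq_chowH_sub hF.1 hF.2]
  refine sub_mem (sub_mem ?_ ?_) (Submodule.sum_mem _ fun G hG ↦ ?_)
  · exact Submodule.subset_span ⟨_, ⟨M.ground_isFlat, hF.1.subset_ground⟩, rfl⟩
  · exact Submodule.subset_span ⟨_, ⟨hF.1, subset_rfl⟩, rfl⟩
  · simp only [Finset.mem_filter, Finset.mem_univ, true_and] at hG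
    obtain ⟨e, heG, heF⟩ := exists_of_ssubset hG
    have hlt : (M.E \ G.1).ncard < (M.E \ F).ncard := by
      refine ncard_lt_ncard (ssubset_of_subset_not_subset (sdiff_subset_sdiff_right hG.subset)
        fun h ↦ ?_) M.ground_finite.sdiff
      exact (h (show e ∈ M.E \ F from ⟨G.2.1.subset_ground heG, heF⟩)).2 heG
    have hsub : {S | M.IsFlat S ∧ G.1 ⊆ S} ⊆ {S | M.IsFlat S ∧ F ⊆ S} :=
      fun S hS ↦ ⟨hS.1, hG.subset.trans hS.2⟩
    exact Submodule.span_mono (image_mono hsub)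
      (ih _ (hlt.trans_le hn) G.1 le_rfl)

open scoped Pointwise in
theorem span_chowH_pow_le (P : Set α → Prop) (n : ℕ) :
    Submodule.span ℚ (M.chowH '' {S | P S}) ^ n ≤
      Submodule.span ℚ (M.chowHProd '' {s | s.card = n ∧ ∀ S ∈ s, P S}) := by
  rw [Submodule.span_pow]
  refine Submodule.span_mono ?_
  induction n with
  | zero =>
    rintro _ rfl
    exact ⟨0, by simp, by simp⟩
  | succ n ih =>
    rw [pow_succ]
    rintro _ ⟨a, ha, _, ⟨S, hS, rfl⟩, rfl⟩
    obtain ⟨s, hs, rfl⟩ := ih ha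
    refine ⟨S ::ₘ s, ⟨by simp [hs.1], ?_⟩, by simp [mul_comm]⟩
    simpa using ⟨hS, hs.2⟩

theorem chowGr_le_span (k : ℕ) : M.chowGr k ≤
    Submodule.span ℚ (M.chowHProd '' {s | s.card = k ∧ ∀ S ∈ s, M.IsFlat S}) := by
  refine le_trans ?_ (M.span_chowH_pow_le M.IsFlat k)
  rw [chowGr, ← homogeneousSubmodule_one_pow, Submodule.map_pow]
  refine pow_le_pow_left' ?_ k
  rw [homogeneousSubmodule_one_eq_span_X, Submodule.map_span, Submodule.span_le]
  rintro _ ⟨_, ⟨v, rfl⟩, rfl⟩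
  rcases v with e | F
  · change M.chowY e ∈ _
    rw [← chowH_singleton, ← M.chowH_closure (singleton_subset_iff.2 e.2)]
    exact Submodule.subset_span ⟨_, M.isFlat_closure _, rfl⟩
  · change M.chowMk (X (Sum.inr F)) ∈ _
    rw [← chowX_eq]
    exact Submodule.span_mono (image_mono fun S hS ↦ hS.1) (M.chowX_mem_span _ F.1 le_rfl)

theorem mem_iSup_chowGr (z : M.AugChow) : z ∈ ⨆ k, M.chowGr k := by
  obtain ⟨p, rfl⟩ := M.chowMk_surjective z
  rw [← sum_homogeneousComponent p, map_sum]
  exact Submodule.sum_mem _ fun k _ ↦ Submodule.mem_iSup_of_mem k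
    ⟨_, homogeneousComponent_isHomogeneous k p, rfl⟩

theorem mem_span_chowHProd (z : M.AugChow) :
    z ∈ Submodule.span ℚ (M.chowHProd '' {s | ∀ S ∈ s, M.IsFlat S}) := by
  have h : ⨆ k, M.chowGr k ≤ Submodule.span ℚ (M.chowHProd '' {s | ∀ S ∈ s, M.IsFlat S}) :=
    iSup_le fun k ↦ (M.chowGr_le_span k).trans (Submodule.span_mono (image_mono fun s hs ↦ hs.2))
  exact h (M.mem_iSup_chowGr z)

/-- Standard multisets of flats index the monomial basis of `CH(M)`: the members form a chain, and
their multiplicities are bounded by the differences of their ranks. -/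
structure Standard (s : Multiset (Set α)) : Prop where
  isFlat : ∀ F ∈ s, M.IsFlat F
  chain : ∀ F ∈ s, ∀ G ∈ s, F ⊆ G ∨ G ⊆ F
  count_le : ∀ F ∈ s, s.count F ≤ M.natRk F
  count_lt : ∀ F ∈ s, ∀ G ∈ s, G ⊂ F → s.count F + M.natRk G < M.natRk F

theorem rankSum_le (s : Multiset (Set α)) : M.rankSum s ≤ s.card * M.natRank := by
  induction s using Multiset.induction with
  | empty => simp [rankSum]
  | cons S s ih =>
    have := M.natRk_le_natRank S
    rw [rankSum_cons, Multiset.card_cons, add_mul]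
    omega

/-- Each failure of standardness allows a rewriting that keeps the number of factors and raises the
bounded rank sum, or gives zero: incomparable F, G are pushed to their join, h_F ^ (rk F + 1)
vanishes, and a factor G below a high power of F becomes another F. -/
theorem chowHProd_mem_span_standard (n : ℕ) : ∀ s : Multiset (Set α), (∀ F ∈ s, M.IsFlat F) →
    s.card * M.natRank - M.rankSum s ≤ n →
    M.chowHProd s ∈ Submodule.span ℚ (M.chowHProd '' {s | M.Standard s}) := by
  induction n using Nat.strong_induction_on with
  | _ n ih =>
  intro s hs hn
  have step (t : Multiset (Set α)) (ht : ∀ F ∈ t, M.IsFlat F) (hc : t.card = s.card)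
      (hr : M.rankSum s < M.rankSum t) :
      M.chowHProd t ∈ Submodule.span ℚ (M.chowHProd '' {s | M.Standard s}) := by
    refine ih _ (lt_of_lt_of_le ?_ hn) t ht le_rfl
    have := M.rankSum_le t
    rw [hc] at this ⊢
    omega
  by_cases hch : ∀ F ∈ s, ∀ G ∈ s, F ⊆ G ∨ G ⊆ F
  swap
  · push Not at hch
    obtain ⟨F, hF, G, hG, hFG, hGF⟩ := hch
    obtain ⟨t, rfl⟩ := Multiset.exists_cons_of_mem hF
    have hG' : G ∈ t := (Multiset.mem_cons.1 hG).resolve_left fun h ↦ hFG h.symm.subset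
    obtain ⟨t, rfl⟩ := Multiset.exists_cons_of_mem hG'
    have hFf := hs F hF
    have hGf := hs G hG
    have hE := union_subset hFf.subset_ground hGf.subset_ground
    set H := M.closure (F ∪ G) with hH
    have hHf : M.IsFlat H := M.isFlat_closure _
    have hsub : F ∪ G ⊆ H := M.subset_closure _ hE
    have h1 : M.natRk F < M.natRk H := hFf.natRk_lt (ssubset_of_subset_not_subset
      (subset_union_left.trans hsub) fun h ↦ hGF (subset_union_right.trans (hsub.trans h)))
      hHf.subset_ground
    have h2 : M.natRk G < M.natRk H := hGf.natRk_lt (ssubset_of_subset_not_subset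
      (subset_union_right.trans hsub) fun h ↦ hFG (subset_union_left.trans (hsub.trans h)))
      hHf.subset_ground
    have hst : ∀ F ∈ t, M.IsFlat F := fun K hK ↦
      hs K (Multiset.mem_cons_of_mem (Multiset.mem_cons_of_mem hK))
    have hcc (A B : Set α) (hA : M.IsFlat A) (hB : M.IsFlat B) : ∀ K ∈ A ::ₘ B ::ₘ t, M.IsFlat K := by
      intro K hK
      rw [Multiset.mem_cons, Multiset.mem_cons] at hK
      rcases hK with rfl | rfl | hK
      exacts [hA, hB, hst K hK]
    have h3 : M.chowHProd (F ::ₘ G ::ₘ t) = M.chowHProd (F ::ₘ H ::ₘ t) +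
        M.chowHProd (G ::ₘ H ::ₘ t) - M.chowHProd (H ::ₘ H ::ₘ t) := by
      simp only [chowHProd_cons]
      linear_combination M.chowHProd t * M.chowH_mul_chowH_eq hFf.subset_ground hGf.subset_ground
    rw [h3]
    refine sub_mem (add_mem (step _ (hcc _ _ hFf hHf) (by simp) ?_)
      (step _ (hcc _ _ hGf hHf) (by simp) ?_)) (step _ (hcc _ _ hHf hHf) (by simp) ?_) <;>
    · simp only [rankSum_cons]
      omega
  by_cases hle : ∀ F ∈ s, s.count F ≤ M.natRk F
  swap
  · push Not at hle
    obtain ⟨F, hF, hlt⟩ := hle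
    obtain ⟨t, ht⟩ := Multiset.le_iff_exists_add.1 (Multiset.le_count_iff_replicate_le.1
      (le_refl (s.count F)))
    rw [ht, chowHProd_add, chowHProd_replicate,
      M.chowH_pow_eq_zero (hs F hF).subset_ground hlt, zero_mul]
    exact zero_mem _
  by_cases hlt : ∀ F ∈ s, ∀ G ∈ s, G ⊂ F → s.count F + M.natRk G < M.natRk F
  swap
  · push Not at hlt
    obtain ⟨F, hF, G, hG, hGF, hlt⟩ := hlt
    obtain ⟨t, ht⟩ := Multiset.le_iff_exists_add.1 (Multiset.le_count_iff_replicate_le.1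
      (le_refl (s.count F)))
    have hGt : G ∈ t := by
      rw [ht, Multiset.mem_add] at hG
      exact hG.resolve_left fun h ↦ hGF.ne (Multiset.eq_of_mem_replicate h)
    obtain ⟨t, rfl⟩ := Multiset.exists_cons_of_mem hGt
    have h1 : M.chowHProd s = M.chowHProd (Multiset.replicate (s.count F + 1) F + t) := by
      rw [ht, chowHProd_add, chowHProd_replicate, chowHProd_cons, ← ht, chowHProd_add,
        chowHProd_replicate, ← M.chowH_mul_chowH_pow hGF.subset (hs F hF).subset_ground
          (n := s.count F) (by omega)]
      ring
    rw [h1]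
    have h2 := (hs G hG).natRk_lt hGF (hs F hF).subset_ground
    refine step _ ?_ ?_ ?_
    · intro K hK
      rw [Multiset.mem_add] at hK
      rcases hK with hK | hK
      · rw [Multiset.eq_of_mem_replicate hK]
        exact hs F hF
      · refine hs K ?_
        rw [ht, Multiset.mem_add]
        exact Or.inr (Multiset.mem_cons_of_mem hK)
    · conv_rhs => rw [ht]
      simp only [Multiset.card_add, Multiset.card_replicate, Multiset.card_cons]
      omega
    · conv_lhs => rw [ht]
      simp only [rankSum_add, Multiset.replicate_succ, rankSum_cons]
      omega
  exact Submodule.subset_span ⟨s, ⟨hs, hch, hle, hlt⟩, rfl⟩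

theorem mem_span_standard (z : M.AugChow) :
    z ∈ Submodule.span ℚ (M.chowHProd '' {s | M.Standard s}) := by
  have h : Submodule.span ℚ (M.chowHProd '' {s | ∀ S ∈ s, M.IsFlat S}) ≤
      Submodule.span ℚ (M.chowHProd '' {s | M.Standard s}) := by
    rw [Submodule.span_le]
    rintro _ ⟨s, hs, rfl⟩
    exact M.chowHProd_mem_span_standard _ s hs le_rfl
  exact h (M.mem_span_chowHProd z)

end

/-! ### Dominance of multisets of flats -/

theorem countP_le_countP_of_imp {β : Type*} {p q : β → Prop} [DecidablePred p]
    [DecidablePred q] {s : Multiset β}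
    (h : ∀ b ∈ s, p b → q b) : s.countP p ≤ s.countP q := by
  induction s using Multiset.induction with
  | empty => simp
  | cons b s ih =>
    have h1 := ih fun c hc ↦ h c (Multiset.mem_cons_of_mem hc)
    have h2 := h b (Multiset.mem_cons_self b s)
    rw [Multiset.countP_cons, Multiset.countP_cons]
    split_ifs <;> first | omega | tauto

theorem forall_of_countP_le {β : Type*} {p q : β → Prop} [DecidablePred p]
    [DecidablePred q] {s : Multiset β}
    (h : ∀ b ∈ s, p b → q b) (hle : s.countP q ≤ s.countP p) : ∀ b ∈ s, q b → p b := by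
  intro b hb hq
  by_contra hp
  obtain ⟨t, rfl⟩ := Multiset.exists_cons_of_mem hb
  have h1 := countP_le_countP_of_imp (s := t) fun c hc ↦ h c (Multiset.mem_cons_of_mem hc)
  rw [Multiset.countP_cons_of_pos _ hq, Multiset.countP_cons_of_neg _ hp] at hle
  omega

theorem countP_natRk_eq (M : Matroid α) (s : Multiset (Set α)) (k : ℕ) :
    s.countP (M.natRk · = k) + s.countP (M.natRk · < k) = s.countP (M.natRk · < k + 1) := by
  induction s using Multiset.induction with
  | empty => simp
  | cons S s ih =>
    simp only [Multiset.countP_cons]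
    split_ifs <;> omega

section

variable {M : Matroid α} [M.Finite] {s t : Multiset (Set α)}

/-- Layer-cake formula: d − rk S is the number of k < d with rk S ≤ k. -/
theorem rankSum_add_sum (M : Matroid α) [M.Finite] (s : Multiset (Set α)) :
    M.rankSum s + ∑ k ∈ Finset.range M.natRank, s.countP (M.natRk · < k + 1) =
      s.card * M.natRank := by
  induction s using Multiset.induction with
  | empty => simp [rankSum]
  | cons S s ih =>
    have h := M.natRk_le_natRank S
    have h1 : ∑ k ∈ Finset.range M.natRank, (if M.natRk S < k + 1 then 1 else 0) =
        M.natRank - M.natRk S := by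
      rw [← Finset.sum_filter, Finset.sum_const, smul_eq_mul, mul_one]
      have : ({k ∈ Finset.range M.natRank | M.natRk S < k + 1} : Finset ℕ) =
          Finset.Ico (M.natRk S) M.natRank := by
        ext k; simp; omega
      rw [this, Nat.card_Ico]
    simp only [Multiset.countP_cons, Finset.sum_add_distrib, h1, rankSum_cons, Multiset.card_cons,
      add_mul, one_mul]
    omega

theorem exists_max_natRk {s : Multiset (Set α)} (hs : s ≠ 0) (hf : ∀ F ∈ s, M.IsFlat F)
    (hch : ∀ F ∈ s, ∀ G ∈ s, F ⊆ G ∨ G ⊆ F) : ∃ F ∈ s, ∀ G ∈ s, G ⊆ F := by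
  obtain ⟨F, hF, hmax⟩ := Finset.exists_max_image s.toFinset M.natRk
    (by simpa [Multiset.toFinset_nonempty] using hs)
  rw [Multiset.mem_toFinset] at hF
  refine ⟨F, hF, fun G hG ↦ (hch F hF G hG).elim (fun h ↦ ?_) id⟩
  exact ((hf F hF).eq_of_subset_of_natRk_le h (hf G hG).subset_ground
    (hmax G (Multiset.mem_toFinset.2 hG))).symm.subset

/-- In the chain s, the members of rank below k all lie under the largest of them, where the
hypothesis applies. -/
theorem countP_natRk_lt_le (hs : ∀ F ∈ s, M.IsFlat F) (hch : ∀ F ∈ s, ∀ G ∈ s, F ⊆ G ∨ G ⊆ F)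
    (h : ∀ F ∈ s, s.countP (· ⊆ F) ≤ t.countP (· ⊆ F)) (k : ℕ) :
    s.countP (M.natRk · < k) ≤ t.countP (M.natRk · < k) := by
  by_cases h0 : s.filter (M.natRk · < k) = 0
  · rw [Multiset.countP_eq_card_filter, h0]
    simp
  obtain ⟨F, hF, hmax⟩ := exists_max_natRk (M := M) h0
    (fun F hF ↦ hs F (Multiset.mem_filter.1 hF).1)
    (fun F hF G hG ↦ hch F (Multiset.mem_filter.1 hF).1 G (Multiset.mem_filter.1 hG).1)
  rw [Multiset.mem_filter] at hF
  calc s.countP (M.natRk · < k) ≤ s.countP (· ⊆ F) :=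
        countP_le_countP_of_imp fun G hG hk ↦ hmax G (Multiset.mem_filter.2 ⟨hG, hk⟩)
    _ ≤ t.countP (· ⊆ F) := h F hF.1
    _ ≤ _ := countP_le_countP_of_imp fun G _ hG ↦ (M.natRk_mono hG).trans_lt hF.2

/-- This makes dominance triangular. Dominance forces t to have at least as many members of small
rank as s, so its rank sum is no larger; equality gives the same number of members of each rank, and
these must be the same flats. -/
theorem eq_of_rankSum_le (hs : ∀ F ∈ s, M.IsFlat F) (ht : ∀ F ∈ t, M.IsFlat F)
    (hch : ∀ F ∈ s, ∀ G ∈ s, F ⊆ G ∨ G ⊆ F) (hc : t.card = s.card)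
    (h : ∀ F ∈ s, s.countP (· ⊆ F) ≤ t.countP (· ⊆ F)) (hr : M.rankSum s ≤ M.rankSum t) :
    t = s := by
  have h1 := M.rankSum_add_sum s
  have h2 := M.rankSum_add_sum t
  rw [hc] at h2
  have h3 := Finset.sum_le_sum fun k (_ : k ∈ Finset.range M.natRank) ↦
    countP_natRk_lt_le hs hch h (k + 1)
  have h4 := (Finset.sum_eq_sum_iff_of_le fun k (_ : k ∈ Finset.range M.natRank) ↦
    countP_natRk_lt_le hs hch h (k + 1)).1 (by omega)
  have h5 (k : ℕ) : s.countP (M.natRk · < k) = t.countP (M.natRk · < k) := by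
    rcases k with _ | k
    · simp
    by_cases hk : k < M.natRank
    · exact h4 k (Finset.mem_range.2 hk)
    · have h6 (u : Multiset (Set α)) : u.countP (M.natRk · < k + 1) = u.card :=
        Multiset.countP_eq_card.2 fun S _ ↦ by have := M.natRk_le_natRank S; omega
      rw [h6, h6, hc]
  have h6 (k : ℕ) : s.countP (M.natRk · = k) = t.countP (M.natRk · = k) := by
    have h7 := M.countP_natRk_eq s k
    have h8 := M.countP_natRk_eq t k
    rw [h5, h5] at h7
    omega
  have h7 (F : Set α) (hF : F ∈ s) (G : Set α) (hG : G ∈ t) (hFG : M.natRk G = M.natRk F) :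
      G = F := by
    -- All members of t of rank at most rk F lie in F, by comparing counts; one of rank exactly rk F
    -- then equals F.
    have h8 : t.countP (M.natRk · < M.natRk F + 1) ≤ t.countP (· ⊆ F) := by
      rw [← h5]
      refine le_trans (countP_le_countP_of_imp fun K hK hK' ↦ ?_) (h F hF)
      refine (hch F hF K hK).elim (fun h ↦ ?_) id
      exact ((hs F hF).eq_of_subset_of_natRk_le h (hs K hK).subset_ground
        (by omega)).symm.subset
    have h9 := forall_of_countP_le (p := (· ⊆ F)) (q := (M.natRk · < M.natRk F + 1)) (fun K _ hK ↦ Nat.lt_succ_of_le (M.natRk_mono hK)) h8 G hG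
      (by omega)
    exact (ht G hG).eq_of_subset_of_natRk_le h9 (hs F hF).subset_ground hFG.symm.le
  have h8 (F : Set α) (hF : F ∈ s) (G : Set α) (hG : G ∈ s) (hFG : M.natRk G = M.natRk F) :
      G = F := by
    rcases hch F hF G hG with h | h
    · exact ((hs F hF).eq_of_subset_of_natRk_le h (hs G hG).subset_ground hFG.le).symm
    · exact (hs G hG).eq_of_subset_of_natRk_le h (hs F hF).subset_ground hFG.symm.le
  have h9 (F : Set α) (hF : F ∈ s) : t.count F = s.count F := by
    have h10 : s.countP (M.natRk · = M.natRk F) = s.count F :=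
      Multiset.countP_congr rfl fun G hG ↦
        propext ⟨fun h ↦ (h8 F hF G hG h).symm, fun h ↦ by rw [h]⟩
    have h11 : t.countP (M.natRk · = M.natRk F) = t.count F :=
      Multiset.countP_congr rfl fun G hG ↦
        propext ⟨fun h ↦ (h7 F hF G hG h).symm, fun h ↦ by rw [h]⟩
    rw [← h10, ← h11, h6]
  ext F
  by_cases hF : F ∈ s
  · exact h9 F hF
  rw [Multiset.count_eq_zero.2 hF, Multiset.count_eq_zero]
  intro hFt
  have h10 : 0 < t.countP (M.natRk · = M.natRk F) := Multiset.countP_pos.2 ⟨F, hFt, rfl⟩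
  rw [← h6, Multiset.countP_pos] at h10
  obtain ⟨G, hG, hGF⟩ := h10
  exact hF (h7 G hG F hFt hGF.symm ▸ hG)

end

/-! ### Degrees of monomials with one factor `x_F` -/

section

variable (M : Matroid α) [M.Finite] {F G S T : Set α} {s : Multiset (Set α)}

/-- Tight flats are closed under join, and cl ∅ is tight. The ground set is not, since s has only d
− 1 members. -/
theorem exists_max_tight (hd : s.card + 1 = M.natRank)
    (hs : ∀ G, M.IsFlat G → s.countP (· ⊆ G) ≤ M.natRk G) :
    ∃ T, M.IsFlat T ∧ T ≠ M.E ∧ M.natRk T ≤ s.countP (· ⊆ T) ∧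
      ∀ G, M.IsFlat G → M.natRk G ≤ s.countP (· ⊆ G) → G ⊆ T := by
  have hfin : {G | M.IsFlat G ∧ M.natRk G ≤ s.countP (· ⊆ G)}.Finite :=
    M.ground_finite.finite_subsets.subset fun G hG ↦ hG.1.subset_ground
  have hne : {G | M.IsFlat G ∧ M.natRk G ≤ s.countP (· ⊆ G)}.Nonempty :=
    ⟨M.closure ∅, M.isFlat_closure _, by rw [natRk_closure, natRk_empty]; exact Nat.zero_le _⟩
  obtain ⟨T, hT⟩ := hfin.exists_maximal hne
  refine ⟨T, hT.prop.1, fun h ↦ ?_, hT.prop.2, fun G hG hG' ↦ ?_⟩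
  · have h1 := hT.prop.2
    have h2 := Multiset.countP_le_card (· ⊆ T) s
    rw [h, natRk_ground] at h1
    rw [h] at h2
    omega
  · have h1 := countP_closure_union_of_tight hs hT.prop.1 hG hT.prop.2 hG'
    have h2 := M.subset_closure (T ∪ G) (union_subset hT.prop.1.subset_ground hG.subset_ground)
    exact (subset_union_right.trans h2).trans
      (hT.le_of_ge ⟨M.isFlat_closure _, h1⟩ (subset_union_left.trans h2))

theorem chowX_mem_span_isFlat (F : Set α) :
    M.chowX F ∈ Submodule.span ℚ (M.chowH '' {S | M.IsFlat S}) :=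
  Submodule.span_mono (image_mono fun _ hS ↦ hS.1) (M.chowX_mem_span _ F le_rfl)

variable [M.Loopless]

/-- Adjoining A to s violates Hall–Rado exactly when A lies in a tight flat, that is, in T. So
deg(h_A h_s) = [A ⊄ T], and Möbius inversion turns this into the delta function at T. -/
theorem chowDeg_chowX_mul_of_tight (hf : ∀ S ∈ s, M.IsFlat S) (hd : s.card + 1 = M.natRank)
    (hs : ∀ G, M.IsFlat G → s.countP (· ⊆ G) ≤ M.natRk G) (hTE : T ≠ M.E)
    (hT : M.IsFlat T) (hTt : M.natRk T ≤ s.countP (· ⊆ T))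
    (hmax : ∀ G, M.IsFlat G → M.natRk G ≤ s.countP (· ⊆ G) → G ⊆ T) (n : ℕ) :
    ∀ F, M.IsFlat F → F ≠ M.E → (M.E \ F).ncard ≤ n →
      M.chowDeg (M.chowX F * M.chowHProd s) = if F = T then 1 else 0 := by
  have hflat (A : Set α) (hA : M.IsFlat A) : ∀ S ∈ A ::ₘ s, M.IsFlat S := by
    intro S hS
    rcases Multiset.mem_cons.1 hS with rfl | hS
    exacts [hA, hf S hS]
  have hHR (A : Set α) (hA : M.IsFlat A) : M.HallRado (A ::ₘ s) ↔ ¬ A ⊆ T := by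
    simp only [HallRado, Multiset.card_cons, hd, true_and, Multiset.countP_cons]
    refine ⟨fun h hAT ↦ ?_, fun h K hK ↦ ?_⟩
    · have := h T hT
      rw [if_pos hAT] at this
      omega
    · split_ifs with hAK
      · by_contra hcon
        exact h (hAK.trans (hmax K hK (by omega)))
      · exact hs K hK
  have hdeg (A : Set α) (hA : M.IsFlat A) :
      M.chowDeg (M.chowH A * M.chowHProd s) = if A ⊆ T then 0 else 1 := by
    rw [← chowHProd_cons, M.chowDeg_chowHProd (hflat A hA)]
    by_cases h : A ⊆ T <;> simp [hHR A hA, h]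
  induction n using Nat.strong_induction_on with
  | _ n ih =>
  intro F hF hFE hn
  rw [M.chowX_eq_chowH_sub hF hFE, sub_mul, sub_mul, map_sub, map_sub, hdeg _ hF,
    hdeg _ M.ground_isFlat, Finset.sum_mul, map_sum,
    if_neg fun h ↦ hTE (subset_antisymm hT.subset_ground h)]
  have h1 : ∑ G : M.ProperFlat with F ⊂ G.1, M.chowDeg (M.chowX G.1 * M.chowHProd s) =
      ∑ G : M.ProperFlat with F ⊂ G.1, if G.1 = T then (1 : ℚ) else 0 := by
    refine Finset.sum_congr rfl fun G hG ↦ ?_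
    simp only [Finset.mem_filter, Finset.mem_univ, true_and] at hG
    obtain ⟨e, heG, heF⟩ := exists_of_ssubset hG
    have hlt : (M.E \ G.1).ncard < (M.E \ F).ncard := by
      refine ncard_lt_ncard (ssubset_of_subset_not_subset (sdiff_subset_sdiff_right hG.subset)
        fun h ↦ ?_) M.ground_finite.sdiff
      exact (h (show e ∈ M.E \ F from ⟨G.2.1.subset_ground heG, heF⟩)).2 heG
    exact ih _ (hlt.trans_le hn) G.1 G.2.1 G.2.2 le_rfl
  obtain ⟨P, rfl⟩ : ∃ P : M.ProperFlat, P.1 = T := ⟨⟨T, hT, hTE⟩, rfl⟩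
  have h2 : ∑ G : M.ProperFlat with F ⊂ G.1, (if G.1 = P.1 then (1 : ℚ) else 0) =
      if F ⊂ P.1 then 1 else 0 := by
    have h3 (G : M.ProperFlat) : (G.1 = P.1) = (G = P) :=
      propext ⟨fun h ↦ Subtype.ext h, fun h ↦ by rw [h]⟩
    simp only [h3]
    rw [Finset.sum_ite_eq']
    simp
  rw [h1, h2]
  by_cases h3 : F = P.1
  · rw [if_pos h3, if_pos h3.subset, if_neg fun h ↦ h.ne h3]
    norm_num
  · by_cases h4 : F ⊆ P.1
    · rw [if_neg h3, if_pos h4, if_pos (h4.ssubset_of_ne h3)]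
      norm_num
    · rw [if_neg h3, if_neg h4, if_neg fun h ↦ h4 h.subset]
      norm_num

theorem chowDeg_eq_zero_of_forall {z : M.AugChow} (hf : ∀ S ∈ s, M.IsFlat S)
    (h : ∀ S, M.IsFlat S → ¬ M.HallRado (S ::ₘ s))
    (hz : z ∈ Submodule.span ℚ (M.chowH '' {S | M.IsFlat S})) :
    M.chowDeg (z * M.chowHProd s) = 0 := by
  induction hz using Submodule.span_induction with
  | mem x hx =>
    obtain ⟨S, hS, rfl⟩ := hx
    rw [← chowHProd_cons, chowDeg_chowHProd, if_neg (h S hS)]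
    intro T hT
    rcases Multiset.mem_cons.1 hT with rfl | hT
    exacts [hS, hf T hT]
  | zero => simp
  | add x y _ _ hx hy => rw [add_mul, map_add, hx, hy, add_zero]
  | smul a x _ hx => rw [smul_mul_assoc, map_smul, hx, smul_zero]

/-- Since x_F is a combination of classes h_S, a wrong number of factors or an inequality already
violated by s makes every term vanish. Otherwise F must be the maximal tight flat. -/
theorem of_chowDeg_chowX_mul_ne_zero (hf : ∀ S ∈ s, M.IsFlat S)
    (h : M.chowDeg (M.chowX F * M.chowHProd s) ≠ 0) :
    s.card + 1 = M.natRank ∧ (∀ G, M.IsFlat G → s.countP (· ⊆ G) ≤ M.natRk G) ∧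
      s.countP (· ⊆ F) = M.natRk F := by
  by_cases hF : M.IsFlat F ∧ F ≠ M.E
  swap
  · rw [M.chowX_of_not hF, zero_mul, map_zero] at h
    exact absurd rfl h
  have h1 : s.card + 1 = M.natRank := by
    by_contra hd
    refine h (M.chowDeg_eq_zero_of_forall hf (fun S _ hS ↦ hd ?_) (M.chowX_mem_span_isFlat F))
    rw [← hS.1, Multiset.card_cons]
  have h2 : ∀ G, M.IsFlat G → s.countP (· ⊆ G) ≤ M.natRk G := by
    by_contra! hd
    obtain ⟨G, hG, hlt⟩ := hd
    refine h (M.chowDeg_eq_zero_of_forall hf (fun S _ hS ↦ ?_) (M.chowX_mem_span_isFlat F))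
    have := hS.2 G hG
    rw [Multiset.countP_cons] at this
    omega
  obtain ⟨T, hT, hTE, hTt, hmax⟩ := M.exists_max_tight h1 h2
  have h3 := M.chowDeg_chowX_mul_of_tight hf h1 h2 hTE hT hTt hmax _ F hF.1 hF.2 le_rfl
  refine ⟨h1, h2, ?_⟩
  by_cases hFT : F = T
  · rw [hFT]
    exact le_antisymm (h2 T hT) hTt
  · rw [h3, if_neg hFT] at h
    exact absurd rfl h

/-- The span of the classes `h_S` of the flats not contained in `F`. -/
def spanNotLE (M : Matroid α) [M.Finite] (F : Set α) : Submodule ℚ M.AugChow :=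
  Submodule.span ℚ (M.chowH '' {S | M.IsFlat S ∧ ¬ S ⊆ F})

/-- A nonzero degree requires rk F of the d − 1 factors next to x_F to lie in F, leaving room for
only d − 1 − rk F outside. -/
theorem chowDeg_eq_zero_of_mem_pow {n : ℕ} (hn : M.natRank ≤ M.natRk F + n) {u : M.AugChow}
    (hu : u ∈ M.spanNotLE F ^ n) (p : M.AugChow) : M.chowDeg (M.chowX F * u * p) = 0 := by
  have hu' := M.span_chowH_pow_le (fun S ↦ M.IsFlat S ∧ ¬ S ⊆ F) n hu
  clear hu
  induction hu' using Submodule.span_induction with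
  | zero => simp
  | add x y _ _ hx hy => rw [mul_add, add_mul, map_add, hx, hy, add_zero]
  | smul a x _ hx => rw [mul_smul_comm, smul_mul_assoc, map_smul, hx, smul_zero]
  | mem x hx =>
    obtain ⟨s, ⟨hsn, hs⟩, rfl⟩ := hx
    have hp := M.mem_span_chowHProd p
    induction hp using Submodule.span_induction with
    | zero => simp
    | add x y _ _ hx hy => rw [mul_add, map_add, hx, hy, add_zero]
    | smul a x _ hx => rw [mul_smul_comm, map_smul, hx, smul_zero]
    | mem x hx =>
      obtain ⟨t, ht, rfl⟩ := hx
      rw [mul_assoc, ← chowHProd_add]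
      by_contra hne
      obtain ⟨h1, -, h3⟩ := M.of_chowDeg_chowX_mul_ne_zero (fun S hS ↦
        (Multiset.mem_add.1 hS).elim (fun h ↦ (hs S h).1) (ht S)) hne
      have h4 : s.countP (· ⊆ F) = 0 := Multiset.countP_eq_zero.2 fun S hS ↦ (hs S hS).2
      have h5 := Multiset.countP_le_card (· ⊆ F) t
      rw [Multiset.countP_add, h4] at h3
      rw [Multiset.card_add] at h1
      omega

end

/-! ### Poincaré duality -/

theorem Standard.filter_ne {M : Matroid α} {s : Multiset (Set α)} (h : M.Standard s) (F : Set α) : M.Standard (s.filter (· ≠ F)) where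
  isFlat G hG := h.isFlat G (Multiset.mem_filter.1 hG).1
  chain G hG H hH := h.chain G (Multiset.mem_filter.1 hG).1 H (Multiset.mem_filter.1 hH).1
  count_le G hG := (Multiset.count_le_of_le G (Multiset.filter_le _ s)).trans
    (h.count_le G (Multiset.mem_filter.1 hG).1)
  count_lt G hG H hH hHG := lt_of_le_of_lt
    (Nat.add_le_add_right (Multiset.count_le_of_le G (Multiset.filter_le _ s)) _)
    (h.count_lt G (Multiset.mem_filter.1 hG).1 H (Multiset.mem_filter.1 hH).1 hHG)

section

variable (M : Matroid α) [M.Finite] {F G S T : Set α} {s : Multiset (Set α)}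

theorem eq_replicate_add_filter_ne (s : Multiset (Set α)) (F : Set α) :
    s = Multiset.replicate (s.count F) F + s.filter (· ≠ F) := by
  conv_lhs => rw [← Multiset.filter_add_not (· = F) s]
  rw [Multiset.filter_eq']

/-- The span of the classes `h_S` of all flats. -/
def spanFlat : Submodule ℚ M.AugChow := Submodule.span ℚ (M.chowH '' {S | M.IsFlat S})

theorem chowX_mul_pow_mem {P : Submodule ℚ M.AugChow} {t x h : M.AugChow} {m n : ℕ}
    (ht : t ∈ P ^ m) (hx : x ∈ P) (hh : h ∈ P) : t * (x * h ^ n) ∈ P ^ (m + (1 + n)) := by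
  rw [pow_add, pow_add, pow_one]
  exact Submodule.mul_mem_mul ht (Submodule.mul_mem_mul hx (Submodule.pow_mem_pow P hh n))

/-- For a standard multiset `s` of flats below `G`, there is a test class `t` such that the product
of `t` with the monomial of `s` fills up the interval below `G`. -/
theorem exists_test_below (n : ℕ) : ∀ s : Multiset (Set α), s.card ≤ n → M.Standard s →
    ∀ G, M.IsFlat G → (∀ F ∈ s, F ⊂ G) → ∃ (j : ℕ) (t : M.AugChow) (N : ℕ),
      (∀ a, a ≤ M.natRk G → (∀ F ∈ s, a + M.natRk F < M.natRk G) → a ≤ j) ∧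
      M.chowXTop G * M.chowH G ^ j * (M.chowHProd s * t) =
        M.chowXTop G * M.chowH G ^ M.natRk G ∧
      t ∈ M.spanFlat ^ N ∧ N + s.card + j = M.natRk G ∧
      ∀ F ∈ s, ∃ (m : ℕ) (u p : M.AugChow), t = M.chowX F * u * p ∧ u ∈ M.spanNotLE F ^ m ∧
        m + s.countP (¬ · ⊆ F) + j + 1 + M.natRk F = M.natRk G := by
  -- Here j is the exponent left for h_G, and the first clause says that any multiplicity of G
  -- permitted by standardness fits into it. The last clause exhibits x_F as a factor of t and
  -- counts the factors outside F: for G = E they number d − 1 − rk F in total, the largest number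
  -- that does not force degree zero.
  induction n with
  | zero =>
    intro s hs _ G _ _
    obtain rfl : s = 0 := Multiset.card_eq_zero.1 (Nat.le_zero.1 hs)
    refine ⟨M.natRk G, 1, 0, fun a ha _ ↦ ha, by simp, ?_, by simp, by simp⟩
    exact Submodule.one_le.1 (le_of_eq (by rw [pow_zero]))
  | succ n ih =>
    intro s hn hs G hG hsG
    by_cases h0 : s = 0
    · exact ih s (by simp [h0]) hs G hG hsG
    obtain ⟨F, hF, hmax⟩ := exists_max_natRk (M := M) h0 hs.isFlat hs.chain
    have hFG := hsG F hF
    have hFf := hs.isFlat F hF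
    have hFE : F ≠ M.E := fun h ↦ hFG.not_subset (hG.subset_ground.trans h.symm.subset)
    have hrk := hFf.natRk_lt hFG hG.subset_ground
    set a := s.count F with ha
    set s₁ := s.filter (· ≠ F) with hs₁
    have hsum : s = Multiset.replicate a F + s₁ := eq_replicate_add_filter_ne s F
    have hmem {K : Set α} (hK : K ∈ s₁) : K ∈ s ∧ K ≠ F := Multiset.mem_filter.1 hK
    have hcard : s.card = a + s₁.card := by
      conv_lhs => rw [hsum]
      simp
    have hapos : 0 < a := Multiset.count_pos.2 hF
    have hlt {K : Set α} (hK : K ∈ s₁) : K ⊂ F :=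
      (hmax K (hmem hK).1).ssubset_of_ne (hmem hK).2
    obtain ⟨j, t, N, hj, heq, htN, hN, hV⟩ := ih s₁ (by omega) (hs.filter_ne F) F hFf
      fun K hK ↦ hlt hK
    have haj : a ≤ j := hj a (hs.count_le F hF) fun K hK ↦
      hs.count_lt F hF K (hmem hK).1 (hlt hK)
    -- F is the top of the chain s. Of the h_F ^ j needed below F, s supplies a and the test class
    -- the remaining j − a. The factor x_F links the interval below F to G and uses one unit of
    -- rank, hence the −1.
    refine ⟨M.natRk G - M.natRk F - 1, t * (M.chowX F * M.chowH F ^ (j - a)),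
      N + (1 + (j - a)), ?_, ?_, ?_, by omega, ?_⟩
    · intro b _ hb
      have := hb F hF
      omega
    · rw [chowXTop, if_neg hFE] at heq
      have h1 := M.chowXTop_mul_pow hFf hG hFG (n := M.natRk G - M.natRk F - 1) (by omega)
      have h2 : M.chowHProd s = M.chowH F ^ a * M.chowHProd s₁ := by
        conv_lhs => rw [hsum]
        rw [chowHProd_add, chowHProd_replicate]
      have h3 : M.chowH F ^ j = M.chowH F ^ a * M.chowH F ^ (j - a) := by
        rw [← pow_add, Nat.add_sub_cancel' haj]
      rw [h3] at heq
      rw [← h1, h2]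
      linear_combination M.chowXTop G * M.chowH G ^ (M.natRk G - M.natRk F - 1) * heq
    · exact M.chowX_mul_pow_mem htN (M.chowX_mem_span_isFlat F)
        (Submodule.subset_span ⟨F, hFf, rfl⟩)
    · intro K hK
      by_cases hKF : K = F
      · subst hKF
        refine ⟨0, 1, t * M.chowH K ^ (j - a), by ring, ?_, ?_⟩
        · exact Submodule.one_le.1 (le_of_eq (by rw [pow_zero]))
        · have : s.countP (¬ · ⊆ K) = 0 :=
            Multiset.countP_eq_zero.2 fun L hL h ↦ h (hmax L hL)
          rw [this]
          omega
      · have hK₁ : K ∈ s₁ := Multiset.mem_filter.2 ⟨hK, hKF⟩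
        obtain ⟨m, u, p, rfl, hu, hm⟩ := hV K hK₁
        have hFK : ¬ F ⊆ K := (hlt hK₁).not_subset
        refine ⟨m + (1 + (j - a)), u * (M.chowX F * M.chowH F ^ (j - a)), p, by ring, ?_, ?_⟩
        · refine M.chowX_mul_pow_mem hu ?_ (Submodule.subset_span ⟨F, ⟨hFf, hFK⟩, rfl⟩)
          have hsub : {S | M.IsFlat S ∧ F ⊆ S} ⊆ {S | M.IsFlat S ∧ ¬ S ⊆ K} :=
            fun S hS ↦ ⟨hS.1, fun h ↦ hFK (hS.2.trans h)⟩
          exact Submodule.span_mono (image_mono hsub) (M.chowX_mem_span _ F le_rfl)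
        · have : s.countP (¬ · ⊆ K) = a + s₁.countP (¬ · ⊆ K) := by
            conv_lhs => rw [hsum]
            rw [Multiset.countP_add, Multiset.countP_eq_card.2, Multiset.card_replicate]
            intro L hL
            rwa [Multiset.eq_of_mem_replicate hL]
          omega

variable [M.Loopless]

theorem chowDeg_chowH_ground_pow : M.chowDeg (M.chowH M.E ^ M.natRank) = 1 := by
  rw [← chowHProd_replicate, chowDeg_chowHProd, if_pos]
  · refine ⟨Multiset.card_replicate _ _, fun G hG ↦ ?_⟩
    by_cases h : M.E ⊆ G
    · rw [subset_antisymm hG.subset_ground h, natRk_ground]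
      exact (Multiset.countP_le_card _ _).trans (Multiset.card_replicate _ _).le
    · rw [Multiset.countP_eq_zero.2]
      · exact Nat.zero_le _
      · intro S hS
        rwa [Multiset.eq_of_mem_replicate hS]
  · intro S hS
    rw [Multiset.eq_of_mem_replicate hS]
    exact M.ground_isFlat

theorem chowDeg_chowHProd_mul_eq_zero (hf : ∀ S ∈ s, M.IsFlat S) {N : ℕ} {t : M.AugChow}
    (ht : t ∈ M.spanFlat ^ N) (h : s.card + N ≠ M.natRank) :
    M.chowDeg (M.chowHProd s * t) = 0 := by
  have ht' := M.span_chowH_pow_le M.IsFlat N ht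
  clear ht
  induction ht' using Submodule.span_induction with
  | zero => simp
  | add x y _ _ hx hy => rw [mul_add, map_add, hx, hy, add_zero]
  | smul a x _ hx => rw [mul_smul_comm, map_smul, hx, smul_zero]
  | mem x hx =>
    obtain ⟨v, ⟨hvN, hv⟩, rfl⟩ := hx
    rw [← chowHProd_add, chowDeg_chowHProd, if_neg]
    · rintro ⟨h1, -⟩
      rw [Multiset.card_add, hvN] at h1
      exact h h1
    · intro S hS
      exact (Multiset.mem_add.1 hS).elim (hf S) (hv S)

/-- For each F in s other than E, the product h_s t contains x_F and already the maximal number of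
factors outside F. If s' has fewer members below F than s, it has more outside, and the degree
vanishes. -/
theorem exists_test (hs : M.Standard s) : ∃ t : M.AugChow,
    M.chowDeg (M.chowHProd s * t) = 1 ∧
    ∀ s' : Multiset (Set α), (∀ S ∈ s', M.IsFlat S) → M.chowDeg (M.chowHProd s' * t) ≠ 0 →
      s'.card = s.card ∧ ∀ F ∈ s, s.countP (· ⊆ F) ≤ s'.countP (· ⊆ F) := by
  set a := s.count M.E with ha
  set s₁ := s.filter (· ≠ M.E) with hs₁
  have hsum : s = Multiset.replicate a M.E + s₁ := eq_replicate_add_filter_ne s M.E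
  have hmem {K : Set α} (hK : K ∈ s₁) : K ∈ s ∧ K ≠ M.E := Multiset.mem_filter.1 hK
  have hlt {K : Set α} (hK : K ∈ s₁) : K ⊂ M.E :=
    (hs.isFlat K (hmem hK).1).subset_ground.ssubset_of_ne (hmem hK).2
  have hcard : s.card = a + s₁.card := by
    conv_lhs => rw [hsum]
    simp
  obtain ⟨j, t, N, hj, heq, htN, hN, hV⟩ := M.exists_test_below _ s₁ le_rfl
    (hs.filter_ne M.E) M.E M.ground_isFlat fun K hK ↦ hlt hK
  have haj : a ≤ j := by
    by_cases hE : M.E ∈ s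
    · exact hj a (hs.count_le _ hE) fun K hK ↦ hs.count_lt _ hE K (hmem hK).1 (hlt hK)
    · rw [ha, Multiset.count_eq_zero.2 hE]
      exact Nat.zero_le _
  rw [chowXTop, if_pos rfl, one_mul, one_mul, natRk_ground] at heq
  rw [natRk_ground] at hN
  have hEspan : M.chowH M.E ∈ M.spanFlat := Submodule.subset_span ⟨_, M.ground_isFlat, rfl⟩
  refine ⟨t * M.chowH M.E ^ (j - a), ?_, fun s' hs' hne ↦ ?_⟩
  · rw [← M.chowDeg_chowH_ground_pow, ← heq]
    congr 1
    have h3 : M.chowH M.E ^ j = M.chowH M.E ^ a * M.chowH M.E ^ (j - a) := by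
      rw [← pow_add, Nat.add_sub_cancel' haj]
    conv_lhs => rw [hsum]
    rw [chowHProd_add, chowHProd_replicate, h3]
    ring
  · have hc : s'.card = s.card := by
      have h1 : s'.card + (N + (j - a)) = M.natRank := by
        by_contra hcon
        refine hne (M.chowDeg_chowHProd_mul_eq_zero hs' ?_ hcon)
        rw [pow_add]
        exact Submodule.mul_mem_mul htN (Submodule.pow_mem_pow _ hEspan _)
      omega
    refine ⟨hc, fun F hF ↦ ?_⟩
    have hnot (v : Multiset (Set α)) : v.countP (· ⊆ F) + v.countP (¬ · ⊆ F) = v.card :=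
      (Multiset.card_eq_countP_add_countP _ v).symm
    by_cases hFE : F = M.E
    · rw [hFE, Multiset.countP_eq_card.2 fun S hS ↦ (hs.isFlat S hS).subset_ground,
        Multiset.countP_eq_card.2 fun S hS ↦ (hs' S hS).subset_ground, hc]
    have hF₁ : F ∈ s₁ := Multiset.mem_filter.2 ⟨hF, hFE⟩
    obtain ⟨m, u, p, rfl, hu, hm⟩ := hV F hF₁
    rw [natRk_ground] at hm
    have hEF : ¬ M.E ⊆ F := (hlt hF₁).not_subset
    by_contra hcon
    apply hne
    have h1 := hnot s
    have h2 := hnot s'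
    have h3 : s.countP (¬ · ⊆ F) = a + s₁.countP (¬ · ⊆ F) := by
      conv_lhs => rw [hsum]
      rw [Multiset.countP_add, Multiset.countP_eq_card.2, Multiset.card_replicate]
      intro L hL
      rwa [Multiset.eq_of_mem_replicate hL]
    have h4 : M.chowHProd s' = M.chowHProd (s'.filter (¬ · ⊆ F)) *
        M.chowHProd (s'.filter (· ⊆ F)) := by
      conv_lhs => rw [← Multiset.filter_add_not (· ⊆ F) s']
      rw [chowHProd_add, mul_comm]
    have h5 : M.chowHProd (s'.filter (¬ · ⊆ F)) ∈ M.spanNotLE F ^ (s'.countP (¬ · ⊆ F)) := by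
      rw [Multiset.countP_eq_card_filter]
      have : ∀ S ∈ s'.filter (¬ · ⊆ F), M.IsFlat S ∧ ¬ S ⊆ F := fun S hS ↦
        ⟨hs' S (Multiset.mem_filter.1 hS).1, (Multiset.mem_filter.1 hS).2⟩
      generalize s'.filter (¬ · ⊆ F) = v at this
      induction v using Multiset.induction with
      | empty => exact Submodule.one_le.1 (le_of_eq (by simp))
      | cons S v ih =>
        rw [chowHProd_cons, Multiset.card_cons, pow_succ']
        exact Submodule.mul_mem_mul (Submodule.subset_span
          ⟨S, this S (Multiset.mem_cons_self S v), rfl⟩)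
          (ih fun T hT ↦ this T (Multiset.mem_cons_of_mem hT))
    have h6 : M.chowHProd s' * (M.chowX F * u * p * M.chowH M.E ^ (j - a)) =
        M.chowX F * (M.chowHProd (s'.filter (¬ · ⊆ F)) * (u * M.chowH M.E ^ (j - a))) *
          (M.chowHProd (s'.filter (· ⊆ F)) * p) := by
      rw [h4]
      ring
    rw [h6]
    refine M.chowDeg_eq_zero_of_mem_pow (n := s'.countP (¬ · ⊆ F) + (m + (j - a))) (by omega) ?_ _
    rw [pow_add, pow_add]
    have hE : M.chowH M.E ∈ M.spanNotLE F :=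
      Submodule.subset_span ⟨_, ⟨M.ground_isFlat, hEF⟩, rfl⟩
    exact Submodule.mul_mem_mul h5 (Submodule.mul_mem_mul hu (Submodule.pow_mem_pow _ hE _))

/-- **Poincaré duality**: the bilinear form `(a, b) ↦ deg (a b)` on `CH(M)` is nondegenerate. -/
theorem eq_zero_of_forall_chowDeg {z : M.AugChow} (h : ∀ a, M.chowDeg (z * a) = 0) : z = 0 := by
  obtain ⟨c, hc, rfl⟩ := (Finsupp.mem_span_image_iff_linearCombination ℚ).1
    (M.mem_span_standard z)
  rw [Finsupp.mem_supported] at hc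
  by_contra hz
  have hne : c.support.Nonempty := by
    rw [Finset.nonempty_iff_ne_empty]
    intro h0
    rw [Finsupp.support_eq_empty.1 h0, map_zero] at hz
    exact hz rfl
  -- With s of least rank sum in the support, its test class sees no other monomial of the support,
  -- so it reads off the nonzero coefficient of s.
  obtain ⟨s, hs, hmin⟩ := Finset.exists_min_image c.support M.rankSum hne
  have hstd : M.Standard s := hc hs
  obtain ⟨t, ht, htest⟩ := M.exists_test hstd
  have h1 := h t
  rw [Finsupp.linearCombination_apply, Finsupp.sum, Finset.sum_mul, map_sum,
    Finset.sum_eq_single s] at h1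
  · rw [smul_mul_assoc, map_smul, ht, smul_eq_mul, mul_one] at h1
    exact Finsupp.mem_support_iff.1 hs h1
  · intro s' hs' hne'
    rw [smul_mul_assoc, map_smul]
    by_contra hcon
    have hstd' : M.Standard s' := hc hs'
    obtain ⟨hcard, hcount⟩ := htest s' hstd'.isFlat (fun h0 ↦ hcon (by rw [h0, smul_zero]))
    exact hne' (eq_of_rankSum_le hstd.isFlat hstd'.isFlat hstd.chain hcard hcount (hmin s' hs'))
  · exact fun h0 ↦ absurd hs h0

end

/-! ### The degree map -/

section

variable (M : Matroid α) [M.Finite]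

theorem chowGr_zero_le : ∀ a ∈ M.chowGr 0, ∃ c : ℚ, a = algebraMap ℚ M.AugChow c := by
  rintro _ ⟨p, hp, rfl⟩
  obtain ⟨c, rfl⟩ : ∃ c : ℚ, p = C c := by
    simp only [homogeneousSubmodule_zero, SetLike.mem_coe] at hp
    obtain ⟨c, hc⟩ := Submodule.mem_one.1 hp
    exact ⟨c, hc.symm⟩
  exact ⟨c, M.chowMk.commutes c⟩

theorem chowX_mem_chowGr (F : Set α) : M.chowX F ∈ M.chowGr 1 := by
  by_cases hF : M.IsFlat F ∧ F ≠ M.E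
  · rw [M.chowX_eq ⟨F, hF⟩]
    exact ⟨_, isHomogeneous_X ℚ _, rfl⟩
  · rw [M.chowX_of_not hF]
    exact zero_mem _

theorem chowH_mem_chowGr (S : Set α) : M.chowH S ∈ M.chowGr 1 :=
  Submodule.sum_mem _ fun F _ ↦ M.chowX_mem_chowGr F.1

theorem chowGr_pow_mem {a : M.AugChow} {k : ℕ} (ha : a ∈ M.chowGr k) (n : ℕ) :
    a ^ n ∈ M.chowGr (n * k) := by
  induction n with
  | zero => exact ⟨1, by rw [Nat.zero_mul]; exact isHomogeneous_one _ ℚ, by simp⟩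
  | succ n ih =>
    rw [pow_succ]
    exact M.chowGr_mul_mem (by ring) ih ha

theorem chowGr_induction {P : M.AugChow → Prop} (hadd : ∀ a b, P a → P b → P (a + b))
    (hgr : ∀ k, ∀ a ∈ M.chowGr k, P a) (z : M.AugChow) : P z := by
  refine Submodule.iSup_induction _ (motive := P) (M.mem_iSup_chowGr z) hgr
    (hgr 0 0 (zero_mem _)) fun x y ↦ hadd x y

variable [M.Loopless]

theorem chowDeg_eq_zero_of_mem_chowGr {k : ℕ} (hk : k ≠ M.natRank) {z : M.AugChow}
    (hz : z ∈ M.chowGr k) : M.chowDeg z = 0 := by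
  have hz' := M.chowGr_le_span k hz
  clear hz
  induction hz' using Submodule.span_induction with
  | zero => simp
  | add x y _ _ hx hy => rw [map_add, hx, hy, add_zero]
  | smul a x _ hx => rw [map_smul, hx, smul_zero]
  | mem x hx =>
    obtain ⟨s, ⟨hs, hf⟩, rfl⟩ := hx
    rw [M.chowDeg_chowHProd hf, if_neg]
    exact fun h ↦ hk (hs.symm.trans h.1)

theorem eq_zero_of_mem_chowGr {k : ℕ} (hk : M.natRank < k) {z : M.AugChow}
    (hz : z ∈ M.chowGr k) : z = 0 := by
  refine M.eq_zero_of_forall_chowDeg fun a ↦ ?_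
  refine M.chowGr_induction (P := fun a ↦ M.chowDeg (z * a) = 0) (fun a b ha hb ↦ ?_)
    (fun l a ha ↦ ?_) a
  · rw [mul_add, map_add, ha, hb, add_zero]
  · exact M.chowDeg_eq_zero_of_mem_chowGr (by omega) (M.chowGr_mul_mem rfl hz ha)

/-- By duality it suffices to test z − deg(z) w against homogeneous elements: those of positive
degree exceed degree d, and those of degree 0 are scalars. -/
theorem eq_smul_of_mem_chowGr {w z : M.AugChow} (hw : w ∈ M.chowGr M.natRank)
    (hw1 : M.chowDeg w = 1) (hz : z ∈ M.chowGr M.natRank) : z = M.chowDeg z • w := by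
  rw [← sub_eq_zero]
  refine M.eq_zero_of_forall_chowDeg fun a ↦ ?_
  have hmem : z - M.chowDeg z • w ∈ M.chowGr M.natRank :=
    sub_mem hz (Submodule.smul_mem _ _ hw)
  refine M.chowGr_induction (P := fun a ↦ M.chowDeg ((z - M.chowDeg z • w) * a) = 0)
    (fun a b ha hb ↦ ?_) (fun l a ha ↦ ?_) a
  · rw [mul_add, map_add, ha, hb, add_zero]
  · by_cases hl : l = 0
    · subst hl
      obtain ⟨c, rfl⟩ := M.chowGr_zero_le a ha
      rw [mul_comm, ← Algebra.smul_def, map_smul, map_sub, map_smul, hw1]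
      simp
    · exact M.chowDeg_eq_zero_of_mem_chowGr (k := M.natRank + l) (by omega)
        (M.chowGr_mul_mem rfl hmem ha)

/-- A flag of proper flats that contain a flat `F` has at most `d - rk F` members. -/
theorem card_flag_le (M : Matroid α) [M.Finite] {𝓕 : Finset M.ProperFlat} {F : Set α}
    (hflag : ∀ G ∈ 𝓕, ∀ H ∈ 𝓕, G.1 ⊆ H.1 ∨ H.1 ⊆ G.1) (hF : ∀ G ∈ 𝓕, F ⊆ G.1) :
    𝓕.card ≤ M.natRank - M.natRk F := by
  rw [← Nat.card_Ico]
  refine Finset.card_le_card_of_injOn (fun G ↦ M.natRk G.1) (fun G hG ↦ ?_) fun G hG H hH h ↦ ?_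
  · rw [Finset.coe_Ico, mem_Ico]
    refine ⟨M.natRk_mono (hF G hG), ?_⟩
    rw [← natRk_ground]
    exact G.2.1.natRk_lt (G.2.1.subset_ground.ssubset_of_ne G.2.2) subset_rfl
  · refine Subtype.ext ?_
    rcases hflag G hG H hH with h' | h'
    · exact G.2.1.eq_of_subset_of_natRk_le h' H.2.1.subset_ground h.symm.le
    · exact (H.2.1.eq_of_subset_of_natRk_le h' G.2.1.subset_ground h.le).symm

theorem chowDeg_prod_chowY {I : Finset ↥M.E} (hI : M.Indep (Subtype.val '' (I : Set ↥M.E)))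
    (hc : I.card = M.natRank) : M.chowDeg (∏ e ∈ I, M.chowY e) = 1 := by
  have h1 : ∏ e ∈ I, M.chowY e =
      M.chowHProd (I.val.map fun e ↦ M.closure {e.1}) := by
    rw [chowHProd, Multiset.map_map, Finset.prod]
    congr 1
    refine Multiset.map_congr rfl fun e _ ↦ ?_
    rw [Function.comp, M.chowH_closure (singleton_subset_iff.2 e.2), chowH_singleton]
  rw [h1, chowDeg_chowHProd, if_pos]
  · refine ⟨by rw [Multiset.card_map]; exact hc, fun G hG ↦ ?_⟩
    rw [Multiset.countP_map]
    have h2 : (I.val.filter fun e ↦ M.closure {e.1} ⊆ G).card =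
        (I.filter fun e ↦ e.1 ∈ G).card := by
      rw [Finset.card_def, Finset.filter_val]
      congr 1
      refine Multiset.filter_congr fun e _ ↦ ?_
      rw [hG.subset_iff_closure_subset (singleton_subset_iff.2 e.2), singleton_subset_iff]
    have h3 : M.Indep (Subtype.val '' ((I.filter fun e ↦ e.1 ∈ G : Finset ↥M.E) : Set ↥M.E)) :=
      hI.subset (image_mono (Finset.coe_subset.2 (Finset.filter_subset _ _)))
    have h4 := h3.natRk_eq_ncard
    rw [ncard_image_of_injective _ Subtype.val_injective, ncard_coe_finset] at h4
    rw [h2, ← h4]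
    refine M.natRk_mono ?_
    rintro _ ⟨e, he, rfl⟩
    simpa using (Finset.mem_filter.1 he).2
  · intro S hS
    obtain ⟨e, -, rfl⟩ := Multiset.mem_map.1 hS
    exact M.isFlat_closure _

/-- The least flat F of the flag can be traded for one more element of I. Maximality forces rk F =
|I|, so I spans F; for a suitable e ∉ F, expanding y_e y_I x_{𝓕∖F} leaves only the term x_F. The
induction ends at a basis monomial. -/
theorem chowDeg_monomial (n : ℕ) : ∀ (I : Finset ↥M.E) (𝓕 : Finset M.ProperFlat),
    I.card + 𝓕.card = M.natRank → M.CompatiblePair I 𝓕 → 𝓕.card = n →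
    M.chowDeg ((∏ e ∈ I, M.chowY e) * ∏ F ∈ 𝓕, M.chowX F.1) = 1 := by
  induction n with
  | zero =>
    intro I 𝓕 hc hp hn
    obtain rfl := Finset.card_eq_zero.1 hn
    rw [Finset.prod_empty, mul_one]
    exact M.chowDeg_prod_chowY hp.indep (by simpa using hc)
  | succ n ih =>
    intro I 𝓕 hc hp hn
    have hne : 𝓕.Nonempty := Finset.card_pos.1 (by omega)
    obtain ⟨F, hF, hmin⟩ := Finset.exists_min_image 𝓕 (fun F ↦ M.natRk F.1) hne
    have hFsub (G : M.ProperFlat) (hG : G ∈ 𝓕) : F.1 ⊆ G.1 := by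
      refine (hp.flag F hF G hG).elim id fun h ↦ ?_
      exact (G.2.1.eq_of_subset_of_natRk_le h F.2.1.subset_ground (hmin G hG)).symm.subset
    have hIncard : (Subtype.val '' (I : Set ↥M.E)).ncard = I.card := by
      rw [ncard_image_of_injective _ Subtype.val_injective, ncard_coe_finset]
    have hrI : M.natRk (Subtype.val '' (I : Set ↥M.E)) = I.card :=
      hp.indep.natRk_eq_ncard.trans hIncard
    have hIF : Subtype.val '' (I : Set ↥M.E) ⊆ F.1 := by
      rintro _ ⟨e, he, rfl⟩
      exact hp.compatible e he F hF
    have hrF : M.natRk F.1 = I.card := by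
      have h1 := M.card_flag_le hp.flag hFsub
      have h2 := M.natRk_mono hIF
      have h3 := M.natRk_le_natRank F.1
      omega
    have hcl : M.closure (Subtype.val '' (I : Set ↥M.E)) = F.1 := by
      refine (M.isFlat_closure _).eq_of_subset_of_natRk_le ?_ F.2.1.subset_ground ?_
      · exact (F.2.1.subset_iff_closure_subset hp.indep.subset_ground).2 hIF
      · rw [natRk_closure, hrF, hrI]
    -- Take e in the next member of the flag, or anywhere outside F if there is none.
    obtain ⟨e, heE, heF, he⟩ : ∃ e ∈ M.E, e ∉ F.1 ∧ ∀ G ∈ 𝓕.erase F, e ∈ G.1 := by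
      by_cases h0 : (𝓕.erase F).Nonempty
      · obtain ⟨G, hG, hGmin⟩ := Finset.exists_min_image (𝓕.erase F) (fun F ↦ M.natRk F.1) h0
        obtain ⟨hGF, hG'⟩ := Finset.mem_erase.1 hG
        have hss : F.1 ⊂ G.1 := (hFsub G hG').ssubset_of_ne fun h ↦ hGF (Subtype.ext h.symm)
        obtain ⟨e, heG, heF⟩ := exists_of_ssubset hss
        refine ⟨e, G.2.1.subset_ground heG, heF, fun H hH ↦ ?_⟩
        refine (hp.flag G hG' H (Finset.mem_erase.1 hH).2).elim (fun h ↦ h heG) fun h ↦ ?_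
        exact (H.2.1.eq_of_subset_of_natRk_le h G.2.1.subset_ground (hGmin H hH)).symm.subset heG
      · obtain ⟨e, heE, heF⟩ :=
          exists_of_ssubset (F.2.1.subset_ground.ssubset_of_ne F.2.2)
        rw [Finset.not_nonempty_iff_eq_empty] at h0
        exact ⟨e, heE, heF, by simp [h0]⟩
    set e' : ↥M.E := ⟨e, heE⟩ with he'
    have heI : e' ∉ I := fun h ↦ heF (hIF ⟨e', h, rfl⟩)
    have h1 : (∏ e ∈ I, M.chowY e) * ∏ F ∈ 𝓕, M.chowX F.1 =
        (∏ e ∈ insert e' I, M.chowY e) * ∏ F ∈ 𝓕.erase F, M.chowX F.1 := by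
      rw [Finset.prod_insert heI, ← Finset.mul_prod_erase 𝓕 _ hF]
      have hsum : M.chowY e' * (∏ e ∈ I, M.chowY e) * (∏ F ∈ 𝓕.erase F, M.chowX F.1) =
          M.chowX F.1 * (∏ e ∈ I, M.chowY e) * (∏ F ∈ 𝓕.erase F, M.chowX F.1) := by
        rw [chowY_eq_sum, Finset.sum_mul, Finset.sum_mul, Finset.sum_eq_single F]
        · intro G hG hGF
          have heG : e ∉ G.1 := (Finset.mem_filter.1 hG).2
          by_cases hIG : ∀ f ∈ I, f.1 ∈ G.1
          swap
          · push Not at hIG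
            obtain ⟨f, hf, hfG⟩ := hIG
            rw [← Finset.mul_prod_erase I _ hf]
            have := M.chowY_mul_chowX f hfG
            linear_combination (∏ x ∈ I.erase f, M.chowY x) *
              (∏ F ∈ 𝓕.erase F, M.chowX F.1) * this
          have hFG : F.1 ⊆ G.1 := by
            rw [← hcl, G.2.1.subset_iff_closure_subset hp.indep.subset_ground]
            rintro _ ⟨f, hf, rfl⟩
            exact hIG f hf
          by_cases hcmp : ∀ H ∈ 𝓕.erase F, H.1 ⊆ G.1 ∨ G.1 ⊆ H.1
          swap
          · push Not at hcmp
            obtain ⟨H, hH, hHG, hGH⟩ := hcmp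
            rw [← Finset.mul_prod_erase (𝓕.erase F) _ hH]
            have := M.chowX_mul_chowX hGH hHG
            linear_combination (∏ x ∈ I, M.chowY x) *
              (∏ K ∈ (𝓕.erase F).erase H, M.chowX K.1) * this
          -- A surviving G ≠ F would extend the flag 𝓕 above F beyond its maximal length.
          exfalso
          have hG𝓕 : G ∉ 𝓕 := fun h ↦ heG (he G (Finset.mem_erase.2 ⟨hGF, h⟩))
          have h2 : ∀ H ∈ 𝓕, H.1 ⊆ G.1 ∨ G.1 ⊆ H.1 := fun H hH ↦ by
            by_cases hHF : H = F
            · rw [hHF]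
              exact Or.inl hFG
            · exact hcmp H (Finset.mem_erase.2 ⟨hHF, hH⟩)
          have h3 := M.card_flag_le (𝓕 := insert G 𝓕) (F := F.1) ?_ ?_
          · rw [Finset.card_insert_of_notMem hG𝓕] at h3
            omega
          · intro H hH K hK
            rcases Finset.mem_insert.1 hH with rfl | hH'
            · rcases Finset.mem_insert.1 hK with rfl | hK'
              · exact Or.inl subset_rfl
              · exact (h2 K hK').symm
            · rcases Finset.mem_insert.1 hK with rfl | hK'
              · exact h2 H hH'
              · exact hp.flag H hH' K hK'
          · intro H hH
            rcases Finset.mem_insert.1 hH with rfl | hH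
            exacts [hFG, hFsub H hH]
        · intro h
          exact absurd (Finset.mem_filter.2 ⟨Finset.mem_univ F, heF⟩) h
      rw [hsum]
      ring
    rw [h1]
    have hcardF : (𝓕.erase F).card + 1 = 𝓕.card := Finset.card_erase_add_one hF
    refine ih _ _ ?_ ⟨?_, ?_, ?_⟩ (by omega)
    · rw [Finset.card_insert_of_notMem heI]
      omega
    · rw [Finset.coe_insert, image_insert_eq]
      refine (hp.indep.insert_indep_iff).2 (Or.inl ⟨heE, ?_⟩)
      rwa [hcl]
    · intro G hG H hH
      exact hp.flag G (Finset.mem_erase.1 hG).2 H (Finset.mem_erase.1 hH).2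
    · intro f hf G hG
      rcases Finset.mem_insert.1 hf with rfl | hf
      · exact he G hG
      · exact hp.compatible f hf G (Finset.mem_erase.1 hG).2

/-- The degree map `CH^d(M) → ℚ`. -/
def degMap : M.chowGr M.natRank →ₗ[ℚ] ℚ := M.chowDeg.domRestrict _

theorem isDegreeMap_degMap : M.IsDegreeMap M.degMap := fun I 𝓕 h hp ↦
  M.chowDeg_monomial _ I 𝓕 h hp rfl

theorem IsDegreeMap.eq_degMap {deg : M.chowGr M.natRank →ₗ[ℚ] ℚ} (h : M.IsDegreeMap deg) :
    deg = M.degMap := by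
  -- CH^d is the line through the monomial y_B of a basis, on which both maps are 1.
  obtain ⟨B, hB⟩ := M.exists_isBase
  have hfin : B.Finite := M.ground_finite.subset hB.subset_ground
  let I : Finset ↥M.E := (hfin.preimage Subtype.val_injective.injOn).toFinset
  have hI : Subtype.val '' (I : Set ↥M.E) = B := by
    rw [Finite.coe_toFinset, image_preimage_eq_inter_range, Subtype.range_coe,
      inter_eq_left.2 hB.subset_ground]
  have hc : I.card + (∅ : Finset M.ProperFlat).card = M.natRank := by
    rw [Finset.card_empty, add_zero, ← ncard_coe_finset,
      ← ncard_image_of_injective _ Subtype.val_injective, hI, ← hB.indep.natRk_eq_ncard, natRk,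
      hB.eRk_eq_eRank, natRank]
  have hp : M.CompatiblePair I ∅ := ⟨by rw [hI]; exact hB.indep, by simp, by simp⟩
  have h1 := h I ∅ hc hp
  have h2 : M.degMap _ = 1 := M.isDegreeMap_degMap I ∅ hc hp
  have hmem := M.chowMonomial_mem I ∅ hc
  ext z
  have h3 : z = M.chowDeg z.1 • ⟨_, hmem⟩ := Subtype.ext (M.eq_smul_of_mem_chowGr hmem h2 z.2)
  rw [h3, map_smul, map_smul, h1, h2]

end

/-! ### The deletion homomorphism -/

instance deleteLoopless (M : Matroid α) [M.Loopless] (D : Set α) : (M ＼ D).Loopless :=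
  (M.delete_isRestriction D).loopless

section

variable (M : Matroid α) [M.Finite] (i : α)

theorem theta_chowMk (p : (M ＼ {i}).ChowPoly) :
    M.theta i ((M ＼ {i}).chowMk p) = aeval (M.thetaVar i) p := rfl

theorem theta_chowX (F : (M ＼ {i}).ProperFlat) :
    M.theta i ((M ＼ {i}).chowX F.1) = M.chowX F.1 + M.chowX (insert i F.1) := by
  rw [chowX_eq, theta_chowMk, aeval_X]
  rfl

theorem chowY_mem_chowGr (e : ↥M.E) : M.chowY e ∈ M.chowGr 1 :=
  ⟨_, isHomogeneous_X ℚ _, rfl⟩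

theorem theta_mem_chowGr {k : ℕ} {a : (M ＼ {i}).AugChow} (ha : a ∈ (M ＼ {i}).chowGr k) :
    M.theta i a ∈ M.chowGr k := by
  obtain ⟨p, hp, rfl⟩ := ha
  change M.theta i ((M ＼ {i}).chowMk p) ∈ _
  have h (v : ↥(M ＼ {i}).E ⊕ (M ＼ {i}).ProperFlat) : ∃ q : M.ChowPoly, q.IsHomogeneous 1 ∧
      M.chowMk q = M.thetaVar i v := by
    have h1 : M.thetaVar i v ∈ M.chowGr 1 := by
      rcases v with e | F
      · exact M.chowY_mem_chowGr _
      · exact add_mem (M.chowX_mem_chowGr _) (M.chowX_mem_chowGr _)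
    obtain ⟨q, hq, hq'⟩ := h1
    exact ⟨q, hq, hq'⟩
  choose q hq hq' using h
  refine ⟨aeval q p, ?_, ?_⟩
  · have := MvPolynomial.IsHomogeneous.aeval hp q hq
    simpa using this
  · rw [theta_chowMk]
    change M.chowMk (aeval q p) = _
    rw [← AlgHom.comp_apply, MvPolynomial.comp_aeval]
    congr 2
    exact funext hq'

theorem algebraMap_eq_theta (r : (M ＼ {i}).AugChow) :
    algebraMap (M ＼ {i}).AugChow M.AugChow r = M.theta i r := rfl

theorem smul_eq_theta_mul (r : (M ＼ {i}).AugChow) (z : M.AugChow) :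
    r • z = M.theta i r * z := by
  rw [Algebra.smul_def, algebraMap_eq_theta]

theorem exists_chowX_of_ne_zero {S : Set α} (h : M.chowX S ≠ 0) : M.IsFlat S ∧ S ≠ M.E := by
  by_contra h'
  exact h (M.chowX_of_not h')

/-- For S avoiding i, neither removing nor adding i changes whether a flat contains S, so the flats
G of M not containing S are sorted by G ∖ i. -/
theorem theta_chowH {S : Set α} (hS : S ⊆ (M ＼ {i}).E) :
    M.theta i ((M ＼ {i}).chowH S) = M.chowH S := by
  have hiS : i ∉ S := fun h ↦ (hS h).2 rfl
  have key (G : Set α) : S ⊆ G \ {i} ↔ S ⊆ G :=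
    ⟨fun h ↦ h.trans sdiff_subset, fun h ↦ subset_sdiff_singleton h hiS⟩
  have key' (G : Set α) : S ⊆ insert i G ↔ S ⊆ G := subset_insert_iff_of_notMem hiS
  have hf (G : M.ProperFlat) (hG : ¬ S ⊆ G.1) :
      (M ＼ {i}).IsFlat (G.1 \ {i}) ∧ G.1 \ {i} ≠ (M ＼ {i}).E :=
    ⟨IsFlat.delete i G.2.1, fun h ↦ hG ((key _).1 (hS.trans h.symm.subset))⟩
  rw [chowH, chowH, map_sum]
  simp only [theta_chowX]
  symm
  rw [Finset.sum_add_distrib,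
    ← Finset.sum_filter_add_sum_filter_not _ (fun G : M.ProperFlat ↦ i ∉ G.1)]
  congr 1
  · refine Finset.sum_bij_ne_zero (fun G hG _ ↦
      ⟨G.1 \ {i}, hf G (Finset.mem_filter.1 (Finset.mem_filter.1 hG).1).2⟩) ?_ ?_ ?_ ?_
    · intro G hG _
      have hG' := (Finset.mem_filter.1 (Finset.mem_filter.1 hG).1).2
      exact Finset.mem_filter.2 ⟨Finset.mem_univ _, fun h ↦ hG' ((key _).1 h)⟩
    · intro G hG _ G' hG' _ h
      have h' := congrArg Subtype.val h
      simp only [Finset.mem_filter, Finset.mem_univ, true_and] at hG hG'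
      simp only [sdiff_singleton_eq_self hG.2, sdiff_singleton_eq_self hG'.2] at h'
      exact Subtype.ext h'
    · intro F hF hne
      simp only [Finset.mem_filter, Finset.mem_univ, true_and] at hF
      refine ⟨⟨F.1, M.exists_chowX_of_ne_zero hne⟩, ?_, hne,
        Subtype.ext (sdiff_singleton_eq_self F.notMem)⟩
      exact Finset.mem_filter.2 ⟨Finset.mem_filter.2 ⟨Finset.mem_univ _, hF⟩, F.notMem⟩
    · intro G hG _
      simp only [Finset.mem_filter, Finset.mem_univ, true_and] at hG
      simp only [sdiff_singleton_eq_self hG.2]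
  · refine Finset.sum_bij_ne_zero (fun G hG _ ↦
      ⟨G.1 \ {i}, hf G (Finset.mem_filter.1 (Finset.mem_filter.1 hG).1).2⟩) ?_ ?_ ?_ ?_
    · intro G hG _
      have hG' := (Finset.mem_filter.1 (Finset.mem_filter.1 hG).1).2
      exact Finset.mem_filter.2 ⟨Finset.mem_univ _, fun h ↦ hG' ((key _).1 h)⟩
    · intro G hG _ G' hG' _ h
      have h' := congrArg Subtype.val h
      simp only [Finset.mem_filter, Finset.mem_univ, true_and, not_not] at hG hG'
      refine Subtype.ext ?_
      rw [← insert_sdiff_self_of_mem hG.2, ← insert_sdiff_self_of_mem hG'.2]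
      exact congrArg (insert i) h'
    · intro F hF hne
      simp only [Finset.mem_filter, Finset.mem_univ, true_and] at hF
      refine ⟨⟨insert i F.1, M.exists_chowX_of_ne_zero hne⟩, ?_, hne,
        Subtype.ext (insert_sdiff_self_of_notMem F.notMem)⟩
      exact Finset.mem_filter.2 ⟨Finset.mem_filter.2 ⟨Finset.mem_univ _, fun h ↦
        hF ((key' _).1 h)⟩, not_not.2 (mem_insert i _)⟩
    · intro G hG _
      simp only [Finset.mem_filter, Finset.mem_univ, true_and, not_not] at hG
      simp only [insert_sdiff_self_of_mem hG.2]

theorem theta_chowHProd {s : Multiset (Set α)} (hs : ∀ S ∈ s, (M ＼ {i}).IsFlat S) :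
    M.theta i ((M ＼ {i}).chowHProd s) = M.chowHProd (s.map M.closure) := by
  induction s using Multiset.induction_on with
  | empty => simp
  | cons S s ih =>
    have hS : S ⊆ (M ＼ {i}).E := (hs S (by simp)).subset_ground
    rw [chowHProd_cons, map_mul, Multiset.map_cons, chowHProd_cons,
      ih fun T hT ↦ hs T (by simp [hT]), theta_chowH _ _ hS,
      M.chowH_closure (hS.trans (M.delete_isRestriction {i}).subset)]

variable [M.Loopless]

/-- A nonzero degree would need F ∪ i tight. The factors are closures of sets avoiding i, so as many
lie in F as in F ∪ i, violating the inequality at the flat F of smaller rank. -/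
theorem chowDeg_chowX_insert_mul_theta {F : Set α} (hF : F ∈ M.deletionFlats i)
    (r : (M ＼ {i}).AugChow) : M.chowDeg (M.chowX (insert i F) * M.theta i r) = 0 := by
  obtain ⟨hFE, hF, hF'⟩ := hF
  have hiF : i ∉ F := fun h ↦ (hFE.subset h).2 rfl
  have hr := (M ＼ {i}).mem_span_chowHProd r
  induction hr using Submodule.span_induction with
  | zero => simp
  | add x y _ _ hx hy => rw [map_add, mul_add, map_add, hx, hy, add_zero]
  | smul a x _ hx => rw [map_smul, mul_smul_comm, map_smul, hx, smul_zero]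
  | mem x hx =>
    obtain ⟨s, hs, rfl⟩ := hx
    rw [theta_chowHProd M i hs]
    by_contra h
    obtain ⟨-, h1, h2⟩ := M.of_chowDeg_chowX_mul_ne_zero (fun S hS ↦ by
      obtain ⟨T, -, rfl⟩ := Multiset.mem_map.1 hS
      exact M.isFlat_closure T) h
    have h3 : (s.map M.closure).countP (· ⊆ insert i F) = (s.map M.closure).countP (· ⊆ F) := by
      refine Multiset.countP_congr rfl fun S hS ↦ ?_
      obtain ⟨T, hT, rfl⟩ := Multiset.mem_map.1 hS
      have hTE : T ⊆ (M ＼ {i}).E := (hs T hT).subset_ground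
      have hTE' : T ⊆ M.E := hTE.trans sdiff_subset
      rw [hF.subset_iff_closure_subset hTE', hF'.subset_iff_closure_subset hTE',
        subset_insert_iff_of_notMem fun h ↦ (hTE h).2 rfl]
    have h4 := h1 F hF
    have h5 := hF.natRk_lt (ssubset_insert hiF) hF'.subset_ground
    omega

theorem IsColoop.isFlat_sdiff {M : Matroid α} {i : α} (h : M.IsColoop i) :
    M.IsFlat (M.E \ {i}) := by
  rw [isFlat_iff_closure_eq]
  refine subset_antisymm (fun x hx ↦ ⟨M.closure_subset_ground _ hx, ?_⟩)
    (M.subset_closure _ sdiff_subset)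
  rintro rfl
  exact (isColoop_iff_notMem_closure_compl h.mem_ground).1 h hx

/-- All factors lie in the flat E∖i, whose rank is less than the d factors required. -/
theorem IsColoop.chowDeg_theta {M : Matroid α} [M.Finite] [M.Loopless] {i : α}
    (h : M.IsColoop i) (r : (M ＼ {i}).AugChow) : M.chowDeg (M.theta i r) = 0 := by
  have hfl := h.isFlat_sdiff
  have hr := (M ＼ {i}).mem_span_chowHProd r
  induction hr using Submodule.span_induction with
  | zero => simp
  | add x y _ _ hx hy => rw [map_add, map_add, hx, hy, add_zero]
  | smul a x _ hx => rw [map_smul, map_smul, hx, smul_zero]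
  | mem x hx =>
    obtain ⟨s, hs, rfl⟩ := hx
    rw [theta_chowHProd M i hs, chowDeg_chowHProd, if_neg]
    · rintro ⟨h1, h2⟩
      have h3 := h2 _ hfl
      have h4 := hfl.natRk_lt (sdiff_singleton_ssubset.2 h.mem_ground) subset_rfl
      rw [natRk_ground] at h4
      rw [Multiset.countP_eq_card.2] at h3
      · omega
      intro S hS
      obtain ⟨T, hT, rfl⟩ := Multiset.mem_map.1 hS
      have hTE : T ⊆ (M ＼ {i}).E := (hs T hT).subset_ground
      rw [hfl.subset_iff_closure_subset (hTE.trans sdiff_subset)]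
      exact hTE
    · intro S hS
      obtain ⟨T, -, rfl⟩ := Multiset.mem_map.1 hS
      exact M.isFlat_closure T

end

/-! ### Products of the generators of the summands -/

section

variable (M : Matroid α) [M.Finite] (i : α)

theorem deletionFlats_notMem {M : Matroid α} {i : α} {F : Set α} (hF : F ∈ M.deletionFlats i) :
    i ∉ F := fun h ↦ (hF.1.subset h).2 rfl

theorem isFlat_delete_of_notMem {M : Matroid α} {i : α} {F : Set α} (hF : M.IsFlat F)
    (hi : i ∉ F) : (M ＼ {i}).IsFlat F := by
  have h := hF.delete i
  rwa [sdiff_singleton_eq_self hi] at h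

theorem theta_chowX_of_isFlat {F : Set α} (hF : (M ＼ {i}).IsFlat F) (hF' : F ≠ M.E \ {i}) :
    M.theta i ((M ＼ {i}).chowX F) = M.chowX F + M.chowX (insert i F) := by
  obtain ⟨P, rfl⟩ : ∃ P : (M ＼ {i}).ProperFlat, P.1 = F := ⟨⟨F, hF, hF'⟩, rfl⟩
  exact M.theta_chowX i P

theorem theta_chowX_deletionFlats {F : Set α} (hF : F ∈ M.deletionFlats i) :
    M.theta i ((M ＼ {i}).chowX F) = M.chowX F + M.chowX (insert i F) :=
  M.theta_chowX_of_isFlat i (isFlat_delete_of_notMem hF.2.1 (deletionFlats_notMem hF)) hF.1.ne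

/-- The extra term in θ_i(x_G) is x_G, and G is incomparable with F ∪ i. -/
theorem chowX_insert_mul_of_ssubset {F G : Set α} (hG : G ∈ M.deletionFlats i) (h : F ⊂ G) :
    M.chowX (insert i F) * M.chowX (insert i G) =
      M.chowX (insert i F) * M.theta i ((M ＼ {i}).chowX G) := by
  have hiG := deletionFlats_notMem hG
  rw [M.theta_chowX_deletionFlats i hG, mul_add,
    M.chowX_mul_chowX (fun h' ↦ hiG (h' (mem_insert i F)))
      fun h' ↦ h.2 ((subset_insert_iff_of_notMem hiG).1 h'), zero_add]

theorem chowX_insert_mul_chowX_insert {F G : Set α} (hF : F ∈ M.deletionFlats i)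
    (hG : G ∈ M.deletionFlats i) (h : F ≠ G) :
    ∃ H ∈ M.deletionFlats i, ∃ t, M.chowX (insert i F) * M.chowX (insert i G) =
      M.chowX (insert i H) * M.theta i t := by
  by_cases h₁ : F ⊆ G
  · exact ⟨F, hF, _, M.chowX_insert_mul_of_ssubset i hG (h₁.ssubset_of_ne h)⟩
  by_cases h₂ : G ⊆ F
  · exact ⟨G, hG, _, (mul_comm _ _).trans
      (M.chowX_insert_mul_of_ssubset i hF (h₂.ssubset_of_ne h.symm))⟩
  · refine ⟨F, hF, 0, ?_⟩
    rw [map_zero, mul_zero]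
    exact M.chowX_mul_chowX
      (fun h ↦ h₁ ((insert_subset_insert_iff (deletionFlats_notMem hF)).1 h))
      (fun h ↦ h₂ ((insert_subset_insert_iff (deletionFlats_notMem hG)).1 h))

theorem chowX_sdiff_mul_chowX_insert {F : Set α} (hF : F ⊂ M.E \ {i}) :
    M.chowX (M.E \ {i}) * M.chowX (insert i F) = 0 :=
  M.chowX_mul_chowX (fun h ↦ hF.2 ((subset_insert_iff_of_notMem (by simp)).1 h))
    fun h ↦ (h (mem_insert i F)).2 rfl

/-- Modulo the image of `θ_i`, every class `x_G` is `± x_{H ∪ i}` with `H ∈ 𝒮_i`, or `x_{E ∖ i}`,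
or zero. -/
theorem chowX_cases (G : Set α) :
    (∃ r, M.chowX G = M.theta i r) ∨ G = M.E \ {i} ∨ (∃ H ∈ M.deletionFlats i, G = insert i H) ∨
      ∃ H ∈ M.deletionFlats i, G = H ∧ ∃ r, M.chowX G = M.theta i r - M.chowX (insert i H) := by
  by_cases hG : M.IsFlat G ∧ G ≠ M.E
  swap
  · exact Or.inl ⟨0, by rw [M.chowX_of_not hG, map_zero]⟩
  obtain ⟨hG, hGE⟩ := hG
  by_cases hiG : i ∈ G
  · have hins : insert i (G \ {i}) = G := insert_sdiff_self_of_mem hiG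
    have hne : G \ {i} ≠ M.E \ {i} := fun h ↦ hGE <| by
      rw [← hins, h, insert_sdiff_self_of_mem (hG.subset_ground hiG)]
    by_cases hF : M.IsFlat (G \ {i})
    · refine Or.inr (Or.inr (Or.inl ⟨G \ {i}, ⟨?_, hF, by rwa [hins]⟩, hins.symm⟩))
      exact (sdiff_subset_sdiff_left hG.subset_ground).ssubset_of_ne hne
    · refine Or.inl ⟨(M ＼ {i}).chowX (G \ {i}), ?_⟩
      rw [M.theta_chowX_of_isFlat i (hG.delete i) hne, hins, M.chowX_of_not fun h ↦ hF h.1,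
        zero_add]
  · by_cases hne : G = M.E \ {i}
    · exact Or.inr (Or.inl hne)
    have hth := M.theta_chowX_of_isFlat i (isFlat_delete_of_notMem hG hiG) hne
    by_cases hF : M.IsFlat (insert i G)
    · refine Or.inr (Or.inr (Or.inr ⟨G, ⟨?_, hG, hF⟩, rfl, _, eq_sub_of_add_eq hth.symm⟩))
      exact (subset_sdiff_singleton hG.subset_ground hiG).ssubset_of_ne hne
    · refine Or.inl ⟨(M ＼ {i}).chowX G, ?_⟩
      rw [hth, M.chowX_of_not fun h ↦ hF h.1, add_zero]

variable {i}

/-- The relation y_i x_{E∖i} = 0 expresses the square through products with x_G for smaller G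
avoiding i. There x_G may be replaced by θ_i(x_G), because x_{E∖i} x_{G∪i} = 0. -/
theorem exists_chowX_sdiff_mul_self (hi : i ∈ M.E) : ∃ t,
    M.chowX (M.E \ {i}) * M.chowX (M.E \ {i}) = M.chowX (M.E \ {i}) * M.theta i t := by
  by_cases hw : M.IsFlat (M.E \ {i}) ∧ M.E \ {i} ≠ M.E
  swap
  · exact ⟨0, by rw [M.chowX_of_not hw, zero_mul, zero_mul]⟩
  obtain ⟨W, hW⟩ : ∃ P : M.ProperFlat, P.1 = M.E \ {i} := ⟨⟨_, hw⟩, rfl⟩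
  have h := M.chowY_mul_chowX ⟨i, hi⟩ (S := M.E \ {i}) (by simp)
  rw [chowY_eq_sum, ← Finset.add_sum_erase _ _ (a := W) (by simp [hW]), add_mul, hW] at h
  refine ⟨-∑ G ∈ (Finset.univ.filter fun F : M.ProperFlat ↦ i ∉ F.1).erase W,
    (M ＼ {i}).chowX G.1, ?_⟩
  rw [eq_neg_of_add_eq_zero_left h, map_neg, map_sum, mul_neg, mul_comm, Finset.mul_sum,
    Finset.mul_sum]
  congr 1
  refine Finset.sum_congr rfl fun G hG ↦ ?_
  simp only [Finset.mem_erase, Finset.mem_filter, Finset.mem_univ, true_and] at hG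
  have hne : G.1 ≠ M.E \ {i} := fun h' ↦ hG.1 (Subtype.ext (h'.trans hW.symm))
  rw [M.theta_chowX_of_isFlat i (isFlat_delete_of_notMem G.2.1 hG.2) hne,
    mul_add, M.chowX_sdiff_mul_chowX_insert i, add_zero]
  exact (subset_sdiff_singleton G.2.1.subset_ground hG.2).ssubset_of_ne hne

end

/-! ### The sum of the summands -/

section

variable (M : Matroid α) [M.Finite] (i : α)

/-- The generators of the summands. -/
def summandGen : Fin 2 ⊕ ↥(M.deletionFlats i) → M.AugChow :=
  Sum.elim ![1, M.chowX (M.E \ {i})] (fun F ↦ M.chowX (insert i F.1))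

theorem mulChowImage_eq_span (a : M.AugChow) :
    M.mulChowImage i a = Submodule.span (M ＼ {i}).AugChow {a} := by
  ext z
  rw [Submodule.mem_span_singleton]
  constructor
  · rintro ⟨_, ⟨r, rfl⟩, rfl⟩
    exact ⟨r, by rw [smul_eq_theta_mul, mul_comm]; rfl⟩
  · rintro ⟨r, rfl⟩
    exact ⟨_, ⟨r, rfl⟩, by rw [smul_eq_theta_mul, mul_comm]; rfl⟩

theorem chowImage_eq_span : M.chowImage i = Submodule.span (M ＼ {i}).AugChow {1} := by
  rw [← mulChowImage_eq_span, mulChowImage, LinearMap.mulLeft_one, Submodule.map_id]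

theorem summandColoop_eq_span (p : Fin 2 ⊕ ↥(M.deletionFlats i)) :
    M.summandColoop i p = Submodule.span (M ＼ {i}).AugChow {M.summandGen i p} := by
  rcases p with p | F
  · fin_cases p
    · exact M.chowImage_eq_span i
    · exact M.mulChowImage_eq_span i _
  · exact M.mulChowImage_eq_span i _

theorem mem_summandColoop {p : Fin 2 ⊕ ↥(M.deletionFlats i)} {z : M.AugChow} :
    z ∈ M.summandColoop i p ↔ ∃ r, z = M.summandGen i p * M.theta i r := by
  rw [summandColoop_eq_span, Submodule.mem_span_singleton]
  simp only [smul_eq_theta_mul, mul_comm (M.summandGen i p), eq_comm]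

theorem summand_eq_summandColoop (p : Unit ⊕ ↥(M.deletionFlats i)) :
    M.summand i p = M.summandColoop i (Sum.map (fun _ ↦ 0) id p) := by
  rcases p with p | F <;> rfl

theorem mul_theta_mem {N : Submodule (M ＼ {i}).AugChow M.AugChow} {a : M.AugChow} (ha : a ∈ N)
    (r : (M ＼ {i}).AugChow) : a * M.theta i r ∈ N := by
  rw [mul_comm, ← smul_eq_theta_mul]
  exact N.smul_mem r ha

theorem eq_top_of_chowX_mem {S : Subalgebra ℚ M.AugChow} (h : ∀ F, M.chowX F ∈ S) (z : M.AugChow) :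
    z ∈ S := by
  obtain ⟨p, rfl⟩ := M.chowMk_surjective z
  induction p using MvPolynomial.induction_on with
  | C a => exact (M.chowMk.commutes a) ▸ S.algebraMap_mem a
  | add p q hp hq => rw [map_add]; exact add_mem hp hq
  | mul_X p v hp =>
    rw [map_mul]
    refine mul_mem hp ?_
    rcases v with e | F
    · change M.chowY e ∈ S
      rw [chowY_eq_sum]
      exact sum_mem fun F _ ↦ h F.1
    · rw [← chowX_eq]
      exact h F.1

/-- Every x_G lies in the span N, so it is enough that N is a subalgebra, that is, that products of
two generators stay in N. The one delicate product is the square of x_{F∪i}. -/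
theorem span_summandGen_eq_top (hi : i ∈ M.E) :
    Submodule.span (M ＼ {i}).AugChow (range (M.summandGen i)) = ⊤ := by
  set N := Submodule.span (M ＼ {i}).AugChow (range (M.summandGen i)) with hN
  have h1 : (1 : M.AugChow) ∈ N := Submodule.subset_span ⟨Sum.inl 0, rfl⟩
  have hw : M.chowX (M.E \ {i}) ∈ N := Submodule.subset_span ⟨Sum.inl 1, rfl⟩
  have hz (F) (hF : F ∈ M.deletionFlats i) : M.chowX (insert i F) ∈ N :=
    Submodule.subset_span ⟨Sum.inr ⟨F, hF⟩, rfl⟩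
  have hθ (r) : M.theta i r ∈ N := by simpa using M.mul_theta_mem i h1 r
  have hx (G : Set α) : M.chowX G ∈ N := by
    obtain ⟨r, hr⟩ | rfl | ⟨H, hH, rfl⟩ | ⟨H, hH, -, r, hr⟩ := M.chowX_cases i G
    · exact hr ▸ hθ r
    · exact hw
    · exact hz H hH
    · exact hr ▸ sub_mem (hθ r) (hz H hH)
  have hzz (F) (hF : F ∈ M.deletionFlats i) (G) (hG : G ∈ M.deletionFlats i) (hFG : F ≠ G) :
      M.chowX (insert i F) * M.chowX (insert i G) ∈ N := by
    obtain ⟨H, hH, t, ht⟩ := M.chowX_insert_mul_chowX_insert i hF hG hFG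
    exact ht ▸ M.mul_theta_mem i (hz H hH) t
  have hxF (F) (hF : F ∈ M.deletionFlats i) :
      M.chowX F = M.theta i ((M ＼ {i}).chowX F) - M.chowX (insert i F) :=
    eq_sub_of_add_eq (M.theta_chowX_deletionFlats i hF).symm
  have hxz (F) (hF : F ∈ M.deletionFlats i) (G) (hG : G ∈ M.deletionFlats i) (hFG : F ≠ G) :
      M.chowX F * M.chowX (insert i G) ∈ N := by
    rw [hxF F hF, sub_mul]
    refine sub_mem ?_ (hzz F hF G hG hFG)
    rw [mul_comm]
    exact M.mul_theta_mem i (hz G hG) _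
  have hxx (F) (hF : F ∈ M.deletionFlats i) (G : Set α) (h₁ : G ≠ F) (h₂ : G ≠ insert i F) :
      M.chowX F * M.chowX G ∈ N := by
    obtain ⟨r, hr⟩ | rfl | ⟨H, hH, rfl⟩ | ⟨H, hH, rfl, r, hr⟩ := M.chowX_cases i G
    · exact hr ▸ M.mul_theta_mem i (hx F) r
    · rw [hxF F hF, sub_mul, mul_comm (M.chowX (insert i F)),
        M.chowX_sdiff_mul_chowX_insert i hF.1, sub_zero, mul_comm]
      exact M.mul_theta_mem i hw _
    · exact hxz F hF H hH fun h ↦ h₂ (h ▸ rfl)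
    · rw [hr, mul_sub]
      exact sub_mem (M.mul_theta_mem i (hx F) r) (hxz F hF G hH h₁.symm)
  -- Subtract y_i x_F = 0 from y_f x_F = 0 for some f ∉ F ∪ i. The flats avoiding both i and f
  -- cancel, including the term x_F², and x_F x_{F∪i} is the only remaining product not already
  -- known to lie in N.
  have hself (F) (hF : F ∈ M.deletionFlats i) : M.chowX F * M.chowX (insert i F) ∈ N := by
    obtain ⟨f, ⟨hfE, hfi⟩, hfF⟩ := exists_of_ssubset hF.1
    have hiF := deletionFlats_notMem hF
    have e1 := M.chowY_mul_chowX ⟨i, hi⟩ (S := F) hiF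
    have e2 := M.chowY_mul_chowX ⟨f, hfE⟩ (S := F) hfF
    rw [chowY_eq_sum, Finset.sum_mul] at e1 e2
    rw [← Finset.sum_filter_add_sum_filter_not _ (fun G : M.ProperFlat ↦ f ∉ G.1)] at e1
    rw [← Finset.sum_filter_add_sum_filter_not _ (fun G : M.ProperFlat ↦ i ∉ G.1)] at e2
    rw [Finset.filter_filter, Finset.filter_filter] at e1 e2
    obtain ⟨P, hP⟩ : ∃ P : M.ProperFlat, P.1 = insert i F := by
      refine ⟨⟨insert i F, hF.2.2, fun h ↦ ?_⟩, rfl⟩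
      rcases h.symm.subset hfE with h | h
      · exact hfi h
      · exact hfF h
    rw [← Finset.add_sum_erase (Finset.filter (fun G : M.ProperFlat ↦ f ∉ G.1 ∧ ¬ i ∉ G.1) _) _
      (a := P)] at e2
    swap
    · rw [Finset.mem_filter, hP]
      exact ⟨Finset.mem_univ _, by rintro (h | h); exacts [hfi h, hfF h], by simp⟩
    have e3 : (∑ G : M.ProperFlat with f ∉ G.1 ∧ i ∉ G.1, M.chowX G.1 * M.chowX F) =
        ∑ G : M.ProperFlat with i ∉ G.1 ∧ f ∉ G.1, M.chowX G.1 * M.chowX F :=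
      Finset.sum_congr (by ext; simp [and_comm]) fun _ _ ↦ rfl
    rw [hP, e3] at e2
    have e4 : M.chowX F * M.chowX (insert i F) =
        (∑ G : M.ProperFlat with i ∉ G.1 ∧ ¬ f ∉ G.1, M.chowX G.1 * M.chowX F) -
        ∑ G ∈ (Finset.univ.filter fun G : M.ProperFlat ↦ f ∉ G.1 ∧ ¬ i ∉ G.1).erase P,
          M.chowX G.1 * M.chowX F := by
      linear_combination e2 - e1
    rw [e4]
    refine sub_mem (sum_mem fun G hG ↦ ?_) (sum_mem fun G hG ↦ ?_)
    · simp only [Finset.mem_filter, Finset.mem_univ, true_and, not_not] at hG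
      rw [mul_comm]
      exact hxx F hF _ (fun h ↦ hfF (h ▸ hG.2)) (fun h ↦ hG.1 (h ▸ mem_insert i F))
    · simp only [Finset.mem_erase, Finset.mem_filter, Finset.mem_univ, true_and, not_not] at hG
      rw [mul_comm]
      exact hxx F hF _ (fun h ↦ hiF (h ▸ hG.2.2)) (fun h ↦ hG.1 (Subtype.ext (h.trans hP.symm)))
  have hgen (p q) : M.summandGen i p * M.summandGen i q ∈ N := by
    have hzw (F : ↥(M.deletionFlats i)) : M.chowX (M.E \ {i}) * M.chowX (insert i F.1) ∈ N := by
      rw [M.chowX_sdiff_mul_chowX_insert i F.2.1]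
      exact zero_mem _
    have hN' (p) : M.summandGen i p ∈ N := Submodule.subset_span ⟨p, rfl⟩
    have hl (q) : M.summandGen i (Sum.inl 0) * M.summandGen i q ∈ N := by
      change 1 * _ ∈ N
      rw [one_mul]
      exact hN' q
    rcases p with p | F <;> rcases q with q | G
    · fin_cases p <;> fin_cases q
      · exact hl _
      · exact hl _
      · rw [mul_comm]
        exact hl _
      · obtain ⟨t, ht⟩ := M.exists_chowX_sdiff_mul_self hi
        change M.chowX (M.E \ {i}) * M.chowX (M.E \ {i}) ∈ N
        exact ht ▸ M.mul_theta_mem i hw t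
    · fin_cases p
      · exact hl _
      · exact hzw G
    · rw [mul_comm]
      fin_cases q
      · exact hl _
      · exact hzw F
    · by_cases hFG : F.1 = G.1
      · obtain rfl := Subtype.ext hFG
        change M.chowX (insert i F.1) * M.chowX (insert i F.1) ∈ N
        have e : M.chowX (insert i F.1) * M.chowX (insert i F.1) =
            M.chowX (insert i F.1) * M.theta i ((M ＼ {i}).chowX F.1) -
              M.chowX F.1 * M.chowX (insert i F.1) := by
          rw [M.theta_chowX_deletionFlats i F.2]
          ring
        rw [e]
        exact sub_mem (M.mul_theta_mem i (hz _ F.2) _) (hself _ F.2)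
      · exact hzz _ F.2 _ G.2 hFG
  have hmul : N * N ≤ N := by
    rw [hN, Submodule.span_mul_span, Submodule.span_le]
    rintro _ ⟨_, ⟨p, rfl⟩, _, ⟨q, rfl⟩, rfl⟩
    exact hgen p q
  let S : Subalgebra ℚ M.AugChow :=
    { carrier := N
      mul_mem' := fun ha hb ↦ hmul (Submodule.mul_mem_mul ha hb)
      add_mem' := fun ha hb ↦ add_mem ha hb
      algebraMap_mem' := fun c ↦ by
        have := hθ (algebraMap ℚ _ c)
        rwa [AlgHom.commutes] at this }
  exact eq_top_iff.2 fun z _ ↦ M.eq_top_of_chowX_mem (S := S) hx z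

theorem iSup_summandColoop (hi : i ∈ M.E) : ⨆ p, M.summandColoop i p = ⊤ := by
  rw [← M.span_summandGen_eq_top i hi, Submodule.span_range_eq_iSup]
  simp only [summandColoop_eq_span]

end

/-! ### Orthogonality and independence of the summands -/

section

variable (M : Matroid α) [M.Finite] [M.Loopless] (i : α)

omit [M.Finite] [M.Loopless] in
variable {M i} in
theorem isColoop_of_isFlat_sdiff (hi : i ∈ M.E) (h : M.IsFlat (M.E \ {i})) : M.IsColoop i := by
  refine (isColoop_iff_notMem_closure_compl hi).2 fun h' ↦ ?_
  rw [h.closure] at h'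
  exact h'.2 rfl

theorem chowDeg_summandGen_inr_mul (F : ↥(M.deletionFlats i)) {q : Fin 2 ⊕ ↥(M.deletionFlats i)}
    (hq : q ≠ Sum.inr F) (r : (M ＼ {i}).AugChow) :
    M.chowDeg (M.summandGen i (Sum.inr F) * M.summandGen i q * M.theta i r) = 0 := by
  change M.chowDeg (M.chowX (insert i F.1) * _ * _) = 0
  rcases q with q | G
  · fin_cases q
    · change M.chowDeg (M.chowX (insert i F.1) * 1 * _) = 0
      rw [mul_one, M.chowDeg_chowX_insert_mul_theta i F.2]
    · change M.chowDeg (M.chowX (insert i F.1) * M.chowX (M.E \ {i}) * _) = 0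
      rw [mul_comm (M.chowX (insert i F.1)), M.chowX_sdiff_mul_chowX_insert i F.2.1, zero_mul,
        map_zero]
  · obtain ⟨H, hH, t, ht⟩ := M.chowX_insert_mul_chowX_insert i F.2 G.2
      fun h ↦ hq (congrArg Sum.inr (Subtype.ext h.symm))
    change M.chowDeg (M.chowX (insert i F.1) * M.chowX (insert i G.1) * _) = 0
    rw [ht, mul_assoc, ← map_mul, M.chowDeg_chowX_insert_mul_theta i hH]

theorem chowDeg_mul_of_mem_inr {F : ↥(M.deletionFlats i)} {q : Fin 2 ⊕ ↥(M.deletionFlats i)}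
    (hq : q ≠ Sum.inr F) {a b : M.AugChow} (ha : a ∈ M.summandColoop i (Sum.inr F))
    (hb : b ∈ M.summandColoop i q) : M.chowDeg (a * b) = 0 := by
  obtain ⟨r, rfl⟩ := (M.mem_summandColoop i).1 ha
  obtain ⟨s, rfl⟩ := (M.mem_summandColoop i).1 hb
  rw [mul_mul_mul_comm, ← map_mul, chowDeg_summandGen_inr_mul M i F hq]

theorem chowDeg_mul_of_mem {p q : Fin 2 ⊕ ↥(M.deletionFlats i)} (hpq : p ≠ q)
    (h : ¬ (p.isLeft ∧ q.isLeft)) {a b : M.AugChow} (ha : a ∈ M.summandColoop i p)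
    (hb : b ∈ M.summandColoop i q) : M.chowDeg (a * b) = 0 := by
  rcases p with p | F
  · rcases q with q | G
    · simp at h
    · rw [mul_comm]
      exact M.chowDeg_mul_of_mem_inr i hpq hb ha
  · exact M.chowDeg_mul_of_mem_inr i hpq.symm ha hb

theorem eq_zero_of_orthogonal_summandColoop (hi : i ∈ M.E) {z : M.AugChow}
    (h : ∀ p, ∀ a ∈ M.summandColoop i p, M.chowDeg (z * a) = 0) : z = 0 := by
  refine M.eq_zero_of_forall_chowDeg fun a ↦ ?_
  have ha : a ∈ ⨆ p, M.summandColoop i p := by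
    rw [M.iSup_summandColoop i hi]
    trivial
  induction ha using Submodule.iSup_induction' with
  | mem p a ha => exact h p a ha
  | zero => rw [mul_zero, map_zero]
  | add a b _ _ ha hb => rw [mul_add, map_add, ha, hb, add_zero]

/-- The image of `θ_i` meets `x_{E ∖ i}` times this image trivially. -/
theorem disjoint_summandColoop_inl (hi : i ∈ M.E) :
    Disjoint (M.summandColoop i (Sum.inl 0)) (M.summandColoop i (Sum.inl 1)) := by
  rw [Submodule.disjoint_def]
  intro z hz₀ hz₁
  have hl : M.summandGen i (Sum.inl 0) = 1 := rfl
  have hr : M.summandGen i (Sum.inl 1) = M.chowX (M.E \ {i}) := rfl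
  by_cases hc : M.IsColoop i
  · refine M.eq_zero_of_orthogonal_summandColoop i hi fun p a ha ↦ ?_
    rcases p with p | F
    · obtain ⟨r, hr⟩ := (M.mem_summandColoop i).1 ha
      obtain ⟨s, hs⟩ := (M.mem_summandColoop i).1 hz₀
      obtain ⟨s', hs'⟩ := (M.mem_summandColoop i).1 hz₁
      rw [hl, one_mul] at hs
      fin_cases p
      · change a = 1 * _ at hr
        rw [hs, hr, one_mul, ← map_mul, hc.chowDeg_theta]
      · change a = M.chowX (M.E \ {i}) * _ at hr
        change z = M.chowX (M.E \ {i}) * _ at hs'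
        obtain ⟨t, ht⟩ := M.exists_chowX_sdiff_mul_self hi
        -- Write w = x_{E∖i}. Writing z as w θ(s') lets w² = w θ(t) absorb the second w; writing it
        -- back as θ(s) puts the product in the image of θ, where the degree vanishes.
        have e : z * a = M.theta i (s * t * r) := by
          rw [map_mul, map_mul, ← hs, hs', hr]
          linear_combination M.theta i s' * M.theta i r * ht
        rw [e, hc.chowDeg_theta]
    · rw [mul_comm]
      exact M.chowDeg_mul_of_mem_inr i (by simp) ha hz₀
  -- Without a coloop, E∖i is not a flat and the second generator is zero.
  · obtain ⟨s, hs⟩ := (M.mem_summandColoop i).1 hz₁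
    rw [hs, hr, M.chowX_of_not, zero_mul]
    exact fun h ↦ hc (isColoop_of_isFlat_sdiff hi h.1)

theorem iSupIndep_summandColoop (hi : i ∈ M.E) : iSupIndep (M.summandColoop i) := by
  rw [iSupIndep_iff_finsetSum_eq_zero_imp_eq_zero]
  intro s v hv hsum
  -- This component is orthogonal to the other summands, and to its own because it is minus a sum of
  -- elements of the others. Duality gives zero.
  have hF (F : ↥(M.deletionFlats i)) (hF : Sum.inr F ∈ s) : v (Sum.inr F) = 0 := by
    refine M.eq_zero_of_orthogonal_summandColoop i hi fun q a ha ↦ ?_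
    by_cases hq : q = Sum.inr F
    · subst hq
      rw [← Finset.add_sum_erase _ _ hF] at hsum
      rw [eq_neg_of_add_eq_zero_left hsum, neg_mul, map_neg, Finset.sum_mul, map_sum,
        Finset.sum_eq_zero, neg_zero]
      intro p hp
      obtain ⟨hp, hps⟩ := Finset.mem_erase.1 hp
      rw [mul_comm]
      exact M.chowDeg_mul_of_mem_inr i hp ha (hv p hps)
    · exact M.chowDeg_mul_of_mem_inr i hq (hv _ hF) ha
  have hl (p q : Fin 2) (hpq : p ≠ q) :
      Disjoint (M.summandColoop i (Sum.inl p)) (M.summandColoop i (Sum.inl q)) := by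
    have h := M.disjoint_summandColoop_inl i hi
    fin_cases p <;> fin_cases q
    · exact absurd rfl hpq
    · exact h
    · exact h.symm
    · exact absurd rfl hpq
  rintro (p | F) hp
  · refine Submodule.disjoint_def.1 (hl p (p + 1) (by omega)) _ (hv _ hp) ?_
    rw [← Finset.add_sum_erase _ _ hp] at hsum
    rw [eq_neg_of_add_eq_zero_left hsum]
    refine neg_mem (sum_mem fun q hq ↦ ?_)
    obtain ⟨hq, hqs⟩ := Finset.mem_erase.1 hq
    rcases q with q | F
    · obtain rfl : q = p + 1 := by
        have : q ≠ p := fun h ↦ hq (congrArg _ h)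
        omega
      exact hv _ hqs
    · rw [hF F hqs]
      exact zero_mem _
  · exact hF F hp

/-! ### The summands are indecomposable, cyclic and graded -/

/-- A multiple of x_F equals h_E ^ d, which has degree 1. -/
theorem chowX_ne_zero {F : Set α} (hF : M.IsFlat F) (hFE : F ≠ M.E) : M.chowX F ≠ 0 := by
  intro h
  have h1 := M.chowH_pow_mul_chowX hF hFE
  have h2 := M.chowDeg_chowH_ground_pow
  rw [← h1, h, zero_mul, mul_zero, map_zero] at h2
  exact zero_ne_one h2

instance augChowNontrivial : Nontrivial M.AugChow := by
  refine ⟨1, 0, fun h ↦ ?_⟩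
  have h2 := M.chowDeg_chowH_ground_pow
  rw [← mul_one (M.chowH M.E ^ _), h, mul_zero, map_zero] at h2
  exact zero_ne_one h2

theorem exists_eq_algebraMap_add_isNilpotent (z : M.AugChow) :
    ∃ (c : ℚ) (n : M.AugChow), IsNilpotent n ∧ z = algebraMap ℚ M.AugChow c + n := by
  refine M.chowGr_induction (P := fun z ↦ ∃ (c : ℚ) (n : M.AugChow), IsNilpotent n ∧
    z = algebraMap ℚ M.AugChow c + n) ?_ ?_ z
  · rintro _ _ ⟨c, n, hn, rfl⟩ ⟨c', n', hn', rfl⟩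
    refine ⟨c + c', n + n', (Commute.all n n').isNilpotent_add hn hn', ?_⟩
    rw [map_add]
    ring
  · rintro (_ | k) a ha
    · obtain ⟨c, rfl⟩ := M.chowGr_zero_le a ha
      exact ⟨c, 0, IsNilpotent.zero, (add_zero _).symm⟩
    · refine ⟨0, a, ⟨M.natRank + 1, ?_⟩, by rw [map_zero, zero_add]⟩
      refine M.eq_zero_of_mem_chowGr ?_ (M.chowGr_pow_mem ha _)
      nlinarith

instance augChowIsLocalRing : IsLocalRing M.AugChow := by
  refine IsLocalRing.of_isUnit_or_isUnit_one_sub_self fun z ↦ ?_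
  obtain ⟨c, n, hn, rfl⟩ := M.exists_eq_algebraMap_add_isNilpotent z
  by_cases hc : c = 0
  · right
    rw [hc, map_zero, zero_add]
    exact hn.isUnit_one_sub
  · left
    exact hn.isUnit_add_left_of_commute ((isUnit_iff_ne_zero.2 hc).map (algebraMap ℚ M.AugChow))
      (Commute.all _ _)

omit [M.Loopless] in
-- Split the generator as r v + (1 − r) v. In a local ring r or 1 − r is a unit, so one of the two
-- pieces contains v and is everything.
theorem isIndecomposableSubmodule_span_singleton {R A : Type*} [CommRing R] [IsLocalRing R]
    [AddCommGroup A] [Module R A] {v : A} (hv : v ≠ 0) :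
    IsIndecomposableSubmodule (Submodule.span R {v}) := by
  refine ⟨fun h ↦ hv (Submodule.span_singleton_eq_bot.1 h), fun N₁ N₂ hd hs ↦ ?_⟩
  have key (N N' : Submodule R A) (hd : Disjoint N N') (hs : N ⊔ N' = Submodule.span R {v})
      (h : v ∈ N) : N' = ⊥ := by
    have h1 : N' ≤ N := (le_sup_right.trans hs.le).trans
      ((Submodule.span_singleton_le_iff_mem _ _).2 h)
    exact disjoint_self.1 (hd.mono_left h1)
  have hvs : v ∈ N₁ ⊔ N₂ := hs ▸ Submodule.mem_span_singleton_self v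
  obtain ⟨a, ha, b, hb, hab⟩ := Submodule.mem_sup.1 hvs
  obtain ⟨r, rfl⟩ := Submodule.mem_span_singleton.1 (hs ▸ Submodule.mem_sup_left ha)
  have hb' : b = (1 - r) • v := by
    rw [sub_smul, one_smul]
    exact eq_sub_of_add_eq' hab
  rcases IsLocalRing.isUnit_or_isUnit_one_sub_self r with h | h
  · exact Or.inr (key _ _ hd hs ((Submodule.smul_mem_iff_of_isUnit _ h).1 ha))
  · exact Or.inl (key _ _ hd.symm (sup_comm N₁ N₂ ▸ hs)
      ((Submodule.smul_mem_iff_of_isUnit _ h).1 (hb' ▸ hb)))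

omit [M.Loopless] in
theorem isGradedSubmodule_span_singleton {a : M.AugChow} {k : ℕ} (ha : a ∈ M.chowGr k) :
    IsGradedSubmodule (Submodule.span (M ＼ {i}).AugChow {a}) := by
  intro z hz
  obtain ⟨r, rfl⟩ := Submodule.mem_span_singleton.1 hz
  clear hz
  induction r using (M ＼ {i}).chowGr_induction with
  | hadd r s hr hs =>
    obtain ⟨c, hc, hcr⟩ := hr
    obtain ⟨c', hc', hcs⟩ := hs
    refine ⟨c + c', fun l ↦ ⟨add_mem (hc l).1 (hc' l).1, add_mem (hc l).2 (hc' l).2⟩, ?_⟩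
    rw [Finsupp.sum_add_index' (fun _ ↦ rfl) fun _ _ _ ↦ rfl, hcr, hcs, add_smul]
  | hgr l r hr =>
    refine ⟨Finsupp.single (l + k) (r • a), fun m ↦ ?_, Finsupp.sum_single_index rfl⟩
    rw [Finsupp.single_apply]
    split_ifs with h
    · refine ⟨?_, Submodule.smul_mem _ r (Submodule.mem_span_singleton_self a)⟩
      rw [smul_eq_theta_mul]
      exact M.chowGr_mul_mem h (M.theta_mem_chowGr i hr) ha
    · exact ⟨zero_mem _, zero_mem _⟩

omit [M.Loopless] in
theorem exists_summandGen_mem_chowGr (p : Fin 2 ⊕ ↥(M.deletionFlats i)) :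
    ∃ k, M.summandGen i p ∈ M.chowGr k := by
  rcases p with p | F
  · fin_cases p
    · refine ⟨0, ?_⟩
      change 1 ∈ M.chowGr 0
      simpa using M.chowGr_pow_mem (M.chowX_mem_chowGr ∅) 0
    · exact ⟨1, M.chowX_mem_chowGr _⟩
  · exact ⟨1, M.chowX_mem_chowGr _⟩

theorem summandGen_ne_zero (hi : i ∈ M.E) {p : Fin 2 ⊕ ↥(M.deletionFlats i)}
    (hp : p = Sum.inl 1 → M.IsColoop i) : M.summandGen i p ≠ 0 := by
  rcases p with p | F
  · fin_cases p
    · exact one_ne_zero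
    · exact M.chowX_ne_zero (hp rfl).isFlat_sdiff fun h ↦ (h.symm.subset hi).2 rfl
  · refine M.chowX_ne_zero F.2.2.2 fun h ↦ ?_
    obtain ⟨f, ⟨hfE, hfi⟩, hfF⟩ := exists_of_ssubset F.2.1
    rcases h.symm.subset hfE with h | h
    · exact hfi h
    · exact hfF h

theorem summandColoop_properties (hi : i ∈ M.E) {p : Fin 2 ⊕ ↥(M.deletionFlats i)}
    (hp : p = Sum.inl 1 → M.IsColoop i) :
    IsGradedSubmodule (M.summandColoop i p) ∧ (M.summandColoop i p).IsPrincipal ∧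
      IsIndecomposableSubmodule (M.summandColoop i p) := by
  rw [summandColoop_eq_span]
  obtain ⟨k, hk⟩ := M.exists_summandGen_mem_chowGr i p
  exact ⟨M.isGradedSubmodule_span_singleton i hk, ⟨_, rfl⟩,
    isIndecomposableSubmodule_span_singleton (M.summandGen_ne_zero i hi hp)⟩

variable {M i} in
theorem poincareOrthogonal_of_forall {N N' : Submodule (M ＼ {i}).AugChow M.AugChow}
    (h : ∀ a ∈ N, ∀ b ∈ N', M.chowDeg (a * b) = 0) : PoincareOrthogonal M.degMap N N' :=
  fun _ _ _ a b ha hb ↦ h a.1 ha b.1 hb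

theorem poincareOrthogonal_summandColoop {p q : Fin 2 ⊕ ↥(M.deletionFlats i)} (hpq : p ≠ q)
    (h : ¬ (p.isLeft ∧ q.isLeft)) :
    PoincareOrthogonal M.degMap (M.summandColoop i p) (M.summandColoop i q) :=
  poincareOrthogonal_of_forall fun _ ha _ hb ↦ M.chowDeg_mul_of_mem i hpq h ha hb

variable {M i} in
-- The witness is h_{E∖i} ^ (d−1) · x_{E∖i} = h_E ^ d, of degree 1; the first factor lies in the
-- image of θ_i.
theorem IsColoop.not_poincareOrthogonal (hc : M.IsColoop i) :
    ¬ PoincareOrthogonal M.degMap (M.summandColoop i (Sum.inl 0))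
      (M.summandColoop i (Sum.inl 1)) := by
  intro h
  have hfl := hc.isFlat_sdiff
  have hne : M.E \ {i} ≠ M.E := fun h ↦ (h.symm.subset hc.mem_ground).2 rfl
  have h1 := M.chowH_pow_mul_chowX hfl hne
  have hrk : M.natRk (M.E \ {i}) + 1 = M.natRank := by
    have h2 := hfl.natRk_lt (sdiff_singleton_ssubset.2 hc.mem_ground) subset_rfl
    have h3 := M.natRk_insert_le i (M.E \ {i})
    rw [insert_sdiff_self_of_mem hc.mem_ground] at h3
    rw [natRk_ground] at h2 h3
    omega
  have ha : M.chowH (M.E \ {i}) ^ M.natRk (M.E \ {i}) ∈ M.chowGr (M.natRk (M.E \ {i})) := by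
    simpa using M.chowGr_pow_mem (M.chowH_mem_chowGr (M.E \ {i})) (M.natRk (M.E \ {i}))
  have h2 := h _ 1 hrk ⟨_, ha⟩ ⟨_, M.chowX_mem_chowGr (M.E \ {i})⟩
    ((M.mem_summandColoop i).2 ⟨(M ＼ {i}).chowH (M.E \ {i}) ^ M.natRk (M.E \ {i}), by
      rw [map_pow, M.theta_chowH i (S := M.E \ {i}) subset_rfl]
      exact (one_mul _).symm⟩)
    ((M.mem_summandColoop i).2 ⟨1, by
      rw [map_one, mul_one]
      rfl⟩)
  change M.chowDeg (M.chowH (M.E \ {i}) ^ M.natRk (M.E \ {i}) * M.chowX (M.E \ {i})) = 0 at h2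
  rw [show M.natRank - M.natRk (M.E \ {i}) - 1 = 0 by omega, pow_zero, one_mul] at h1
  rw [mul_comm, h1, chowDeg_chowH_ground_pow] at h2
  exact one_ne_zero h2

theorem isInternal_summandColoop (hi : i ∈ M.E) : DirectSum.IsInternal (M.summandColoop i) :=
  DirectSum.isInternal_submodule_of_iSupIndep_of_iSup_eq_top (M.iSupIndep_summandColoop i hi)
    (M.iSup_summandColoop i hi)

variable {i} in
theorem isInternal_summand (hi : i ∈ M.E) (hc : ¬ M.IsColoop i) :
    DirectSum.IsInternal (M.summand i) := by
  have he : M.summand i = M.summandColoop i ∘ Sum.map (fun _ ↦ 0) id :=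
    funext (M.summand_eq_summandColoop i)
  have hinj : Function.Injective
      (Sum.map (fun _ : Unit ↦ (0 : Fin 2)) (id : ↥(M.deletionFlats i) → _)) :=
    Function.Injective.sumMap (fun _ _ _ ↦ rfl) Function.injective_id
  refine DirectSum.isInternal_submodule_of_iSupIndep_of_iSup_eq_top ?_ ?_
  · rw [he]
    exact (M.iSupIndep_summandColoop i hi).comp hinj
  · refine eq_top_iff.2 ((M.iSup_summandColoop i hi).symm.le.trans (iSup_le fun p ↦ ?_))
    rcases p with p | F
    · fin_cases p
      · exact le_iSup (M.summand i) (Sum.inl ())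
      · refine le_of_eq_of_le ?_ bot_le
        rw [summandColoop_eq_span, Submodule.span_singleton_eq_bot]
        exact M.chowX_of_not fun h ↦ hc (isColoop_of_isFlat_sdiff hi h.1)
    · exact le_iSup (M.summand i) (Sum.inr F)

end

end Matroid

end

open scoped Classical in
theorem theorem1p2 {α : Type*} (M : Matroid α) [M.Finite] [M.Loopless] (i : α) (hi : i ∈ M.E) :
    ∃ deg : M.chowGr M.natRank →ₗ[ℚ] ℚ,
      M.IsDegreeMap deg ∧ (∀ deg', M.IsDegreeMap deg' → deg' = deg) ∧
      (¬ M.IsColoop i →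
        DirectSum.IsInternal (M.summand i) ∧
        (∀ p, Matroid.IsGradedSubmodule (M.summand i p) ∧ (M.summand i p).IsPrincipal ∧
          Matroid.IsIndecomposableSubmodule (M.summand i p)) ∧
        (∀ p q, p ≠ q → Matroid.PoincareOrthogonal deg (M.summand i p) (M.summand i q))) ∧
      (M.IsColoop i →
        DirectSum.IsInternal (M.summandColoop i) ∧
        (∀ p, Matroid.IsGradedSubmodule (M.summandColoop i p) ∧
          (M.summandColoop i p).IsPrincipal ∧
          Matroid.IsIndecomposableSubmodule (M.summandColoop i p)) ∧
        (∀ p q, p ≠ q → ¬ (p.isLeft ∧ q.isLeft) →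
          Matroid.PoincareOrthogonal deg (M.summandColoop i p) (M.summandColoop i q)) ∧
        ¬ Matroid.PoincareOrthogonal deg
          (M.summandColoop i (Sum.inl 0)) (M.summandColoop i (Sum.inl 1))) := by
  refine ⟨M.degMap, M.isDegreeMap_degMap, fun _ h ↦ h.eq_degMap, fun hc ↦
    ⟨M.isInternal_summand hi hc, fun p ↦ ?_, fun p q hpq ↦ ?_⟩, fun hc ↦
    ⟨M.isInternal_summandColoop i hi, fun p ↦ M.summandColoop_properties i hi fun _ ↦ hc,
      fun p q hpq h ↦ M.poincareOrthogonal_summandColoop i hpq h, hc.not_poincareOrthogonal⟩⟩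
  · rw [M.summand_eq_summandColoop]
    refine M.summandColoop_properties i hi ?_
    rcases p with _ | F <;> simp
  · rw [M.summand_eq_summandColoop, M.summand_eq_summandColoop]
    rcases p with _ | F <;> rcases q with _ | G
    · exact absurd rfl hpq
    · exact M.poincareOrthogonal_summandColoop i (by simp) (by simp)
    · exact M.poincareOrthogonal_summandColoop i (by simp) (by simp)
    · exact M.poincareOrthogonal_summandColoop i (by simpa using hpq) (by simp)
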